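/- Let $(\mathcal M,g)$ be a smooth 4-dimensional spacetime of signature $(-,+,+,+)$ with Levi-Civita connection $\nabla$, and let $\Delta\subset\mathcal M$ be a non-expanding horizon: an embedded null hypersurface, diffeomorphic to $B\times\mathcal I$ with $B$ a compact connected surface and $\mathcal I$ an open interval, whose null generators are the curves $\{b\}\times\mathcal I$ and whose null tangent fields $\ell$ satisfy $q^{AB}\mathcal L_\ell q_{AB}=0$, where $q$ is the induced degenerate metric. A *natural* vector field of $\Delta$ is a null field $\ell$ tangent to $\Delta$, non-zero on a dense subset, with $\nabla_\ell\ell=\ell$ and $q^{AB}N_{AB}=0$, where $[\mathcal L_\ell,D_a]X^b=\ell^bN_{ac}X^c$ and $D$ is the connection induced on $\Delta$. If there is exactly one natural field, it is called the *invariant vector field* of $\Delta$, and $\Delta$ is called invariant-generic. *Bondi-like neighbourhood.* Let $\mathcal M'\supset\Delta$ be an open set with smooth functions $v,r$ and smooth vector fields $n,\zeta$ such that $\zeta|_\Delta$ is tangent to $\Delta$ and null; $n$ is null, $\nabla_nn=0$, the pullback of $g(n,\cdot)$ to $\Delta$ is $-dv$, and every point of $\mathcal M'$ is joined to $\Delta$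 by an integral curve of $n$ in $\mathcal M'$; $[n,\zeta]=0$; $\zeta(v)=1$, $n(v)=0$; $n(r)=-1$, $r|_\Delta=0$. Bondi-like coordinates are local coordinates $(x^1,x^2,v,r)$ on $\mathcal M'$ such that $x^1,x^2$ are constant along $\zeta$ and $n$; in them $\zeta=\partial_v$ and $n=-\partial_r$. *Adapted null frame.* On an open subset of $\mathcal M'$ whose points are joined to $\Delta$ inside it by integral curves of $n$, let $(e_1,e_2,e_3,e_4)=(m,\bar m,n,\ell)$ be a null frame, with $g(m,\bar m)=1$, $g(n,\ell)=-1$ and all other products zero, such that on $\Delta$: $\ell=\zeta$, $m$ is tangent to the slices $v=\mathrm{const}$ of $\Delta$, and $\mathcal L_\zeta m=0$; and such that $\nabla_nm=\nabla_n\ell=0$. Suppose that on $\mathcal M'$ the metric $g$ and a 2-form $F$ satisfy the source-free Einstein–Maxwell equations (with any cosmological constant), and that $K$ is a Killing vector field on $\mathcal M'$ with $\mathcal L_KF=0$ which is tangent to and null on $\Delta$. Suppose that either (a) $\Delta$ is invariant-generic, $\partial_v|_\Delta=\zeta|_\Delta$ is its invariant vector field, and $K\not\equiv0$ on $\mathcal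 M'$; or (b) $K|_\Delta=\partial_v|_\Delta=\zeta|_\Delta$. Then there is a constant $a\neq0$, with $a=1$ if $K|_\Delta=\partial_v|_\Delta$ (in particular in case (b)), such that $K=a\,\zeta$ throughout $\mathcal M'$; that is, $K=a\,\partial_v$ in all Bondi-like coordinates, and $K=\partial_v$ after rescaling $K$ by a constant. Moreover, in every Bondi-like coordinate chart contained in the domain of an adapted null frame, all the components $e_\mu{}^i$ $(\mu,i=1,\dots,4)$ of the frame vectors, all twelve Newman–Penrose spin coefficients $\sigma,\rho,\tau,\varkappa,\beta,\alpha,\gamma,\varepsilon,\mu,\lambda,\nu,\pi$, the Maxwell components $\Phi_0,\Phi_1,\Phi_2$ and the Weyl components $\Psi_0,\dots,\Psi_4$ of the frame are independent of $v$. -/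

import Mathlib

open scoped Manifold ContDiff Topology

noncomputable section

namespace KillingHorizon

/-- Model space of the spacetime manifold. -/
abbrev R4 : Type := EuclideanSpace ℝ (Fin 4)

/-- Model space of the base of the horizon. -/
abbrev R2 : Type := EuclideanSpace ℝ (Fin 2)

/-- Tangent space of the spacetime at a point. -/
abbrev Tan (M : Type*) [TopologicalSpace M] [ChartedSpace R4 M] (x : M) : Type :=
  TangentSpace 𝓘(ℝ, R4) x

/-- (Not necessarily smooth) vector fields on the spacetime. -/
abbrev VField (M : Type*) [TopologicalSpace M] [ChartedSpace R4 M] : Type _ :=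
  (x : M) → TangentSpace 𝓘(ℝ, R4) x

/-- (Not necessarily smooth) covariant 2-tensor fields on the spacetime. -/
abbrev BField (M : Type*) [TopologicalSpace M] [ChartedSpace R4 M] : Type _ :=
  (x : M) → (TangentSpace 𝓘(ℝ, R4) x →L[ℝ] TangentSpace 𝓘(ℝ, R4) x →L[ℝ] ℝ)

/-- Covariant derivatives on the tangent bundle; `D Y x (X x)` is `(∇_X Y)(x)`. -/
abbrev Conn (M : Type*) [TopologicalSpace M] [ChartedSpace R4 M] [IsManifold 𝓘(ℝ, R4) ∞ M] :
    Type _ :=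
  CovariantDerivative 𝓘(ℝ, R4) R4 (fun x : M => TangentSpace 𝓘(ℝ, R4) x)

section Calculus

variable {M : Type*} [TopologicalSpace M] [ChartedSpace R4 M] [IsManifold 𝓘(ℝ, R4) ∞ M]

/-- `X` is a smooth vector field on the open set `U`. -/
def SmoothOn (X : VField M) (U : Set M) : Prop :=
  ContMDiffOn 𝓘(ℝ, R4) 𝓘(ℝ, R4).tangent ∞
    (fun x => (⟨x, X x⟩ : TangentBundle 𝓘(ℝ, R4) M)) U

/-- `X` is smooth at the point `x`. -/
def SmoothAt (X : VField M) (x : M) : Prop :=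
  ContMDiffAt 𝓘(ℝ, R4) 𝓘(ℝ, R4).tangent ∞
    (fun y => (⟨y, X y⟩ : TangentBundle 𝓘(ℝ, R4) M)) x

/-- `X` is differentiable at the point `x`. -/
def DiffAt (X : VField M) (x : M) : Prop :=
  MDifferentiableAt 𝓘(ℝ, R4) 𝓘(ℝ, R4).tangent
    (fun y => (⟨y, X y⟩ : TangentBundle 𝓘(ℝ, R4) M)) x

/-- `T` is a smooth covariant 2-tensor field on the open set `U`. -/
def SmoothTensorOn (T : BField M) (U : Set M) : Prop :=
  ContMDiffOn 𝓘(ℝ, R4) (𝓘(ℝ, R4).prod 𝓘(ℝ, R4 →L[ℝ] R4 →L[ℝ] ℝ)) ∞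
    (fun x => Bundle.TotalSpace.mk' (R4 →L[ℝ] R4 →L[ℝ] ℝ)
      (E := fun x : M => (TangentSpace 𝓘(ℝ, R4) x →L[ℝ] TangentSpace 𝓘(ℝ, R4) x →L[ℝ] ℝ))
      x (T x)) U

/-- The differential of a real function. -/
def dFun (f : M → ℝ) (x : M) : TangentSpace 𝓘(ℝ, R4) x →L[ℝ] ℝ :=
  mvfderiv 𝓘(ℝ, R4) f x

/-- The Lie bracket of vector fields. -/
def bracket (X Y : VField M) : VField M :=
  VectorField.mlieBracket 𝓘(ℝ, R4) X Y

/-- `g` is a smooth metric of signature `(-,+,+,+)`. -/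
structure IsLorentzMetric (g : BField M) : Prop where
  smooth : SmoothTensorOn g Set.univ
  symm : ∀ (x : M) (u w : Tan M x), g x u w = g x w u
  signature : ∀ x : M, ∃ b : Fin 4 → Tan M x, ∀ i j : Fin 4,
    g x (b i) (b j) = if i = j then (if i = 0 then -1 else 1) else 0

/-- `D` is the Levi-Civita connection of `g`. -/
structure IsLeviCivita (g : BField M) (D : Conn M) : Prop where
  smooth : CovariantDerivative.ContMDiffCovariantDerivative D ∞
  torsion_free : ∀ (X Y : VField M) (x : M), DiffAt X x → DiffAt Y x →
    D Y x (X x) - D X x (Y x) = bracket X Y x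
  metric : ∀ (X Y : VField M) (x : M), DiffAt X x → DiffAt Y x → ∀ w : Tan M x,
    dFun (fun y => g y (X y) (Y y)) x w = g x (D X x w) (Y x) + g x (X x) (D Y x w)

/-- An extension of a tangent vector at `x` to a vector field that is smooth near `x`. -/
def extendVec {x : M} (u : Tan M x) : VField M :=
  FiberBundle.extend R4 u

/-- The curvature `R(X,Y)Z = ∇_X ∇_Y Z - ∇_Y ∇_X Z - ∇_[X,Y] Z`, on vector fields. -/
def curvature (D : Conn M) (X Y Z : VField M) (x : M) : Tan M x :=
  D (fun y => D Z y (Y y)) x (X x) - D (fun y => D Z y (X y)) x (Y x) - D Z x (bracket X Y x)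

/-- The curvature tensor `R(u,w)z` at a point. -/
def riemann (D : Conn M) (x : M) (u w z : Tan M x) : Tan M x :=
  curvature D (extendVec u) (extendVec w) (extendVec z) x

/-- A basis of the tangent space, used to take traces. -/
def stdVec (x : M) (i : Fin 4) : Tan M x := (EuclideanSpace.single i (1 : ℝ) : R4)

/-- Coefficients of a tangent vector in the basis `stdVec x`. -/
def stdCoord (x : M) (u : Tan M x) (i : Fin 4) : ℝ := (show R4 from u) i

/-- The components `g^{ij}` of the inverse metric in the basis `stdVec x`. -/
def invMetric (g : BField M) (x : M) : Matrix (Fin 4) (Fin 4) ℝ :=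
  (Matrix.of fun i j => g x (stdVec x i) (stdVec x j))⁻¹

/-- The Ricci tensor, `Ric(u,w) = trace (z ↦ R(z,w)u)`. -/
def ricci (D : Conn M) (x : M) (u w : Tan M x) : ℝ :=
  ∑ i, stdCoord x (riemann D x (stdVec x i) w u) i

/-- The scalar curvature. -/
def scalarCurv (g : BField M) (D : Conn M) (x : M) : ℝ :=
  ∑ i, ∑ j, invMetric g x i j * ricci D x (stdVec x i) (stdVec x j)

/-- The Weyl tensor `C_{abcd}` (dimension 4), with `R_{abcd} = g(a, R(c,d)b)`. -/
def weyl (g : BField M) (D : Conn M) (x : M) (a b c d : Tan M x) : ℝ :=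
  g x a (riemann D x c d b)
    - (1 / 2) * (g x a c * ricci D x b d - g x a d * ricci D x b c
        - g x b c * ricci D x a d + g x b d * ricci D x a c)
    + (scalarCurv g D x / 6) * (g x a c * g x b d - g x a d * g x b c)

/-- `(∇_w F)(u,z)` at a point. -/
def covF (D : Conn M) (F : BField M) (x : M) (w u z : Tan M x) : ℝ :=
  dFun (fun y => F y (extendVec u y) (extendVec z y)) x w - F x (D (extendVec u) x w) z - F x u (D (extendVec z) x w)

/-- The energy-momentum tensor of the electromagnetic field, up to the coupling constant:
`F_{uα} F_w^α - (1/4) g_{uw} F_{αβ} F^{αβ}`. -/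
def emTensor (g F : BField M) (x : M) (u w : Tan M x) : ℝ :=
  (∑ i, ∑ j, invMetric g x i j * (F x u (stdVec x i) * F x w (stdVec x j)))
    - (1 / 4) * g x u w * ∑ i, ∑ j, ∑ k, ∑ l, invMetric g x i k * invMetric g x j l *
        (F x (stdVec x i) (stdVec x j) * F x (stdVec x k) (stdVec x l))

/-- The Einstein-Maxwell equations without charges and currents on `U`, with coupling constant
`c` and cosmological constant `Λ`. -/
structure IsElectrovac (g : BField M) (D : Conn M) (F : BField M) (c Λ : ℝ) (U : Set M) :
    Prop where
  smooth : SmoothTensorOn F U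
  antisymm : ∀ x ∈ U, ∀ u w : Tan M x, F x u w = - F x w u
  closed : ∀ x ∈ U, ∀ u w z : Tan M x, covF D F x u w z + covF D F x w z u + covF D F x z u w = 0
  divergence_free : ∀ x ∈ U, ∀ z : Tan M x,
    ∑ i, ∑ j, invMetric g x i j * covF D F x (stdVec x i) (stdVec x j) z = 0
  einstein : ∀ x ∈ U, ∀ u w : Tan M x,
    ricci D x u w - (1 / 2) * scalarCurv g D x * g x u w + Λ * g x u w = c * emTensor g F x u w

/-- `K` is a Killing vector field on the open set `U`. -/
structure IsKillingOn (g : BField M) (D : Conn M) (K : VField M) (U : Set M) : Prop where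
  smooth : SmoothOn K U
  killing : ∀ x ∈ U, ∀ u w : Tan M x, g x (D K x u) w + g x u (D K x w) = 0

/-- The Lie derivative of the tensor field `F` along `K` vanishes on `U`. -/
def LieInvariantOn (K : VField M) (F : BField M) (U : Set M) : Prop :=
  ∀ x ∈ U, ∀ X Y : VField M, SmoothAt X x → SmoothAt Y x →
    dFun (fun y => F y (X y) (Y y)) x (K x)
      = F x (bracket K X x) (Y x) + F x (X x) (bracket K Y x)

end Calculus

section Horizon

variable {M : Type*} [TopologicalSpace M] [ChartedSpace R4 M] [IsManifold 𝓘(ℝ, R4) ∞ M]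
variable {B : Type*} [TopologicalSpace B] [ChartedSpace R2 B]

/-- The tangent space of the image of `Φ` at `Φ q`. -/
def horizonTangent (Φ : B × ℝ → M) (q : B × ℝ) : Submodule ℝ (Tan M (Φ q)) :=
  LinearMap.range (mfderiv (𝓘(ℝ, R2).prod 𝓘(ℝ, ℝ)) 𝓘(ℝ, R4) Φ q).toLinearMap

/-- The tangent vector at `Φ q` of the curve `t ↦ Φ (b, t)`. -/
def generator (Φ : B × ℝ → M) (q : B × ℝ) : Tan M (Φ q) :=
  mfderiv (𝓘(ℝ, R2).prod 𝓘(ℝ, ℝ)) 𝓘(ℝ, R4) Φ q ((0, 1) : R2 × ℝ)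

/-- Smooth vector fields tangent to the horizon. Such a field is represented by an extension to a
neighbourhood of the horizon; only its values on the horizon matter. -/
structure IsHorizonField (Φ : B × ℝ → M) (X : VField M) : Prop where
  smooth : ∃ U : Set M, IsOpen U ∧ Set.range Φ ⊆ U ∧ SmoothOn X U
  tangent : ∀ q, X (Φ q) ∈ horizonTangent Φ q

/-- Smooth null vector fields tangent to the horizon: sections of the null direction bundle. -/
structure IsNullHorizonField (g : BField M) (Φ : B × ℝ → M) (X : VField M) : Prop
    extends IsHorizonField Φ X where
  null : ∀ q, g (Φ q) (X (Φ q)) (X (Φ q)) = 0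

/-- The image of `Φ` is a non-expanding horizon with base `B`. (The open interval of the product
structure is parametrised by the real line; topological assumptions on `B` are made separately.)
`null_generators` says that the embedded hypersurface is null and that its null generators are the
curves `{b} × ℝ`. In `non_expanding`, `u, w` represent a `q`-orthonormal basis of the quotient of the
tangent space by the null direction, so that the left-hand side is `(1/2) q^{AB} (𝓛_ℓ q)_{AB}`. -/
structure IsNonExpandingHorizon (g : BField M) (D : Conn M) (Φ : B × ℝ → M) : Prop where
  embedding : Manifold.IsSmoothEmbedding (𝓘(ℝ, R2).prod 𝓘(ℝ, ℝ)) 𝓘(ℝ, R4) ∞ Φ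
  null_generators : ∀ q, ∀ w ∈ horizonTangent Φ q, g (Φ q) (generator Φ q) w = 0
  non_expanding : ∀ L : VField M, IsNullHorizonField g Φ L → ∀ q,
    ∀ u ∈ horizonTangent Φ q, ∀ w ∈ horizonTangent Φ q,
      g (Φ q) u u = 1 → g (Φ q) w w = 1 → g (Φ q) u w = 0 →
      g (Φ q) (D L (Φ q) u) u + g (Φ q) (D L (Φ q) w) w = 0

/-- `[𝓛_L, D_X] Y = [L, D_X Y] - D_[L,X] Y - D_X [L, Y]`. For fields tangent to the horizon this is
the commutator of the Lie derivative with the covariant derivative induced on the horizon. -/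
def lieConn (D : Conn M) (L X Y : VField M) (x : M) : Tan M x :=
  bracket L (fun y => D Y y (X y)) x - D Y x (bracket L X x) - D (bracket L Y) x (X x)

/-- Natural vector fields of the horizon geometry: tangent, null, non-vanishing on a dense (and
automatically open) subset, of surface gravity 1, and such that the tensor `N` defined by
`[𝓛_L, D_a] X^b = L^b N_{ac} X^c` has vanishing trace, `q^{AB} N_{AB} = 0`. The last condition is
written as `(q^{AB} N_{AB}) L = 0`, the trace being taken over orthonormal pairs. -/
structure IsNaturalField (g : BField M) (D : Conn M) (Φ : B × ℝ → M) (L : VField M) : Prop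
    extends IsNullHorizonField g Φ L where
  generic : Dense {q : B × ℝ | L (Φ q) ≠ 0}
  surface_gravity : ∀ q, D L (Φ q) (L (Φ q)) = L (Φ q)
  traceless : ∀ X Y : VField M, IsHorizonField Φ X → IsHorizonField Φ Y → ∀ q,
    g (Φ q) (X (Φ q)) (X (Φ q)) = 1 → g (Φ q) (Y (Φ q)) (Y (Φ q)) = 1 →
    g (Φ q) (X (Φ q)) (Y (Φ q)) = 0 →
    lieConn D L X X (Φ q) + lieConn D L Y Y (Φ q) = 0

/-- `L` is the invariant vector field of the horizon, that is, its unique natural vector field. The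
horizon is invariant-generic precisely if such an `L` exists. -/
structure IsInvariantField (g : BField M) (D : Conn M) (Φ : B × ℝ → M) (L : VField M) : Prop where
  natural : IsNaturalField g D Φ L
  unique : ∀ L' : VField M, IsNaturalField g D Φ L' → ∀ q, L' (Φ q) = L (Φ q)

/-- Every point of `U` is joined to the horizon by an integral curve of `n` that stays in `U`. -/
def SweptOut (Φ : B × ℝ → M) (n : VField M) (U : Set M) : Prop :=
  ∀ p ∈ U, ∃ (γ : ℝ → M) (s : ℝ), γ 0 ∈ Set.range Φ ∧ γ s = p ∧
    IsMIntegralCurveOn (I := 𝓘(ℝ, R4)) γ n (Set.uIcc 0 s) ∧ ∀ t ∈ Set.uIcc 0 s, γ t ∈ U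

/-- The Bondi-like extension of a null vector field of the horizon to a neighbourhood `U`. On the
horizon `ζ` is the given null field and `v` the given function with `ζ(v) = 1`; the transversal null
field `n` is the one whose covector pulls back to `-dv`, and it is extended geodesically. -/
structure IsBondiNeighbourhood (g : BField M) (D : Conn M) (Φ : B × ℝ → M) (U : Set M)
    (n ζ : VField M) (v r : M → ℝ) : Prop where
  isOpen : IsOpen U
  contains : Set.range Φ ⊆ U
  smooth_n : SmoothOn n U
  smooth_zeta : SmoothOn ζ U
  smooth_v : ContMDiffOn 𝓘(ℝ, R4) 𝓘(ℝ, ℝ) ∞ v U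
  smooth_r : ContMDiffOn 𝓘(ℝ, R4) 𝓘(ℝ, ℝ) ∞ r U
  zeta_tangent : ∀ q, ζ (Φ q) ∈ horizonTangent Φ q
  zeta_null : ∀ q, g (Φ q) (ζ (Φ q)) (ζ (Φ q)) = 0
  n_null : ∀ p ∈ U, g p (n p) (n p) = 0
  n_horizon : ∀ q, ∀ w ∈ horizonTangent Φ q, g (Φ q) (n (Φ q)) w = - dFun v (Φ q) w
  n_geodesic : ∀ p ∈ U, D n p (n p) = 0
  bracket_n_zeta : ∀ p ∈ U, bracket n ζ p = 0
  zeta_v : ∀ p ∈ U, dFun v p (ζ p) = 1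
  n_v : ∀ p ∈ U, dFun v p (n p) = 0
  n_r : ∀ p ∈ U, dFun r p (n p) = -1
  r_horizon : ∀ q, r (Φ q) = 0
  swept : SweptOut Φ n U

/-- The components of a tangent vector at `p` in the chart `e`. -/
def chartComp (e : OpenPartialHomeomorph M R4) (p : M) (u : Tan M p) (i : Fin 4) : ℝ :=
  (show R4 from mfderiv 𝓘(ℝ, R4) 𝓘(ℝ, R4) e p u) i

/-- The coordinate vector `∂_i` of the chart `e` at `p`. -/
def coordVec (e : OpenPartialHomeomorph M R4) (i : Fin 4) (p : M) : Tan M p :=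
  mfderiv 𝓘(ℝ, R4) 𝓘(ℝ, R4) e.symm (e p) (EuclideanSpace.single i (1 : ℝ) : R4)

/-- Bondi-like coordinate charts `(x¹, x², v, r)`, numbered `0, 1, 2, 3`; the functions `x¹, x²` are
constant along `ζ` and `n`. -/
structure IsBondiChart (U : Set M) (n ζ : VField M) (v r : M → ℝ)
    (e : OpenPartialHomeomorph M R4) : Prop where
  smooth : e ∈ IsManifold.maximalAtlas 𝓘(ℝ, R4) ∞ M
  source_subset : e.source ⊆ U
  coord_v : ∀ p ∈ e.source, e p 2 = v p
  coord_r : ∀ p ∈ e.source, e p 3 = r p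
  zeta_x : ∀ p ∈ e.source, chartComp e p (ζ p) 0 = 0 ∧ chartComp e p (ζ p) 1 = 0
  n_x : ∀ p ∈ e.source, chartComp e p (n p) 0 = 0 ∧ chartComp e p (n p) 1 = 0

/-- `f` does not depend on the coordinate `v` of the chart `e`: it is constant along every coordinate
line segment in the direction of `v` that lies in the chart. -/
def IndependentOfV {α : Type*} (e : OpenPartialHomeomorph M R4) (f : M → α) : Prop :=
  ∀ y ∈ e.target, ∀ t : ℝ,
    segment ℝ y (y + t • EuclideanSpace.single 2 (1 : ℝ)) ⊆ e.target →
    f (e.symm (y + t • EuclideanSpace.single 2 (1 : ℝ))) = f (e.symm y)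

end Horizon

section NewmanPenrose

variable {M : Type*} [TopologicalSpace M] [ChartedSpace R4 M] [IsManifold 𝓘(ℝ, R4) ∞ M]
variable {B : Type*} [TopologicalSpace B] [ChartedSpace R2 B]

/-- Complex vector fields `X 0 + i X 1`, as pairs of a real and an imaginary part. -/
abbrev CField (M : Type*) [TopologicalSpace M] [ChartedSpace R4 M] : Type _ := Fin 2 → VField M

/-- The complex vector field given by a real one. -/
def cReal (X : VField M) : CField M := ![X, 0]

/-- The complex conjugate of a complex vector field. -/
def cConj (X : CField M) : CField M := ![X 0, -X 1]

/-- Complex bilinear extension of a real tensor field. -/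
def cBilin (T : BField M) (X Y : CField M) (x : M) : ℂ :=
  ∑ i : Fin 2, ∑ j : Fin 2, Complex.I ^ ((i : ℕ) + j) * (T x (X i x) (Y j x) : ℝ)

/-- `g(X, ∇_Z Y)`, extended complex multilinearly. -/
def cConn (g : BField M) (D : Conn M) (X Y Z : CField M) (x : M) : ℂ :=
  ∑ i : Fin 2, ∑ j : Fin 2, ∑ k : Fin 2,
    Complex.I ^ ((i : ℕ) + j + k) * (g x (X i x) (D (Y j) x (Z k x)) : ℝ)

/-- The Weyl tensor, extended complex multilinearly. -/
def cWeyl (g : BField M) (D : Conn M) (X Y Z W : CField M) (x : M) : ℂ :=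
  ∑ i : Fin 2, ∑ j : Fin 2, ∑ k : Fin 2, ∑ l : Fin 2,
    Complex.I ^ ((i : ℕ) + j + k + l) * (weyl g D x (X i x) (Y j x) (Z k x) (W l x) : ℝ)

/-- The null frame `(e₁, e₂, e₃, e₄) = (m, m̄, n, l)`. -/
def npFrame (m : CField M) (n l : VField M) : Fin 4 → CField M :=
  ![m, cConj m, cReal n, cReal l]

/-- The components `e_μ^i` of the frame vectors in the chart `e`. -/
def frameComponents (e : OpenPartialHomeomorph M R4) (m : CField M) (n l : VField M) (p : M) :
    Fin 4 → Fin 4 → ℂ :=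
  fun μ i => (chartComp e p (npFrame m n l μ 0 p) i : ℝ)
    + Complex.I * (chartComp e p (npFrame m n l μ 1 p) i : ℝ)

/-- The twelve Newman-Penrose spin coefficients, in the order
`σ, ρ, τ, ϰ, β, α, γ, ε, μ, λ, ν, π`. With `Γ_{ab} = g(e_a, ∇ e_b)` they are the components along
`(e¹, e², e³, e⁴)` of `-Γ₁₄`, of `-(Γ₁₂ + Γ₃₄)/2` and of `Γ₂₃`. -/
def spinCoefficients (g : BField M) (D : Conn M) (m : CField M) (n l : VField M) (p : M) :
    Fin 12 → ℂ :=
  let m' := cConj m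
  let n' := cReal n
  let l' := cReal l
  ![-cConn g D m l' m p, -cConn g D m l' m' p, -cConn g D m l' n' p, -cConn g D m l' l' p,
    -(1 / 2) * (cConn g D m m' m p + cConn g D n' l' m p),
    -(1 / 2) * (cConn g D m m' m' p + cConn g D n' l' m' p),
    -(1 / 2) * (cConn g D m m' n' p + cConn g D n' l' n' p),
    -(1 / 2) * (cConn g D m m' l' p + cConn g D n' l' l' p),
    cConn g D m' n' m p, cConn g D m' n' m' p, cConn g D m' n' n' p, cConn g D m' n' l' p]

/-- The Maxwell components `Φ₀ = F₄₁`, `Φ₁ = (F₄₃ + F₂₁)/2`, `Φ₂ = F₂₃`. -/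
def maxwellScalars (F : BField M) (m : CField M) (n l : VField M) (p : M) : Fin 3 → ℂ :=
  let m' := cConj m
  let n' := cReal n
  let l' := cReal l
  ![cBilin F l' m p, (1 / 2) * (cBilin F l' n' p + cBilin F m' m p), cBilin F m' n' p]

/-- The Weyl components `Ψ₀ = -C₄₁₄₁`, `Ψ₁ = -C₄₃₄₁`, `Ψ₂ = -C₄₁₂₃`, `Ψ₃ = -C₄₃₂₃`,
`Ψ₄ = -C₃₂₃₂`. -/
def weylScalars (g : BField M) (D : Conn M) (m : CField M) (n l : VField M) (p : M) :
    Fin 5 → ℂ :=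
  let m' := cConj m
  let n' := cReal n
  let l' := cReal l
  ![-cWeyl g D l' m l' m p, -cWeyl g D l' n' l' m p, -cWeyl g D l' m m' n' p,
    -cWeyl g D l' n' m' n' p, -cWeyl g D n' m' n' m' p]

/-- `(m, m̄, n, l)` is an adapted null frame on the open set `W`: a null frame in which, at the
horizon, `l` is the given null vector `ζ`, and `m` is tangent to the slices `v = const` of the horizon
and Lie dragged by `ζ`; it is parallelly transported along `n`. -/
structure IsAdaptedFrame (g : BField M) (D : Conn M) (Φ : B × ℝ → M) (U : Set M)
    (n ζ : VField M) (v : M → ℝ) (W : Set M) (m : CField M) (l : VField M) : Prop where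
  isOpen : IsOpen W
  subset : W ⊆ U
  swept : SweptOut Φ n W
  smooth_m : ∀ i, SmoothOn (m i) W
  smooth_l : SmoothOn l W
  null_frame : ∀ p ∈ W, ∀ i j : Fin 4, cBilin g (npFrame m n l i) (npFrame m n l j) p =
    !![0, 1, 0, 0; 1, 0, 0, 0; 0, 0, 0, -1; 0, 0, -1, 0] i j
  l_horizon : ∀ q, Φ q ∈ W → l (Φ q) = ζ (Φ q)
  m_tangent : ∀ q, Φ q ∈ W → ∀ i, m i (Φ q) ∈ horizonTangent Φ q ∧ dFun v (Φ q) (m i (Φ q)) = 0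
  m_dragged : ∀ q, Φ q ∈ W → ∀ i, bracket ζ (m i) (Φ q) = 0
  m_parallel : ∀ p ∈ W, ∀ i, D (m i) p (n p) = 0
  l_parallel : ∀ p ∈ W, D l p (n p) = 0

end NewmanPenrose

end KillingHorizon

end

open KillingHorizon

set_option linter.unusedSectionVars false

/-! On the horizon the null field has the form K = fζ with f = dv(K), so two things have to be
shown: f is constant, and the relation K = aζ propagates off the horizon along n.

Rigidity on the horizon. A Killing field preserves the Levi-Civita connection, [𝓛_K, ∇] = 0
(`IsKillingOn.lieConn_eq_zero`). The trace condition on a natural field ζ forces [𝓛_ζ, D]_X ζ = 0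
for tangent X (`IsNaturalField.lieConn_zeta`). Inserting K = fζ into the first identity and
subtracting f times the second shows that the function κ = f + ζ(f), for which ∇_ζ K = κζ, has
vanishing tangential derivatives, so it is constant (`IsNaturalField.surface_gravity_const`). If κ ≠
0, then K/κ is again a natural field. If κ = 0, then ζ + K is. Uniqueness of the invariant field
gives K = κζ in both cases (`IsInvariantField.eq_smul_of_killing`). In case (b) this step is
replaced by the hypothesis, with a = 1.

Propagation. The field n is determined on the horizon by g and dv, both of which are compatible with
K = aζ there, so [K, n] = 0 on the horizon. Lie differentiating ∇_n n = 0 along K gives a linear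
transport equation for [K, n] along n, hence [K, n] = 0 everywhere. Now K - aζ commutes with n,
which is again a linear transport equation with zero initial value
(`IsBondiNeighbourhood.eq_smul_zeta_of_horizon`). The constant a is nonzero because K is not
identically zero, so ζ itself is Killing.

Invariance. The same transport argument shows that the adapted frame commutes with ζ. Products,
covariant derivatives and curvatures of such fields are ζ-invariant, F is invariant by assumption,
and ζ = ∂_v in Bondi-like charts. This makes all frame quantities independent of v
(`IsBondiChart.independentOfV_frame`). The uniqueness statement behind every transport step is
`transport_eq_zero_iff`. -/

noncomputable section

namespace KillingHorizon

/-! ### Calculus of vector fields, brackets and covariant derivatives. -/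

section VectorCalculus

variable {M : Type*} [TopologicalSpace M] [ChartedSpace R4 M] [IsManifold 𝓘(ℝ, R4) ∞ M]

/-- `f` is a smooth real function on the open set `V`. -/
abbrev SmoothFun (f : M → ℝ) (V : Set M) : Prop :=
  ContMDiffOn 𝓘(ℝ, R4) 𝓘(ℝ, ℝ) ∞ f V

variable {V W : Set M} {X Y Z : VField M} {f h : M → ℝ} {x : M}

instance : IsManifold 𝓘(ℝ, R4) 1 M := IsManifold.of_le (n := ∞) (by simp)
instance : IsManifold 𝓘(ℝ, R4) 2 M := IsManifold.of_le (n := ∞) ENat.LEInfty.out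
instance : IsManifold 𝓘(ℝ, R4) 3 M := IsManifold.of_le (n := ∞) (WithTop.coe_le_coe.2 le_top)
instance : IsManifold 𝓘(ℝ, R4) (∞ + 1) M := inferInstanceAs (IsManifold 𝓘(ℝ, R4) ∞ M)
instance : IsManifold 𝓘(ℝ, R4) (minSmoothness ℝ 3) M := by
  simp only [minSmoothness_of_isRCLikeNormedField]; infer_instance

theorem SmoothOn.mono (hX : SmoothOn X V) (h : W ⊆ V) : SmoothOn X W :=
  ContMDiffOn.mono hX h

theorem SmoothOn.smoothAt (hX : SmoothOn X V) (hV : IsOpen V) (hx : x ∈ V) : SmoothAt X x :=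
  ContMDiffOn.contMDiffAt hX (hV.mem_nhds hx)

theorem SmoothAt.diffAt (hX : SmoothAt X x) : DiffAt X x :=
  ContMDiffAt.mdifferentiableAt hX (by simp)

theorem SmoothOn.diffAt (hX : SmoothOn X V) (hV : IsOpen V) (hx : x ∈ V) : DiffAt X x :=
  (hX.smoothAt hV hx).diffAt

theorem SmoothFun.mdiffAt (hf : SmoothFun f V) (hV : IsOpen V) (hx : x ∈ V) :
    MDifferentiableAt 𝓘(ℝ, R4) 𝓘(ℝ, ℝ) f x :=
  (ContMDiffOn.contMDiffAt hf (hV.mem_nhds hx)).mdifferentiableAt (by simp)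

theorem SmoothOn.add (hX : SmoothOn X V) (hY : SmoothOn Y V) : SmoothOn (X + Y) V :=
  ContMDiffOn.add_section hX hY

theorem SmoothOn.sub (hX : SmoothOn X V) (hY : SmoothOn Y V) : SmoothOn (X - Y) V :=
  ContMDiffOn.sub_section hX hY

theorem SmoothOn.smul (hf : SmoothFun f V) (hX : SmoothOn X V) : SmoothOn (f • X) V :=
  ContMDiffOn.smul_section hf hX

theorem SmoothOn.const_smul (c : ℝ) (hX : SmoothOn X V) : SmoothOn (c • X) V :=
  ContMDiffOn.const_smul_section hX

theorem smoothOn_zero : SmoothOn (0 : VField M) V :=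
  (Bundle.contMDiff_zeroSection ℝ _).contMDiffOn

theorem SmoothOn.bracket (hX : SmoothOn X V) (hY : SmoothOn Y V) (hV : IsOpen V) :
    SmoothOn (bracket X Y) V := fun x hx =>
  (ContMDiffAt.mlieBracket_vectorField (m := ⊤) (n := ⊤) (hX.smoothAt hV hx) (hY.smoothAt hV hx)
    (by simp)).contMDiffWithinAt

theorem jacobi (hV : IsOpen V) (hX : SmoothOn X V) (hY : SmoothOn Y V) (hZ : SmoothOn Z V)
    (hx : x ∈ V) : bracket X (bracket Y Z) x = bracket (bracket X Y) Z x
      + bracket Y (bracket X Z) x := by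
  have key : ∀ {X : VField M}, SmoothOn X V → ContMDiffAt 𝓘(ℝ, R4) 𝓘(ℝ, R4).tangent
      (minSmoothness ℝ 2) (fun y => (⟨y, X y⟩ : TangentBundle 𝓘(ℝ, R4) M)) x := fun hX => by
    simp only [minSmoothness_of_isRCLikeNormedField]
    exact (hX.smoothAt hV hx).of_le ENat.LEInfty.out
  exact VectorField.leibniz_identity_mlieBracket_apply (key hX) (key hY) (key hZ)

theorem bracket_swap (X Y : VField M) (x : M) : bracket X Y x = - bracket Y X x :=
  VectorField.mlieBracket_swap_apply

theorem bracket_add_left (hX : DiffAt X x) (hY : DiffAt Y x) :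
    bracket (X + Y) Z x = bracket X Z x + bracket Y Z x :=
  VectorField.mlieBracket_add_left hX hY

theorem bracket_add_right (hX : DiffAt X x) (hY : DiffAt Y x) :
    bracket Z (X + Y) x = bracket Z X x + bracket Z Y x :=
  VectorField.mlieBracket_add_right hX hY

theorem bracket_smul_right (hf : MDifferentiableAt 𝓘(ℝ, R4) 𝓘(ℝ, ℝ) f x) (hX : DiffAt X x) :
    bracket Y (f • X) x = dFun f x (Y x) • X x + f x • bracket Y X x :=
  VectorField.mlieBracket_smul_right hf hX

theorem bracket_const_smul_right (c : ℝ) (hX : DiffAt X x) :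
    bracket Y (c • X) x = c • bracket Y X x :=
  VectorField.mlieBracket_const_smul_right hX

theorem bracket_const_smul_left (c : ℝ) (hX : DiffAt X x) :
    bracket (c • X) Y x = c • bracket X Y x :=
  VectorField.mlieBracket_const_smul_left hX

theorem bracket_congr {X' Y' : VField M} (hX : ∀ᶠ y in 𝓝 x, X y = X' y)
    (hY : ∀ᶠ y in 𝓝 x, Y y = Y' y) : bracket X Y x = bracket X' Y' x :=
  Filter.EventuallyEq.mlieBracket_vectorField_eq hX hY

theorem dFun_congr (h' : ∀ᶠ y in 𝓝 x, f y = h y) : dFun f x = dFun h x := by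
  have h2 : f =ᶠ[𝓝 x] h := h'
  simp only [dFun, mvfderiv, h2.mfderiv_eq]
  rfl

theorem dFun_const (c : ℝ) : dFun (fun _ : M => c) x = 0 := mvfderiv_const c

theorem dFun_add (hf : MDifferentiableAt 𝓘(ℝ, R4) 𝓘(ℝ, ℝ) f x)
    (hh : MDifferentiableAt 𝓘(ℝ, R4) 𝓘(ℝ, ℝ) h x) :
    dFun (fun y => f y + h y) x = dFun f x + dFun h x := mvfderiv_add hf hh

theorem SmoothFun.dFun_apply (hf : SmoothFun f V) (hX : SmoothOn X V) (hV : IsOpen V) :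
    SmoothFun (fun y => dFun f y (X y)) V := by
  have h1 := ContMDiffOn.contMDiffOn_tangentMapWithin (m := ∞) hf (by simp) hV.uniqueMDiffOn
  have h2 := h1.comp hX (fun y hy => hy)
  have h3 := (contMDiff_snd_tangentBundle_modelSpace (n := ∞) ℝ 𝓘(ℝ, ℝ)).comp_contMDiffOn h2
  refine h3.congr fun z hz => ?_
  simp only [Function.comp, tangentMapWithin, mfderivWithin_of_isOpen hV hz]
  rfl

theorem dFun_neg : dFun (fun y => - f y) x = - dFun f x := mvfderiv_neg

theorem SmoothTensorOn.apply {T : BField M} (hT : SmoothTensorOn T V) (hX : SmoothOn X V)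
    (hY : SmoothOn Y V) : SmoothFun (fun y => T y (X y) (Y y)) V := by
  intro y hy
  have : ContMDiffWithinAt 𝓘(ℝ, R4) (𝓘(ℝ, R4).prod 𝓘(ℝ)) ∞
      (fun m ↦ Bundle.TotalSpace.mk' ℝ (E := Bundle.Trivial M ℝ) m (T m (X m) (Y m))) V y := by
    apply ContMDiffWithinAt.clm_bundle_apply₂ (F₁ := R4) (F₂ := R4)
    · exact hT y hy
    · exact hX y hy
    · exact hY y hy
  simp only [Bundle.contMDiffWithinAt_totalSpace] at this
  exact this.2

/-- A bump function cuts the field off without changing it near the point. This allows the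
smoothness of a connection, which is applied to globally smooth sections, to be used for fields
defined only on an open set. -/
theorem SmoothOn.exists_global [T2Space M] (hX : SmoothOn X V) (hV : IsOpen V) (hx : x ∈ V) :
    ∃ X' : VField M, SmoothOn X' Set.univ ∧ ∀ᶠ y in 𝓝 x, X' y = X y := by
  obtain ⟨χ, -, hχ⟩ := (SmoothBumpFunction.nhds_basis_tsupport (I := 𝓘(ℝ, R4)) x).mem_iff.1
    (hV.mem_nhds hx)
  refine ⟨(χ : M → ℝ) • X, ?_, ?_⟩
  · exact (ContMDiffOn.smul_section_of_tsupport (χ.contMDiff.contMDiffOn) hV hχ hX).contMDiffOn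
  · filter_upwards [χ.eventuallyEq_one] with y hy
    simp [hy]

theorem exists_smooth_extension [T2Space M] (w : Tan M x) :
    ∃ X : VField M, SmoothOn X Set.univ ∧ X x = w := by
  obtain ⟨s, hs, h⟩ := FiberBundle.exists_contMDiffOn_extend (k := ∞) 𝓘(ℝ, R4) R4 w
  obtain ⟨t, hts, ht, hxt⟩ := mem_nhds_iff.1 hs
  obtain ⟨X, hX, hXx⟩ := SmoothOn.exists_global (X := extendVec w) (h.mono hts) ht hxt
  exact ⟨X, hX, hXx.self_of_nhds.trans (FiberBundle.extend_apply_self R4 w)⟩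

theorem smoothOn_extendVec (w : Tan M x) :
    ∃ s : Set M, IsOpen s ∧ x ∈ s ∧ SmoothOn (extendVec w) s := by
  obtain ⟨s, hs, h⟩ := FiberBundle.exists_contMDiffOn_extend (k := ∞) 𝓘(ℝ, R4) R4 w
  obtain ⟨t, hts, ht, hxt⟩ := mem_nhds_iff.1 hs
  exact ⟨t, ht, hxt, h.mono hts⟩

theorem extendVec_self (w : Tan M x) : extendVec w x = w := FiberBundle.extend_apply_self R4 w

/-- The Lie bracket acts on functions as the commutator. -/
theorem dFun_bracket [T2Space M] (hV : IsOpen V) (hf : SmoothFun f V) (hX : SmoothOn X V)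
    (hY : SmoothOn Y V) (hx : x ∈ V) :
    dFun f x (bracket X Y x) = dFun (fun y => dFun f y (Y y)) x (X x)
      - dFun (fun y => dFun f y (X y)) x (Y x) := by
  obtain ⟨Z, hZ, hZx⟩ := exists_smooth_extension (stdVec x 0)
  replace hZ := hZ.mono (Set.subset_univ V)
  have hne : Z x ≠ 0 := by
    rw [hZx]
    intro h
    have h1 : (EuclideanSpace.single 0 (1 : ℝ) : R4) = 0 := h
    simp at h1
  have leib : ∀ {A B : VField M} {k : M → ℝ}, SmoothFun k V → SmoothOn B V → ∀ y ∈ V,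
      bracket A (k • B) y = ((fun y => dFun k y (A y)) • B + k • bracket A B) y :=
    fun hk hB y hy => bracket_smul_right (hk.mdiffAt hV hy) (hB.diffAt hV hy)
  have ev : ∀ {A B : VField M}, (∀ y ∈ V, A y = B y) → ∀ᶠ y in 𝓝 x, A y = B y :=
    fun h => Filter.eventually_of_mem (hV.mem_nhds hx) h
  -- The Jacobi identity for X, Y, fZ is expanded by the Leibniz rule. By the Jacobi identity for X,
  -- Y, Z all terms cancel except multiples of Z(x), and Z(x) ≠ 0 lets the coefficients be compared.
  have jac := jacobi hV hX hY (hZ.smul hf) hx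
  rw [bracket_congr (ev fun _ _ => rfl) (ev (leib hf hZ)),
    bracket_congr (X := Y) (ev fun _ _ => rfl) (ev (leib hf hZ)), leib hf hZ x hx] at jac
  have fY := hf.dFun_apply hY hV
  have fX := hf.dFun_apply hX hV
  rw [bracket_add_right ((hZ.smul fY).diffAt hV hx) (((hY.bracket hZ hV).smul hf).diffAt hV hx),
    bracket_add_right ((hZ.smul fX).diffAt hV hx) (((hX.bracket hZ hV).smul hf).diffAt hV hx),
    leib fY hZ x hx, leib fX hZ x hx, leib hf (hY.bracket hZ hV) x hx,
    leib hf (hX.bracket hZ hV) x hx] at jac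
  simp only [Pi.add_apply, Pi.smul_apply', jacobi hV hX hY hZ hx] at jac
  have : (dFun f x (bracket X Y x) - (dFun (fun y => dFun f y (Y y)) x (X x)
      - dFun (fun y => dFun f y (X y)) x (Y x))) • Z x = 0 := by
    rw [← sub_eq_zero] at jac
    rw [← neg_eq_zero, ← jac]
    module
  exact sub_eq_zero.1 ((smul_eq_zero.1 this).resolve_right hne)

section Connection

variable (D : Conn M)

theorem cov_add (hX : DiffAt X x) (hY : DiffAt Y x) : D (X + Y) x = D X x + D Y x :=
  D.isCovariantDerivativeOnUniv.add hX hY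

theorem cov_smul (hf : MDifferentiableAt 𝓘(ℝ, R4) 𝓘(ℝ, ℝ) f x) (hX : DiffAt X x) (w : Tan M x) :
    D (f • X) x w = f x • D X x w + dFun f x w • X x := by
  have := D.isCovariantDerivativeOnUniv.leibniz hX hf
  exact congrArg (fun A => A w) this

theorem cov_const_smul (c : ℝ) (hX : DiffAt X x) : D (c • X) x = c • D X x :=
  D.isCovariantDerivativeOnUniv.smul_const c hX

theorem cov_congr (hX : DiffAt X x) (hY : DiffAt Y x) (h : ∀ᶠ y in 𝓝 x, X y = Y y) :
    D X x = D Y x :=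
  D.isCovariantDerivativeOnUniv.congr_of_eventuallyEq hX hY Filter.univ_mem h

theorem cov_zero : D 0 x = 0 := D.isCovariantDerivativeOnUniv.zero

variable {D}

theorem SmoothOn.cov [T2Space M] (hD : CovariantDerivative.ContMDiffCovariantDerivative D ∞)
    (hX : SmoothOn X V) (hY : SmoothOn Y V) (hV : IsOpen V) :
    SmoothOn (fun y => D Y y (X y)) V := by
  intro x hx
  obtain ⟨Y', hY', hYY'⟩ := hY.exists_global hV hx
  have h1 := (hD.contMDiff.contMDiff hY') x (Set.mem_univ x)
  have h2 : ContMDiffWithinAt 𝓘(ℝ, R4) 𝓘(ℝ, R4).tangent ∞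
      (fun y => (⟨y, D Y' y (X y)⟩ : TangentBundle 𝓘(ℝ, R4) M)) V x :=
    ContMDiffWithinAt.clm_bundle_apply (F₁ := R4) (F₂ := R4)
      (h1.mono (Set.subset_univ V)) (hX x hx)
  refine h2.congr_of_eventuallyEq_of_mem ?_ hx
  filter_upwards [mem_nhdsWithin_of_mem_nhds (eventually_eventually_nhds.2 hYY'),
    self_mem_nhdsWithin] with y hy hyV
  rw [cov_congr D (hY.diffAt hV hyV) (hY'.diffAt isOpen_univ (Set.mem_univ _))
    (hy.mono fun _ h => h.symm)]

end Connection

end VectorCalculus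

/-! ### Killing fields preserve the Levi-Civita connection. -/

section Killing

variable {M : Type*} [TopologicalSpace M] [ChartedSpace R4 M] [IsManifold 𝓘(ℝ, R4) ∞ M]
variable {V : Set M} {K X Y Z : VField M} {x : M} {g : BField M} {D : Conn M}

theorem IsLorentzMetric.eq_zero (hg : IsLorentzMetric g) {u : Tan M x}
    (h : ∀ w : Tan M x, g x u w = 0) : u = 0 := by
  obtain ⟨b, hb⟩ := hg.signature x
  have hli : LinearIndependent ℝ b := by
    rw [Fintype.linearIndependent_iff]
    intro c hc i
    have h1 := congrArg (fun z => g x (b i) z) hc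
    simp only [map_sum, map_smul, hb, map_zero] at h1
    rw [Finset.sum_eq_single i (fun j _ hj => by simp [Ne.symm hj]) (by simp)] at h1
    by_cases h0 : i = 0 <;> simpa [h0] using h1
  have hfr : Fintype.card (Fin 4) = Module.finrank ℝ (Tan M x) := by
    change _ = Module.finrank ℝ R4
    simp
  let B := basisOfLinearIndependentOfCardEqFinrank hli hfr
  have hB : ∀ i, B i = b i := fun i => by simp [B]
  have hu := B.sum_repr u
  have : B.repr u = 0 := by
    ext i
    have h1 := h (b i)
    rw [← hu] at h1
    simp only [map_sum, map_smul, hB, sum_apply,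
      smul_apply, hb] at h1
    rw [Finset.sum_eq_single i (fun j _ hj => by simp [hj]) (by simp)] at h1
    by_cases h0 : i = 0 <;> simpa [h0] using h1
  exact B.repr.map_eq_zero_iff.1 this

theorem IsLorentzMetric.smoothFun (hg : IsLorentzMetric g) (hX : SmoothOn X V)
    (hY : SmoothOn Y V) : SmoothFun (fun y => g y (X y) (Y y)) V :=
  SmoothTensorOn.apply (ContMDiffOn.mono hg.smooth (Set.subset_univ V)) hX hY

theorem IsLeviCivita.bracket_eq (hD : IsLeviCivita g D) (hX : DiffAt X x) (hY : DiffAt Y x) :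
    bracket X Y x = D Y x (X x) - D X x (Y x) := (hD.torsion_free X Y x hX hY).symm

theorem IsKillingOn.mono (hK : IsKillingOn g D K V) {W : Set M} (h : W ⊆ V) :
    IsKillingOn g D K W :=
  ⟨hK.smooth.mono h, fun x hx => hK.killing x (h hx)⟩

/-- The metric is invariant under a Killing field. -/
theorem IsKillingOn.dFun_metric (hD : IsLeviCivita g D) (hV : IsOpen V)
    (hK : IsKillingOn g D K V) (hX : SmoothOn X V) (hY : SmoothOn Y V) (hx : x ∈ V) :
    dFun (fun y => g y (X y) (Y y)) x (K x)
      = g x (bracket K X x) (Y x) + g x (X x) (bracket K Y x) := by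
  have dX := hX.diffAt hV hx
  have dY := hY.diffAt hV hx
  have dK := hK.smooth.diffAt hV hx
  rw [hD.metric X Y x dX dY, hD.bracket_eq dK dX, hD.bracket_eq dK dY]
  have := hK.killing x hx (X x) (Y x)
  simp only [map_sub, sub_apply]
  linarith

variable [T2Space M]

/-- The antisymmetric part in X, Y is the Lie derivative of the torsion: without torsion it reduces
to the Jacobi identity for K, X, Y. -/
theorem lieConn_symm (hD : IsLeviCivita g D) (hV : IsOpen V) (hK : SmoothOn K V)
    (hX : SmoothOn X V) (hY : SmoothOn Y V) (hx : x ∈ V) :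
    lieConn D K X Y x = lieConn D K Y X x := by
  have hXY := hX.cov hD.smooth hY hV
  have hYX := hY.cov hD.smooth hX hV
  have e1 : bracket K (bracket X Y) x
      = bracket K (fun y => D Y y (X y)) x - bracket K (fun y => D X y (Y y)) x := by
    have h : bracket K (fun y => D Y y (X y)) x
        = bracket K (bracket X Y + fun y => D X y (Y y)) x := by
      refine bracket_congr (Filter.Eventually.of_forall fun _ => rfl) ?_
      filter_upwards [hV.mem_nhds hx] with y hy
      simp [hD.bracket_eq (hX.diffAt hV hy) (hY.diffAt hV hy)]
    rw [h, bracket_add_right ((hX.bracket hY hV).diffAt hV hx) (hYX.diffAt hV hx)]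
    abel
  have e2 := hD.bracket_eq ((hK.bracket hX hV).diffAt hV hx) (hY.diffAt hV hx)
  have e3 := hD.bracket_eq (hX.diffAt hV hx) ((hK.bracket hY hV).diffAt hV hx)
  have e4 := jacobi hV hK hX hY hx
  rw [e1, e2, e3] at e4
  simp only [lieConn]
  rw [← sub_eq_zero] at e4 ⊢
  rw [← e4]
  abel

/-- Both 𝓛_K and ∇ annihilate g, so their commutator acts on the endomorphism index as a
g-antisymmetric map. In the proof this is [K, X] acting on the function g(Y, Z), expanded in both
orders. -/
theorem IsKillingOn.lieConn_antisymm (hg : IsLorentzMetric g) (hD : IsLeviCivita g D)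
    (hV : IsOpen V) (hK : IsKillingOn g D K V) (hX : SmoothOn X V) (hY : SmoothOn Y V)
    (hZ : SmoothOn Z V) (hx : x ∈ V) :
    g x (lieConn D K X Y x) (Z x) + g x (Y x) (lieConn D K X Z x) = 0 := by
  have hXY := hX.cov hD.smooth hY hV
  have hXZ := hX.cov hD.smooth hZ hV
  have hKY := hK.smooth.bracket hY hV
  have hKZ := hK.smooth.bracket hZ hV
  have sm : ∀ {A B : VField M}, SmoothOn A V → SmoothOn B V →
      MDifferentiableAt 𝓘(ℝ, R4) 𝓘(ℝ, ℝ) (fun y => g y (A y) (B y)) x :=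
    fun hA hB => (hg.smoothFun hA hB).mdiffAt hV hx
  have ev : ∀ {p q : M → ℝ}, (∀ y ∈ V, p y = q y) → dFun p x = dFun q x :=
    fun h => dFun_congr (Filter.eventually_of_mem (hV.mem_nhds hx) h)
  have comm := dFun_bracket hV (hg.smoothFun hY hZ) hK.smooth hX hx
  have e1 := ev fun y hy => hD.metric Y Z y (hY.diffAt hV hy) (hZ.diffAt hV hy) (X y)
  have e2 := ev fun y hy => hK.dFun_metric hD hV hY hZ hy
  rw [e1, e2, dFun_add (sm hXY hZ) (sm hY hXZ), dFun_add (sm hKY hZ) (sm hY hKZ),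
    hD.metric Y Z x (hY.diffAt hV hx) (hZ.diffAt hV hx)] at comm
  simp only [add_apply] at comm
  rw [hK.dFun_metric hD hV hXY hZ hx, hK.dFun_metric hD hV hY hXZ hx,
    hD.metric _ Z x (hKY.diffAt hV hx) (hZ.diffAt hV hx),
    hD.metric Y _ x (hY.diffAt hV hx) (hKZ.diffAt hV hx)] at comm
  simp only [lieConn, map_sub, sub_apply]
  linarith

/-- The Levi-Civita connection is invariant under a Killing field. -/
theorem IsKillingOn.lieConn_eq_zero (hg : IsLorentzMetric g) (hD : IsLeviCivita g D)
    (hV : IsOpen V) (hK : IsKillingOn g D K V) (hX : SmoothOn X V) (hY : SmoothOn Y V)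
    (hx : x ∈ V) : lieConn D K X Y x = 0 := by
  refine hg.eq_zero fun w => ?_
  obtain ⟨Z, hZ, rfl⟩ := exists_smooth_extension w
  replace hZ := hZ.mono (Set.subset_univ V)
  -- The trilinear expression g([𝓛_K, ∇_X] Y, Z) is symmetric in X, Y and antisymmetric in Y, Z.
  -- Alternating the two symmetries over the three slots makes it equal to its own negative.
  have a1 := hK.lieConn_antisymm hg hD hV hX hY hZ hx
  have a2 := hK.lieConn_antisymm hg hD hV hY hX hZ hx
  have a3 := hK.lieConn_antisymm hg hD hV hZ hX hY hx
  rw [lieConn_symm hD hV hK.smooth hY hX hx] at a2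
  rw [lieConn_symm hD hV hK.smooth hZ hX hx, lieConn_symm hD hV hK.smooth hZ hY hx] at a3
  rw [hg.symm x (Y x)] at a1
  rw [hg.symm x (X x)] at a2 a3
  rw [hg.symm x (lieConn D K X Z x)] at a1 a3
  linarith

/-- This form lets 𝓛_K be applied to equations such as ∇_n n = 0 or ∇_n X = 0, which yields the
transport equations for [K, n] and [K, X]. -/
theorem IsKillingOn.bracket_cov (hg : IsLorentzMetric g) (hD : IsLeviCivita g D)
    (hV : IsOpen V) (hK : IsKillingOn g D K V) (hX : SmoothOn X V) (hY : SmoothOn Y V)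
    (hx : x ∈ V) : bracket K (fun y => D Y y (X y)) x
      = D Y x (bracket K X x) + D (bracket K Y) x (X x) := by
  have := hK.lieConn_eq_zero hg hD hV hX hY hx
  rw [lieConn, sub_sub, sub_eq_zero] at this
  exact this

end Killing

/-! ### Symmetries and tensoriality of the curvature. -/

section Curvature

variable {M : Type*} [TopologicalSpace M] [ChartedSpace R4 M] [IsManifold 𝓘(ℝ, R4) ∞ M]
variable [T2Space M]
variable {V : Set M} {K X Y Z T : VField M} {x : M} {g : BField M} {D : Conn M}

theorem curvature_swap (X Y Z : VField M) (x : M) :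
    curvature D X Y Z x = - curvature D Y X Z x := by
  simp only [curvature, bracket_swap X Y, map_neg]
  abel

/-- Metric compatibility: the commutator of X and Y minus [X, Y] annihilates the function g(Z, T).
-/
theorem curvature_antisymm (hg : IsLorentzMetric g) (hD : IsLeviCivita g D) (hV : IsOpen V)
    (hX : SmoothOn X V) (hY : SmoothOn Y V) (hZ : SmoothOn Z V) (hT : SmoothOn T V)
    (hx : x ∈ V) : g x (curvature D X Y Z x) (T x) = - g x (Z x) (curvature D X Y T x) := by
  have c : ∀ {A B : VField M}, SmoothOn A V → SmoothOn B V → SmoothOn (fun y => D B y (A y)) V :=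
    fun hA hB => hA.cov hD.smooth hB hV
  have sm : ∀ {A B : VField M}, SmoothOn A V → SmoothOn B V →
      MDifferentiableAt 𝓘(ℝ, R4) 𝓘(ℝ, ℝ) (fun y => g y (A y) (B y)) x :=
    fun hA hB => (hg.smoothFun hA hB).mdiffAt hV hx
  have ev : ∀ {p q : M → ℝ}, (∀ y ∈ V, p y = q y) → dFun p x = dFun q x :=
    fun h => dFun_congr (Filter.eventually_of_mem (hV.mem_nhds hx) h)
  have met : ∀ {A B : VField M}, SmoothOn A V → SmoothOn B V → ∀ y ∈ V, ∀ w : Tan M y,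
      dFun (fun y => g y (A y) (B y)) y w = g y (D A y w) (B y) + g y (A y) (D B y w) :=
    fun hA hB y hy => hD.metric _ _ y (hA.diffAt hV hy) (hB.diffAt hV hy)
  have comm := dFun_bracket hV (hg.smoothFun hZ hT) hX hY hx
  rw [ev fun y hy => met hZ hT y hy (Y y), ev fun y hy => met hZ hT y hy (X y),
    dFun_add (sm (c hY hZ) hT) (sm hZ (c hY hT)), dFun_add (sm (c hX hZ) hT) (sm hZ (c hX hT)),
    met hZ hT x hx] at comm
  simp only [add_apply] at comm
  rw [met (c hY hZ) hT x hx, met hZ (c hY hT) x hx, met (c hX hZ) hT x hx,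
    met hZ (c hX hT) x hx] at comm
  simp only [KillingHorizon.curvature, map_sub, sub_apply]
  linarith

/-- For a torsion-free connection the cyclic sum of second derivatives regroups into the cyclic sum
of [[X, Y], Z], which vanishes by the Jacobi identity. -/
theorem curvature_bianchi (hD : IsLeviCivita g D) (hV : IsOpen V)
    (hX : SmoothOn X V) (hY : SmoothOn Y V) (hZ : SmoothOn Z V) (hx : x ∈ V) :
    curvature D X Y Z x + curvature D Y Z X x + curvature D Z X Y x = 0 := by
  have c : ∀ {A B : VField M}, SmoothOn A V → SmoothOn B V → SmoothOn (fun y => D B y (A y)) V :=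
    fun hA hB => hA.cov hD.smooth hB hV
  have key : ∀ {A B C : VField M}, SmoothOn A V → SmoothOn B V → SmoothOn C V →
      D (fun y => D B y (A y)) x (C x) - D (fun y => D A y (B y)) x (C x)
        = D (bracket A B) x (C x) := fun {A B C} hA hB hC => by
    have h : D (fun y => D B y (A y)) x = D (bracket A B + fun y => D A y (B y)) x := by
      refine cov_congr D ((c hA hB).diffAt hV hx)
        (((hA.bracket hB hV).add (c hB hA)).diffAt hV hx) ?_
      filter_upwards [hV.mem_nhds hx] with y hy
      simp [hD.bracket_eq (hA.diffAt hV hy) (hB.diffAt hV hy)]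
    rw [h, cov_add D ((hA.bracket hB hV).diffAt hV hx) ((c hB hA).diffAt hV hx)]
    simp
  have tor : ∀ {A B C : VField M}, SmoothOn A V → SmoothOn B V → SmoothOn C V →
      D C x (bracket A B x) = bracket (bracket A B) C x + D (bracket A B) x (C x) :=
    fun hA hB hC => by
      rw [hD.bracket_eq ((hA.bracket hB hV).diffAt hV hx) (hC.diffAt hV hx)]; abel
  have k1 := key hX hY hZ
  have k2 := key hY hZ hX
  have k3 := key hZ hX hY
  have j := jacobi hV hX hY hZ hx
  rw [bracket_swap X (bracket Y Z), bracket_swap Y (bracket X Z),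
    bracket_congr (x := x) (X := bracket X Z) (X' := (-1 : ℝ) • bracket Z X) (Y := Y) (Y' := Y)
      (Filter.Eventually.of_forall fun y => by simp [bracket_swap X Z])
      (Filter.Eventually.of_forall fun _ => rfl),
    bracket_const_smul_left _ ((hZ.bracket hX hV).diffAt hV hx)] at j
  simp only [KillingHorizon.curvature, tor hX hY hZ, tor hY hZ hX, tor hZ hX hY, ← k1, ← k2, ← k3]
  rw [← sub_eq_zero] at j
  rw [← j]
  module

theorem curvature_pair_symm (hg : IsLorentzMetric g) (hD : IsLeviCivita g D) (hV : IsOpen V)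
    (hX : SmoothOn X V) (hY : SmoothOn Y V) (hZ : SmoothOn Z V) (hT : SmoothOn T V)
    (hx : x ∈ V) : g x (curvature D X Y Z x) (T x) = g x (curvature D Z T X x) (Y x) := by
  have b : ∀ {A B C E : VField M}, SmoothOn A V → SmoothOn B V → SmoothOn C V →
      g x (curvature D A B C x) (E x) + g x (curvature D B C A x) (E x)
        + g x (curvature D C A B x) (E x) = 0 := fun {A B C E} hA hB hC => by
    have := congrArg (fun u => g x u (E x)) (curvature_bianchi hD hV hA hB hC hx)
    simpa using this
  have a : ∀ {A B C E : VField M}, SmoothOn A V → SmoothOn B V → SmoothOn C V → SmoothOn E V →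
      g x (curvature D A B C x) (E x) = - g x (curvature D A B E x) (C x) :=
    fun {A B C E} hA hB hC hE => by
      rw [curvature_antisymm hg hD hV hA hB hC hE hx, hg.symm]
  have s : ∀ (A B C E : VField M),
      g x (curvature D A B C x) (E x) = - g x (curvature D B A C x) (E x) :=
    fun A B C E => by rw [curvature_swap A B]; simp
  -- The classical octahedron argument: four Bianchi identities, one for each omitted field,
  -- combined with the antisymmetries in the first and in the last pair.
  have b1 := b (E := T) hX hY hZ
  have b2 := b (E := X) hY hZ hT
  have b3 := b (E := Y) hZ hT hX
  have b4 := b (E := Z) hT hX hY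
  have a1 := a hX hY hZ hT
  have a2 := a hY hZ hX hT
  have a3 := a hZ hX hY hT
  have a4 := a hZ hT hX hY
  have a5 := a hX hT hY hZ
  have a6 := a hT hY hX hZ
  have s1 := s T X Z Y
  have s2 := s X Z T Y
  have s3 := s T X Y Z
  have s4 := s Y T Z X
  have s5 := s Y T X Z
  have s6 := s Z X Y T
  have s7 := s Z X T Y
  linarith

/-- Tensoriality is read off from the symmetries. Antisymmetry moves the third argument into a slot
of g, where only its value at x counts, and pair symmetry brings the first two arguments into such a
position in turn. Each extension can therefore be replaced by any field with the same value at x. -/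
theorem riemann_eq_curvature (hg : IsLorentzMetric g) (hD : IsLeviCivita g D) (hV : IsOpen V)
    (hX : SmoothOn X V) (hY : SmoothOn Y V) (hZ : SmoothOn Z V) (hx : x ∈ V) :
    riemann D x (X x) (Y x) (Z x) = curvature D X Y Z x := by
  obtain ⟨V₁, o₁, x₁, h₁⟩ := smoothOn_extendVec (X x)
  obtain ⟨V₂, o₂, x₂, h₂⟩ := smoothOn_extendVec (Y x)
  obtain ⟨V₃, o₃, x₃, h₃⟩ := smoothOn_extendVec (Z x)
  set N := V ∩ (V₁ ∩ (V₂ ∩ V₃)) with hN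
  have oN : IsOpen N := hV.inter (o₁.inter (o₂.inter o₃))
  have xN : x ∈ N := ⟨hx, x₁, x₂, x₃⟩
  replace hX := hX.mono (show N ⊆ V from fun _ h => h.1)
  replace hY := hY.mono (show N ⊆ V from fun _ h => h.1)
  replace hZ := hZ.mono (show N ⊆ V from fun _ h => h.1)
  replace h₁ := h₁.mono (show N ⊆ V₁ from fun _ h => h.2.1)
  replace h₂ := h₂.mono (show N ⊆ V₂ from fun _ h => h.2.2.1)
  replace h₃ := h₃.mono (show N ⊆ V₃ from fun _ h => h.2.2.2)
  rw [← sub_eq_zero]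
  refine hg.eq_zero fun w => ?_
  obtain ⟨T, hT, rfl⟩ := exists_smooth_extension w
  replace hT := hT.mono (Set.subset_univ N)
  rw [map_sub, sub_apply, sub_eq_zero, riemann]
  have p1 := curvature_antisymm hg hD oN h₁ h₂ h₃ hT xN
  have p2 := curvature_antisymm hg hD oN h₁ h₂ hZ hT xN
  have p3 := curvature_pair_symm hg hD oN h₁ h₂ hZ hT xN
  have p4 := curvature_pair_symm hg hD oN h₁ hY hZ hT xN
  have p5 := curvature_antisymm hg hD oN hZ hT h₁ hY xN
  have p6 := curvature_antisymm hg hD oN hZ hT hX hY xN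
  have p7 := curvature_pair_symm hg hD oN hX hY hZ hT xN
  rw [extendVec_self] at p1 p3 p5
  rw [p1, ← p2, p3, ← p4, p4, p5, ← p6, p7]

end Curvature

/-! ### Gram matrices, expansion in a basis and metric traces. -/

section Gram

variable {M : Type*} [TopologicalSpace M] [ChartedSpace R4 M] [IsManifold 𝓘(ℝ, R4) ∞ M]
variable {x : M} {g : BField M} {D : Conn M}

/-- The Gram matrix of four tangent vectors. -/
def gram (g : BField M) (x : M) (b : Fin 4 → Tan M x) : Matrix (Fin 4) (Fin 4) ℝ :=
  Matrix.of fun i j => g x (b i) (b j)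

theorem finrank_tan (x : M) : Module.finrank ℝ (Tan M x) = 4 := by
  change Module.finrank ℝ R4 = 4
  simp

/-- A vector in terms of its products with the members of a basis. -/
theorem IsLorentzMetric.expand (hg : IsLorentzMetric g) {b : Fin 4 → Tan M x}
    (hb : (gram g x b).det ≠ 0) (u : Tan M x) :
    u = ∑ i, (∑ j, (gram g x b)⁻¹ i j * g x u (b j)) • b i := by
  have hu : IsUnit (gram g x b).det := isUnit_iff_ne_zero.2 hb
  have hli : LinearIndependent ℝ b := by
    rw [Fintype.linearIndependent_iff]
    intro c hc
    have h1 : Matrix.vecMul c (gram g x b) = 0 := by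
      ext j
      have := congrArg (fun z => g x z (b j)) hc
      simpa [Matrix.vecMul, dotProduct, gram, sum_apply] using this
    have h2 := Matrix.eq_zero_of_vecMul_eq_zero hb h1
    exact fun i => congrFun h2 i
  have hfr : Fintype.card (Fin 4) = Module.finrank ℝ (Tan M x) := by simp [finrank_tan]
  let B := basisOfLinearIndependentOfCardEqFinrank hli hfr
  have hB : ∀ i, B i = b i := fun i => by simp [B]
  obtain ⟨c, rfl⟩ : ∃ c : Fin 4 → ℝ, u = ∑ k, c k • b k :=
    ⟨fun k => B.repr u k, by simpa [hB] using (B.sum_repr u).symm⟩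
  refine Finset.sum_congr rfl fun i _ => ?_
  congr 1
  have h3 : ∀ k, ∑ j, (gram g x b)⁻¹ i j * g x (b k) (b j) = (1 : Matrix (Fin 4) (Fin 4) ℝ) i k := by
    intro k
    rw [← Matrix.nonsing_inv_mul _ hu, Matrix.mul_apply]
    exact Finset.sum_congr rfl fun j _ => by rw [hg.symm x (b k)]; rfl
  simp only [map_sum, map_smul, sum_apply, smul_apply, Finset.mul_sum]
  rw [Finset.sum_comm]
  have : ∀ k, ∑ j, (gram g x b)⁻¹ i j * c k • g x (b k) (b j)
      = c k * (1 : Matrix (Fin 4) (Fin 4) ℝ) i k := fun k => by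
    rw [← h3 k, Finset.mul_sum]
    exact Finset.sum_congr rfl fun j _ => by rw [smul_eq_mul]; ring
  rw [Finset.sum_congr rfl fun k _ => this k]
  simp [Matrix.one_apply]

theorem IsLorentzMetric.gram_det_ne_zero (hg : IsLorentzMetric g) {b : Fin 4 → Tan M x}
    (hb : LinearIndependent ℝ b) : (gram g x b).det ≠ 0 := by
  intro h
  obtain ⟨c, hc, h1⟩ := Matrix.exists_vecMul_eq_zero_iff.2 h
  have hfr : Fintype.card (Fin 4) = Module.finrank ℝ (Tan M x) := by simp [finrank_tan]
  let B := basisOfLinearIndependentOfCardEqFinrank hb hfr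
  have hB : ∀ i, B i = b i := fun i => by simp [B]
  have h2 : ∑ k, c k • b k = 0 := by
    refine hg.eq_zero fun w => ?_
    rw [← B.sum_repr w]
    simp only [hB, map_sum, map_smul]
    refine Finset.sum_eq_zero fun j _ => ?_
    have := congrFun h1 j
    simp only [Matrix.vecMul, dotProduct, gram, Matrix.of_apply, Pi.zero_apply] at this
    simp [sum_apply, this]
  exact hc (funext fun i => Fintype.linearIndependent_iff.1 hb c h2 i)

theorem linearIndependent_stdVec (x : M) : LinearIndependent ℝ (stdVec x) := by
  have h := (EuclideanSpace.basisFun (Fin 4) ℝ).toBasis.linearIndependent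
  have e : (stdVec x : Fin 4 → R4) = (EuclideanSpace.basisFun (Fin 4) ℝ).toBasis := by
    ext1 i
    rw [OrthonormalBasis.coe_toBasis, EuclideanSpace.basisFun_apply]
    rfl
  rw [← e] at h
  exact h

theorem invMetric_eq (g : BField M) (x : M) : invMetric g x = (gram g x (stdVec x))⁻¹ := rfl

/-- Turns the coordinate trace in the definition of `ricci` into a metric trace, to which `trace_eq`
applies. -/
theorem stdCoord_eq (hg : IsLorentzMetric g) (u : Tan M x) (i : Fin 4) :
    stdCoord x u i = ∑ j, invMetric g x i j * g x u (stdVec x j) := by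
  have h := hg.expand (hg.gram_det_ne_zero (linearIndependent_stdVec x)) u
  rw [← invMetric_eq] at h
  have h2 := congrArg (fun z : R4 => z i) h
  refine h2.trans ?_
  have : ∀ c : Fin 4 → ℝ,
      (∑ k, c k • (EuclideanSpace.single k (1 : ℝ) : R4) : R4) i = c i := fun c => by
    simp [Finset.sum_apply, Pi.single_apply]
  exact this fun i => ∑ j, invMetric g x i j * g x u (stdVec x j)

/-- The trace of a bilinear form with respect to the metric does not depend on the basis. -/
theorem trace_eq (hg : IsLorentzMetric g) (T : Tan M x →ₗ[ℝ] Tan M x →ₗ[ℝ] ℝ)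
    {b b' : Fin 4 → Tan M x} (hb : (gram g x b).det ≠ 0) (hb' : (gram g x b').det ≠ 0) :
    ∑ i, ∑ j, (gram g x b)⁻¹ i j * T (b i) (b j)
      = ∑ i, ∑ j, (gram g x b')⁻¹ i j * T (b' i) (b' j) := by
  have tr : ∀ A B : Matrix (Fin 4) (Fin 4) ℝ, ∑ i, ∑ j, A i j * B i j = (A * B.transpose).trace :=
    fun A B => by simp [Matrix.trace, Matrix.mul_apply]
  -- P is the matrix of the change of basis. Bilinear forms transform by congruence with P and the
  -- inverse Gram matrix by the inverse congruence, so P cancels inside the trace.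
  let P : Matrix (Fin 4) (Fin 4) ℝ :=
    Matrix.of fun i k => ∑ j, (gram g x b)⁻¹ k j * g x (b' i) (b j)
  have hP : ∀ i, b' i = ∑ k, P i k • b k := fun i => hg.expand hb (b' i)
  let mat : (Tan M x →ₗ[ℝ] Tan M x →ₗ[ℝ] ℝ) → (Fin 4 → Tan M x) → Matrix (Fin 4) (Fin 4) ℝ :=
    fun S b => Matrix.of fun i j => S (b i) (b j)
  have hmat : ∀ S, mat S b' = P * mat S b * P.transpose := fun S => by
    ext i j
    simp only [mat, Matrix.of_apply, hP i, hP j, map_sum, map_smul, LinearMap.sum_apply,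
      LinearMap.smul_apply, Matrix.mul_apply, Matrix.transpose_apply, Finset.sum_mul, smul_eq_mul]
    refine Finset.sum_congr rfl fun k _ => ?_
    rw [Finset.mul_sum]
    exact Finset.sum_congr rfl fun l _ => by ring
  let G : Tan M x →ₗ[ℝ] Tan M x →ₗ[ℝ] ℝ := LinearMap.mk₂ ℝ (fun u w => g x u w)
    (by simp) (by simp) (by simp) (by simp)
  have hG : gram g x b' = P * gram g x b * P.transpose := hmat G
  have hPu : IsUnit P.det := by
    refine isUnit_iff_ne_zero.2 fun h => hb' ?_
    rw [hG, Matrix.det_mul, Matrix.det_mul, h]; ring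
  have e1 := tr (gram g x b)⁻¹ (mat T b)
  have e2 := tr (gram g x b')⁻¹ (mat T b')
  simp only [mat, Matrix.of_apply] at e1 e2
  rw [e1, e2]
  change (_ * (mat T b).transpose).trace = (_ * (mat T b').transpose).trace
  have hPt : IsUnit P.transpose.det := by rwa [Matrix.det_transpose]
  rw [hmat T, hG, Matrix.mul_inv_rev, Matrix.mul_inv_rev, Matrix.transpose_mul,
    Matrix.transpose_mul, Matrix.transpose_transpose]
  calc ((gram g x b)⁻¹ * (mat T b).transpose).trace
      = ((P.transpose)⁻¹ * ((gram g x b)⁻¹ * (mat T b).transpose * P.transpose)).trace := by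
        rw [Matrix.trace_mul_comm (P.transpose)⁻¹, Matrix.mul_assoc,
          Matrix.mul_nonsing_inv _ hPt, Matrix.mul_one]
    _ = _ := by
        congr 1
        simp only [Matrix.mul_assoc]
        rw [← Matrix.mul_assoc P⁻¹ P, Matrix.nonsing_inv_mul _ hPu, Matrix.one_mul]

end Gram

/-! ### Linear transport equations along n. -/

section Transport

variable {M : Type*} [TopologicalSpace M] [ChartedSpace R4 M] [IsManifold 𝓘(ℝ, R4) ∞ M]
variable {V : Set M} {n Y : VField M} {x : M} {g : BField M} {D : Conn M}

theorem hasDerivWithinAt_comp_integralCurve {f : M → ℝ} {γ : ℝ → M} {s : Set ℝ} {t : ℝ}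
    (hf : MDifferentiableAt 𝓘(ℝ, R4) 𝓘(ℝ, ℝ) f (γ t))
    (hγ : IsMIntegralCurveOn (I := 𝓘(ℝ, R4)) γ n s) (ht : t ∈ s) :
    HasDerivWithinAt (fun τ => f (γ τ)) (dFun f (γ t) (n (γ t))) s t := by
  have h := hf.hasMFDerivAt.comp_hasMFDerivWithinAt t (hγ t ht)
  have h1 : HasFDerivWithinAt (f ∘ γ) ((show R4 →L[ℝ] ℝ from mfderiv 𝓘(ℝ, R4) 𝓘(ℝ, ℝ) f (γ t)).comp
      ((1 : ℝ →L[ℝ] ℝ).smulRight (show R4 from n (γ t)))) s t := h.hasFDerivWithinAt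
  refine h1.hasDerivWithinAt.congr_deriv ?_
  change (show R4 →L[ℝ] ℝ from mfderiv 𝓘(ℝ, R4) 𝓘(ℝ, ℝ) f (γ t)) ((1 : ℝ) • (show R4 from n (γ t))) = _
  rw [one_smul]
  rfl

variable [T2Space M]

/-- Near any point, the components of a solution of a linear transport equation along `n` with
respect to a local frame satisfy a linear system with bounded coefficients. -/
theorem transport_system (hg : IsLorentzMetric g) (hD : IsLeviCivita g D) (hV : IsOpen V)
    (hn : SmoothOn n V) (hY : SmoothOn Y V) (c : ℝ)
    (h : ∀ p ∈ V, D Y p (n p) = c • D n p (Y p)) (hx : x ∈ V) :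
    ∃ (N : Set M) (y : Fin 4 → M → ℝ) (A : Fin 4 → Fin 4 → M → ℝ) (C : ℝ), N ∈ 𝓝 x ∧
      (∀ p ∈ N, (Y p = 0 ↔ ∀ i, y i p = 0) ∧
        (∀ i, MDifferentiableAt 𝓘(ℝ, R4) 𝓘(ℝ, ℝ) (y i) p) ∧
        (∀ i, dFun (y i) p (n p) = ∑ j, A i j p * y j p) ∧ ∀ i j, |A i j p| ≤ C) := by
  choose b hb hbx using fun i => exists_smooth_extension (stdVec x i)
  replace hb := fun i => (hb i).mono (Set.subset_univ V)
  let G : M → Matrix (Fin 4) (Fin 4) ℝ := fun p => gram g p (fun i => b i p)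
  have hGc : ContinuousOn G V := by
    refine continuousOn_pi.2 fun i => continuousOn_pi.2 fun j => ?_
    exact (hg.smoothFun (hb i) (hb j)).continuousOn
  have hGx : (G x).det ≠ 0 := by
    have : (fun i => b i x) = stdVec x := funext hbx
    simp only [G, this]
    exact hg.gram_det_ne_zero (linearIndependent_stdVec x)
  have hGat : ContinuousAt G x := hGc.continuousAt (hV.mem_nhds hx)
  have hdet : ∀ᶠ p in 𝓝 x, (G p).det ≠ 0 :=
    (Continuous.matrix_det continuous_id).continuousAt.comp hGat |>.eventually_ne hGx
  have hinv : ContinuousAt (fun p => (G p)⁻¹) x := by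
    have h1 : ContinuousAt (fun p => (G p).det⁻¹ • (G p).adjugate) x :=
      (((Continuous.matrix_det continuous_id).continuousAt.comp hGat).inv₀ hGx).smul
        ((Continuous.matrix_adjugate continuous_id).continuousAt.comp hGat)
    refine h1.congr (Filter.Eventually.of_forall fun p => ?_)
    simp [Matrix.inv_def]
  let y : Fin 4 → M → ℝ := fun i p => g p (Y p) (b i p)
  -- The coefficients come from n(g(Y, b_i)) = g(c ∇_Y n, b_i) + g(Y, ∇_n b_i), with Y expanded in
  -- the frame b through the inverse Gram matrix.
  let A : Fin 4 → Fin 4 → M → ℝ := fun i j p =>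
    ∑ k, (G p)⁻¹ k j * (c * g p (D n p (b k p)) (b i p) + g p (b k p) (D (b i) p (n p)))
  have hA : ∀ i j, ContinuousAt (A i j) x := fun i j => by
    refine tendsto_finsetSum _ fun k _ => ?_
    have h1 : ContinuousAt (fun p => (G p)⁻¹ k j) x :=
      continuousAt_pi.1 (continuousAt_pi.1 hinv k) j
    have h2 := (hg.smoothFun ((hb k).cov hD.smooth hn hV) (hb i)).continuousOn.continuousAt
      (hV.mem_nhds hx)
    have h3 := (hg.smoothFun (hb k) (hn.cov hD.smooth (hb i) hV)).continuousOn.continuousAt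
      (hV.mem_nhds hx)
    exact h1.mul ((continuousAt_const.mul h2).add h3)
  obtain ⟨C, hC⟩ : ∃ C : ℝ, ∀ᶠ p in 𝓝 x, ∀ i j, |A i j p| ≤ C := by
    -- A sum of positive terms dominates each of them, which gives one bound for all sixteen
    -- coefficients.
    refine ⟨∑ i, ∑ j, (|A i j x| + 1), ?_⟩
    simp only [Filter.eventually_all]
    intro i j
    have h1 : ∀ᶠ p in 𝓝 x, |A i j p| < |A i j x| + 1 :=
      (hA i j).abs.eventually_lt_const (by linarith)
    filter_upwards [h1] with p hp
    have h2 : |A i j x| + 1 ≤ ∑ j, (|A i j x| + 1) :=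
      Finset.single_le_sum (f := fun j => |A i j x| + 1) (fun j _ => by positivity)
        (Finset.mem_univ j)
    have h3 : ∑ j, (|A i j x| + 1) ≤ ∑ i, ∑ j, (|A i j x| + 1) :=
      Finset.single_le_sum (f := fun i => ∑ j, (|A i j x| + 1))
        (fun i _ => Finset.sum_nonneg fun j _ => by positivity) (Finset.mem_univ i)
    linarith
  refine ⟨_, y, A, C, Filter.inter_mem (hV.mem_nhds hx) (Filter.inter_mem hdet hC), ?_⟩
  rintro p ⟨hpV, hpd, hpC⟩
  have hexp := hg.expand hpd (Y p)
  refine ⟨⟨fun h0 i => by simp [y, h0], fun h0 => ?_⟩,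
    fun i => (hg.smoothFun hY (hb i)).mdiffAt hV hpV, fun i => ?_, hpC⟩
  · rw [hexp]
    refine Finset.sum_eq_zero fun i _ => ?_
    have : ∀ j, g p (Y p) (b j p) = 0 := h0
    simp [this]
  · have e1 := hD.metric Y (b i) p (hY.diffAt hV hpV) ((hb i).diffAt hV hpV) (n p)
    change dFun (fun p => g p (Y p) (b i p)) p (n p) = _
    rw [e1, h p hpV]
    have e2 : ∀ L : Tan M p →ₗ[ℝ] ℝ,
        L (Y p) = ∑ j, (∑ k, (G p)⁻¹ k j * L (b k p)) * y j p := fun L => by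
      conv_lhs => rw [hexp]
      simp only [map_sum, map_smul, smul_eq_mul, Finset.sum_mul]
      rw [Finset.sum_comm]
      exact Finset.sum_congr rfl fun j _ => Finset.sum_congr rfl fun k _ => by
        simp only [y, G]; ring
    exact e2
      { toFun := fun u => g p (c • D n p u) (b i p) + g p u (D (b i) p (n p))
        map_add' := fun u w => by simp only [map_add, smul_add, add_apply]; ring
        map_smul' := fun r u => by
          simp only [map_smul, smul_apply, smul_eq_mul, RingHom.id_apply]; ring } |>.trans (by
        refine Finset.sum_congr rfl fun j _ => ?_
        simp [A])

/-- Uniqueness for linear differential equations, without a global frame along the curve. The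
constant c covers the three uses: c = -1 for [K, n], c = 1 for a field commuting with n, c = 0 for a
parallel field. -/
theorem transport_eq_zero_iff (hg : IsLorentzMetric g) (hD : IsLeviCivita g D) (hV : IsOpen V)
    (hn : SmoothOn n V) (hY : SmoothOn Y V) (c : ℝ)
    (h : ∀ p ∈ V, D Y p (n p) = c • D n p (Y p)) {γ : ℝ → M} {s : ℝ}
    (hγ : IsMIntegralCurveOn (I := 𝓘(ℝ, R4)) γ n (Set.uIcc 0 s))
    (hγV : ∀ t ∈ Set.uIcc 0 s, γ t ∈ V) : Y (γ 0) = 0 ↔ Y (γ s) = 0 := by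
  -- Vanishing at two parameters being equivalent is a transitive and symmetric relation, so by
  -- connectedness of the interval it suffices to prove it near each parameter, where a local frame
  -- is available.
  refine IsPreconnected.induction₂ (s := Set.uIcc 0 s) isPreconnected_uIcc
    (fun t t' => Y (γ t) = 0 ↔ Y (γ t') = 0) ?_ (fun _ _ _ _ _ _ h h' => h.trans h')
    (fun _ _ _ _ h => h.symm) Set.left_mem_uIcc Set.right_mem_uIcc
  intro t₀ ht₀
  obtain ⟨N, y, A, C, hN, hNp⟩ := transport_system hg hD hV hn hY c h (hγV t₀ ht₀)
  have key : ∀ a b : ℝ, a ≤ b → Set.Icc a b ⊆ Set.uIcc 0 s → (∀ t ∈ Set.Icc a b, γ t ∈ N) →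
      (Y (γ a) = 0 ↔ Y (γ b) = 0) := by
    intro a b hab hsub hin
    let f : ℝ → Fin 4 → ℝ := fun t i => y i (γ t)
    let w : ℝ → (Fin 4 → ℝ) → Fin 4 → ℝ := fun t z i => ∑ j, A i j (γ t) * z j
    -- In the sup norm each component is a sum of four terms, each with coefficient at most C, hence
    -- the constant 4C.
    have hw : ∀ t ∈ Set.Icc a b, LipschitzOnWith (4 * C).toNNReal (w t) Set.univ := by
      intro t ht
      have hC0 : 0 ≤ C := (abs_nonneg _).trans ((hNp _ (hin t ht)).2.2.2 0 0)
      refine LipschitzOnWith.of_dist_le_mul fun z _ z' _ => ?_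
      rw [Real.coe_toNNReal _ (by positivity), dist_pi_le_iff (by positivity)]
      intro i
      rw [Real.dist_eq]
      have : w t z i - w t z' i = ∑ j, A i j (γ t) * (z j - z' j) := by
        simp only [w, ← Finset.sum_sub_distrib, mul_sub]
      rw [this]
      calc |∑ j, A i j (γ t) * (z j - z' j)| ≤ ∑ j, |A i j (γ t) * (z j - z' j)| :=
            Finset.abs_sum_le_sum_abs _ _
        _ ≤ ∑ _j : Fin 4, C * dist z z' := by
            refine Finset.sum_le_sum fun j _ => ?_
            rw [abs_mul]
            exact mul_le_mul ((hNp _ (hin t ht)).2.2.2 i j)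
              (by rw [← Real.dist_eq]; exact dist_le_pi_dist z z' j) (abs_nonneg _) hC0
        _ = 4 * C * dist z z' := by simp; ring
    have hder : ∀ t ∈ Set.Icc a b, HasDerivWithinAt f (w t (f t)) (Set.Icc a b) t := by
      intro t ht
      refine hasDerivWithinAt_pi.2 fun i => ?_
      have := hasDerivWithinAt_comp_integralCurve ((hNp _ (hin t ht)).2.1 i) (hγ.mono hsub) ht
      rwa [(hNp _ (hin t ht)).2.2.1 i] at this
    have hcont : ContinuousOn f (Set.Icc a b) := fun t ht => (hder t ht).continuousWithinAt
    have h0 : ∀ t S, HasDerivWithinAt (fun _ : ℝ => (0 : Fin 4 → ℝ)) (w t 0) S t := fun t S => by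
      have : w t 0 = 0 := by ext i; simp [w]
      rw [this]; exact hasDerivWithinAt_const t S 0
    have hzero : ∀ t ∈ Set.Icc a b, Y (γ t) = 0 ↔ f t = 0 := fun t ht =>
      (hNp _ (hin t ht)).1.trans funext_iff.symm
    have ha := Set.left_mem_Icc.2 hab
    have hb := Set.right_mem_Icc.2 hab
    rw [hzero a ha, hzero b hb]
    constructor
    · intro hf0
      exact ODE_solution_unique_of_mem_Icc_right (g := fun _ => 0) (s := fun _ => Set.univ)
        (fun t ht => hw t (Set.Ico_subset_Icc_self ht)) hcont
        (fun t ht => (hder t (Set.Ico_subset_Icc_self ht)).mono_of_mem_nhdsWithin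
          (Icc_mem_nhdsGE_of_mem ht)) (fun _ _ => Set.mem_univ _) continuousOn_const
        (fun t _ => h0 t _) (fun _ _ => Set.mem_univ _) hf0 hb
    · intro hf0
      exact ODE_solution_unique_of_mem_Icc_left (g := fun _ => 0) (s := fun _ => Set.univ)
        (fun t ht => hw t (Set.Ioc_subset_Icc_self ht)) hcont
        (fun t ht => (hder t (Set.Ioc_subset_Icc_self ht)).mono_of_mem_nhdsWithin
          (Icc_mem_nhdsLE_of_mem ht)) (fun _ _ => Set.mem_univ _) continuousOn_const
        (fun t _ => h0 t _) (fun _ _ => Set.mem_univ _) hf0 ha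
  have hcw := hγ.continuousWithinAt ht₀ hN
  obtain ⟨ε, hε, hball⟩ := Metric.mem_nhdsWithin_iff.1 hcw
  filter_upwards [self_mem_nhdsWithin, mem_nhdsWithin_of_mem_nhds (Metric.ball_mem_nhds t₀ hε)]
    with t ht htb
  have hconv : ∀ {a b : ℝ}, a ∈ Set.uIcc 0 s → b ∈ Set.uIcc 0 s → a ∈ Metric.ball t₀ ε →
      b ∈ Metric.ball t₀ ε → Set.Icc a b ⊆ Set.uIcc 0 s ∧ ∀ τ ∈ Set.Icc a b, γ τ ∈ N := by
    intro a b ha hb ha' hb'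
    have h1 : Set.Icc a b ⊆ Set.uIcc 0 s := Set.ordConnected_uIcc.out ha hb
    have h2 : Set.Icc a b ⊆ Metric.ball t₀ ε := by
      rw [Real.ball_eq_Ioo] at *
      exact Set.ordConnected_Ioo.out ha' hb'
    exact ⟨h1, fun τ hτ => hball ⟨h2 hτ, h1 hτ⟩⟩
  rcases le_total t₀ t with hle | hle
  · have := hconv ht₀ ht (Metric.mem_ball_self hε) htb
    exact key _ _ hle this.1 this.2
  · have := hconv ht ht₀ htb (Metric.mem_ball_self hε)
    exact (key _ _ hle this.1 this.2).symm

end Transport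

/-! ### Tangent spaces of the horizon and functions constant along it. -/

section HorizonTangent

variable {M : Type*} [TopologicalSpace M] [ChartedSpace R4 M] [IsManifold 𝓘(ℝ, R4) ∞ M]
variable {B : Type*} [TopologicalSpace B] [ChartedSpace R2 B]
variable {Φ : B × ℝ → M} {q : B × ℝ}

/-- In suitable charts an immersion is z ↦ (z, 0). Projecting to the first factor turns Φ, read in
the target chart, into the source chart, whose derivative is injective. -/
theorem mfderiv_injective_of_embedding [IsManifold 𝓘(ℝ, R2) ∞ B]
    (hΦ : Manifold.IsSmoothEmbedding (𝓘(ℝ, R2).prod 𝓘(ℝ, ℝ)) 𝓘(ℝ, R4) ∞ Φ) (q : B × ℝ) :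
    Function.Injective (mfderiv (𝓘(ℝ, R2).prod 𝓘(ℝ, ℝ)) 𝓘(ℝ, R4) Φ q) := by
  have h := hΦ.isImmersion.isImmersionAt q
  have hΦd : MDifferentiableAt (𝓘(ℝ, R2).prod 𝓘(ℝ, ℝ)) 𝓘(ℝ, R4) Φ q :=
    hΦ.contMDiff.mdifferentiableAt (by simp)
  let ψ := h.domChart
  have hψ : ψ.MDifferentiable (𝓘(ℝ, R2).prod 𝓘(ℝ, ℝ)) (𝓘(ℝ, R2).prod 𝓘(ℝ, ℝ)) :=
    ⟨(contMDiffOn_of_mem_maximalAtlas h.domChart_mem_maximalAtlas).mdifferentiableOn (by simp),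
      (contMDiffOn_symm_of_mem_maximalAtlas h.domChart_mem_maximalAtlas).mdifferentiableOn
        (by simp)⟩
  have hφ : MDifferentiableAt 𝓘(ℝ, R4) 𝓘(ℝ, R4) h.codChart (Φ q) :=
    (contMDiffAt_of_mem_maximalAtlas h.codChart_mem_maximalAtlas
      h.mem_codChart_source).mdifferentiableAt (by simp)
  let L : R4 →L[ℝ] R2 × ℝ :=
    (ContinuousLinearMap.fst ℝ (R2 × ℝ) h.complement).comp h.equiv.symm.toContinuousLinearMap
  have hev : (fun q' => L (h.codChart (Φ q'))) =ᶠ[𝓝 q]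
      fun q' => (𝓘(ℝ, R2).prod 𝓘(ℝ, ℝ)) (ψ q') := by
    filter_upwards [ψ.open_source.mem_nhds h.mem_domChart_source] with q' hq'
    have h1 := h.writtenInCharts ((h.domChart.extend (𝓘(ℝ, R2).prod 𝓘(ℝ, ℝ))).map_source
      (by simpa using hq'))
    simp only [Function.comp] at h1
    rw [(h.domChart.extend _).left_inv (by simpa using hq')] at h1
    have h2 : h.codChart (Φ q') = h.equiv (((𝓘(ℝ, R2).prod 𝓘(ℝ, ℝ)) (ψ q')), 0) := h1
    simp [L, h2]
  have hL : MDifferentiableAt 𝓘(ℝ, R4) 𝓘(ℝ, R2 × ℝ) L (h.codChart (Φ q)) :=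
    L.mdifferentiableAt
  have hI : MDifferentiableAt (𝓘(ℝ, R2).prod 𝓘(ℝ, ℝ)) 𝓘(ℝ, R2 × ℝ)
      (𝓘(ℝ, R2).prod 𝓘(ℝ, ℝ)) (ψ q) := (𝓘(ℝ, R2).prod 𝓘(ℝ, ℝ)).mdifferentiableAt
  have e1 := (hL.hasMFDerivAt.comp q (hφ.hasMFDerivAt.comp q hΦd.hasMFDerivAt))
  have e2 := (𝓘(ℝ, R2).prod 𝓘(ℝ, ℝ)).hasMFDerivAt (x := ψ q) |>.comp q
    (hψ.mdifferentiableAt h.mem_domChart_source).hasMFDerivAt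
  have e3 := (e1.congr_of_eventuallyEq hev.symm)
  have e4 := hasMFDerivAt_unique e3 e2
  refine (injective_iff_map_eq_zero _).2 fun w hw => ?_
  have h0 : mfderiv (𝓘(ℝ, R2).prod 𝓘(ℝ, ℝ)) (𝓘(ℝ, R2).prod 𝓘(ℝ, ℝ)) ψ q w = 0 := by
    have h5 := congrArg (fun A => A w) e4
    refine h5.symm.trans ?_
    change mfderiv 𝓘(ℝ, R4) 𝓘(ℝ, R2 × ℝ) L (h.codChart (Φ q))
      (mfderiv 𝓘(ℝ, R4) 𝓘(ℝ, R4) h.codChart (Φ q)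
      (mfderiv (𝓘(ℝ, R2).prod 𝓘(ℝ, ℝ)) 𝓘(ℝ, R4) Φ q w)) = 0
    rw [hw, map_zero, map_zero]
  exact (injective_iff_map_eq_zero _).1 (hψ.mfderiv_injective h.mem_domChart_source) w h0

theorem finrank_horizonTangent [IsManifold 𝓘(ℝ, R2) ∞ B]
    (hΦ : Manifold.IsSmoothEmbedding (𝓘(ℝ, R2).prod 𝓘(ℝ, ℝ)) 𝓘(ℝ, R4) ∞ Φ) (q : B × ℝ) :
    Module.finrank ℝ (horizonTangent Φ q) = 3 := by
  refine (LinearMap.finrank_range_of_inj (mfderiv_injective_of_embedding hΦ q)).trans ?_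
  change Module.finrank ℝ (R2 × ℝ) = 3
  simp

/-- A subspace of dimension 3 on which a nonzero functional vanishes is its kernel. -/
theorem mem_horizonTangent_iff [IsManifold 𝓘(ℝ, R2) ∞ B]
    (hΦ : Manifold.IsSmoothEmbedding (𝓘(ℝ, R2).prod 𝓘(ℝ, ℝ)) 𝓘(ℝ, R4) ∞ Φ) {q : B × ℝ}
    (α : Tan M (Φ q) →L[ℝ] ℝ) {u : Tan M (Φ q)} (hu : α u ≠ 0)
    (h : ∀ w ∈ horizonTangent Φ q, α w = 0) (w : Tan M (Φ q)) :
    w ∈ horizonTangent Φ q ↔ α w = 0 := by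
  have hfd : FiniteDimensional ℝ (Tan M (Φ q)) := inferInstanceAs (FiniteDimensional ℝ R4)
  have hle : horizonTangent Φ q ≤ LinearMap.ker α.toLinearMap := fun w hw => h w hw
  have h1 := LinearMap.finrank_range_add_finrank_ker α.toLinearMap
  have h2 : 0 < Module.finrank ℝ (LinearMap.range α.toLinearMap) := by
    rw [Module.finrank_pos_iff_exists_ne_zero]
    exact ⟨⟨α u, u, rfl⟩, fun h => hu (congrArg Subtype.val h)⟩
  have h3 : Module.finrank ℝ (LinearMap.ker α.toLinearMap) ≤ 3 := by
    rw [finrank_tan] at h1; omega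
  have heq := Submodule.eq_of_le_of_finrank_le hle (h3.trans (finrank_horizonTangent hΦ q).ge)
  rw [heq]
  rfl

/-- A function that is constant along the horizon has vanishing tangential derivatives. -/
theorem dFun_eq_zero_of_const {f : M → ℝ} {c : ℝ}
    (hΦ : Manifold.IsSmoothEmbedding (𝓘(ℝ, R2).prod 𝓘(ℝ, ℝ)) 𝓘(ℝ, R4) ∞ Φ)
    (hf : MDifferentiableAt 𝓘(ℝ, R4) 𝓘(ℝ, ℝ) f (Φ q)) (h : ∀ᶠ q' in 𝓝 q, f (Φ q') = c) :
    ∀ w ∈ horizonTangent Φ q, dFun f (Φ q) w = 0 := by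
  rintro _ ⟨u, rfl⟩
  have hΦd : MDifferentiableAt (𝓘(ℝ, R2).prod 𝓘(ℝ, ℝ)) 𝓘(ℝ, R4) Φ q :=
    hΦ.contMDiff.mdifferentiableAt (by simp)
  have h1 := hf.hasMFDerivAt.comp q hΦd.hasMFDerivAt
  have h2 : HasMFDerivAt (𝓘(ℝ, R2).prod 𝓘(ℝ, ℝ)) 𝓘(ℝ, ℝ) (f ∘ Φ) q 0 :=
    (hasMFDerivAt_const c q).congr_of_eventuallyEq h
  have h3 := congrArg (fun A => A u) (hasMFDerivAt_unique h1 h2)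
  exact h3

/-- A function on spacetime whose tangential derivatives along the connected horizon vanish is
constant on the horizon. -/
theorem const_of_dFun_eq_zero [ConnectedSpace B] [IsManifold 𝓘(ℝ, R2) ∞ B] {f : M → ℝ}
    (hΦ : Manifold.IsSmoothEmbedding (𝓘(ℝ, R2).prod 𝓘(ℝ, ℝ)) 𝓘(ℝ, R4) ∞ Φ)
    (hf : ∀ q, MDifferentiableAt 𝓘(ℝ, R4) 𝓘(ℝ, ℝ) f (Φ q))
    (h : ∀ q, ∀ w ∈ horizonTangent Φ q, dFun f (Φ q) w = 0) (q q' : B × ℝ) :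
    f (Φ q) = f (Φ q') := by
  have hF : ∀ q, HasMFDerivAt (𝓘(ℝ, R2).prod 𝓘(ℝ, ℝ)) 𝓘(ℝ, ℝ) (f ∘ Φ) q 0 := fun q => by
    have hΦd : MDifferentiableAt (𝓘(ℝ, R2).prod 𝓘(ℝ, ℝ)) 𝓘(ℝ, R4) Φ q :=
      hΦ.contMDiff.mdifferentiableAt (by simp)
    have h1 := (hf q).hasMFDerivAt.comp q hΦd.hasMFDerivAt
    convert h1 using 1
    ext u
    exact (h q _ ⟨u, rfl⟩).symm
  have : Std.Symm fun q q' : B × ℝ => f (Φ q) = f (Φ q') := ⟨fun _ _ h => h.symm⟩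
  refine PreconnectedSpace.induction₂ (fun q q' => f (Φ q) = f (Φ q')) (fun q => ?_)
    ⟨fun _ _ _ h h' => h.trans h'⟩ q q'
  let I := (𝓘(ℝ, R2).prod 𝓘(ℝ, ℝ))
  let φ := extChartAt I q
  have ht : φ.target ∈ 𝓝 (φ q) := extChartAt_target_mem_nhds q
  -- A function with zero derivative is constant on a ball in a chart. Connectedness of B × ℝ then
  -- extends local to global constancy.
  obtain ⟨ε, hε, hb⟩ := Metric.mem_nhds_iff.1 ht
  have hd : ∀ z ∈ Metric.ball (φ q) ε, HasFDerivAt ((f ∘ Φ) ∘ φ.symm) (0 : R2 × ℝ →L[ℝ] ℝ) z := by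
    intro z hz
    have h1 : MDifferentiableAt 𝓘(ℝ, R2 × ℝ) I φ.symm z :=
      ((contMDiffOn_extChartAt_symm (n := ∞) q).contMDiffAt
        (Filter.mem_of_superset (Metric.isOpen_ball.mem_nhds hz) hb)).mdifferentiableAt (by simp)
    have h2 := (hF (φ.symm z)).comp z h1.hasMFDerivAt
    have h3 : HasFDerivAt ((f ∘ Φ) ∘ φ.symm) ((0 : R2 × ℝ →L[ℝ] ℝ).comp
        (show R2 × ℝ →L[ℝ] R2 × ℝ from mfderiv 𝓘(ℝ, R2 × ℝ) I φ.symm z)) z := h2.hasFDerivAt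
    rwa [ContinuousLinearMap.zero_comp] at h3
  have hconst : ∀ z ∈ Metric.ball (φ q) ε, (f ∘ Φ) (φ.symm z) = (f ∘ Φ) (φ.symm (φ q)) :=
    fun z hz => Metric.isOpen_ball.is_const_of_fderiv_eq_zero
      (convex_ball _ _).isPreconnected
      (fun z hz => (hd z hz).differentiableAt.differentiableWithinAt)
      (fun z hz => (hd z hz).fderiv) hz (Metric.mem_ball_self hε)
  filter_upwards [(continuousAt_extChartAt (I := I) q).preimage_mem_nhds
    (Metric.ball_mem_nhds (φ q) hε), extChartAt_source_mem_nhds (I := I) q] with q' h1 h2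
  have h3 := hconst (φ q') h1
  simp only [Function.comp, φ.left_inv h2, φ.left_inv (mem_extChartAt_source q)] at h3
  exact h3.symm

end HorizonTangent

/-! ### Null vectors in Lorentzian linear algebra. -/

section LorentzAlgebra

variable {M : Type*} [TopologicalSpace M] [ChartedSpace R4 M] [IsManifold 𝓘(ℝ, R4) ∞ M]
variable {x : M} {g : BField M}

/-- Coordinates in which the metric at a point is the Minkowski metric. -/
theorem IsLorentzMetric.exists_coords (hg : IsLorentzMetric g) (x : M) :
    ∃ y : Tan M x →ₗ[ℝ] (Fin 4 → ℝ), Function.Injective y ∧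
      ∀ u w, g x u w = - (y u 0 * y w 0) + y u 1 * y w 1 + y u 2 * y w 2 + y u 3 * y w 3 := by
  obtain ⟨b, hb⟩ := hg.signature x
  have hdet : (gram g x b).det ≠ 0 := by
    have : gram g x b = Matrix.diagonal fun i => if i = 0 then -1 else 1 := by
      ext i j
      simp [gram, hb, Matrix.diagonal_apply]
    rw [this, Matrix.det_diagonal]
    simp
  let G := gram g x b
  let y : Tan M x →ₗ[ℝ] (Fin 4 → ℝ) := LinearMap.pi fun i =>
    ∑ j, G⁻¹ i j • (g x (b j)).toLinearMap
  have hy : ∀ u, u = ∑ i, y u i • b i := fun u => by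
    conv_lhs => rw [hg.expand hdet u]
    refine Finset.sum_congr rfl fun i _ => ?_
    congr 1
    simp only [y, LinearMap.pi_apply, LinearMap.sum_apply, LinearMap.smul_apply, smul_eq_mul]
    exact Finset.sum_congr rfl fun j _ => by rw [hg.symm x u]; rfl
  refine ⟨y, fun u w h => by rw [hy u, hy w, h], fun u w => ?_⟩
  conv_lhs => rw [hy u, hy w]
  simp only [Fin.sum_univ_four, map_add, map_smul, add_apply, smul_apply, hb, smul_eq_mul]
  simp
  ring

/-- Two orthogonal null vectors are parallel. -/
theorem IsLorentzMetric.parallel (hg : IsLorentzMetric g) {k u : Tan M x} (hk : k ≠ 0)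
    (hkk : g x k k = 0) (huu : g x u u = 0) (hku : g x k u = 0) : ∃ c : ℝ, u = c • k := by
  obtain ⟨y, hy, hyg⟩ := hg.exists_coords x
  have hk0 : y k 0 ≠ 0 := by
    intro h0
    rw [hyg, h0] at hkk
    refine hk (hy ?_)
    have h1 : y k 1 = 0 := by nlinarith [sq_nonneg (y k 1), sq_nonneg (y k 2), sq_nonneg (y k 3)]
    have h2 : y k 2 = 0 := by nlinarith [sq_nonneg (y k 1), sq_nonneg (y k 2), sq_nonneg (y k 3)]
    have h3 : y k 3 = 0 := by nlinarith [sq_nonneg (y k 1), sq_nonneg (y k 2), sq_nonneg (y k 3)]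
    ext i
    fin_cases i <;> simp [h0, h1, h2, h3]
  refine ⟨y u 0 / y k 0, hy ?_⟩
  rw [hyg] at hkk huu hku
  -- The spatial part of k⁰u - u⁰k has squared length (k⁰)² g(u,u) + (u⁰)² g(k,k) - 2k⁰u⁰ g(k,u),
  -- because its time component is zero. All three products vanish, so k⁰u = u⁰k.
  have key : (y k 0 * y u 1 - y u 0 * y k 1) ^ 2 + (y k 0 * y u 2 - y u 0 * y k 2) ^ 2
      + (y k 0 * y u 3 - y u 0 * y k 3) ^ 2 = 0 := by
    linear_combination (y k 0) ^ 2 * huu + (y u 0) ^ 2 * hkk - 2 * y k 0 * y u 0 * hku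
  have e1 : y k 0 * y u 1 - y u 0 * y k 1 = 0 := by
    nlinarith [sq_nonneg (y k 0 * y u 1 - y u 0 * y k 1),
      sq_nonneg (y k 0 * y u 2 - y u 0 * y k 2), sq_nonneg (y k 0 * y u 3 - y u 0 * y k 3)]
  have e2 : y k 0 * y u 2 - y u 0 * y k 2 = 0 := by
    nlinarith [sq_nonneg (y k 0 * y u 1 - y u 0 * y k 1),
      sq_nonneg (y k 0 * y u 2 - y u 0 * y k 2), sq_nonneg (y k 0 * y u 3 - y u 0 * y k 3)]
  have e3 : y k 0 * y u 3 - y u 0 * y k 3 = 0 := by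
    nlinarith [sq_nonneg (y k 0 * y u 1 - y u 0 * y k 1),
      sq_nonneg (y k 0 * y u 2 - y u 0 * y k 2), sq_nonneg (y k 0 * y u 3 - y u 0 * y k 3)]
  ext i
  rw [map_smul, Pi.smul_apply, smul_eq_mul, div_mul_eq_mul_div, eq_div_iff hk0]
  fin_cases i
  · simp
  · change y u 1 * y k 0 = y u 0 * y k 1; linarith
  · change y u 2 * y k 0 = y u 0 * y k 2; linarith
  · change y u 3 * y k 0 = y u 0 * y k 3; linarith

/-- Vectors orthogonal to a null vector are not timelike. -/
theorem IsLorentzMetric.nonneg_of_orthogonal (hg : IsLorentzMetric g) {k u : Tan M x}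
    (hk : k ≠ 0) (hkk : g x k k = 0) (hku : g x k u = 0) : 0 ≤ g x u u := by
  obtain ⟨y, hy, hyg⟩ := hg.exists_coords x
  have hk0 : y k 0 ≠ 0 := by
    intro h0
    rw [hyg, h0] at hkk
    refine hk (hy ?_)
    have h1 : y k 1 = 0 := by nlinarith [sq_nonneg (y k 1), sq_nonneg (y k 2), sq_nonneg (y k 3)]
    have h2 : y k 2 = 0 := by nlinarith [sq_nonneg (y k 1), sq_nonneg (y k 2), sq_nonneg (y k 3)]
    have h3 : y k 3 = 0 := by nlinarith [sq_nonneg (y k 1), sq_nonneg (y k 2), sq_nonneg (y k 3)]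
    ext i
    fin_cases i <;> simp [h0, h1, h2, h3]
  rw [hyg] at hkk hku ⊢
  -- The same identity with only g(k,k) and g(k,u) zero exhibits (k⁰)² g(u,u) as a sum of squares.
  have key : (y k 0 * y u 1 - y u 0 * y k 1) ^ 2 + (y k 0 * y u 2 - y u 0 * y k 2) ^ 2
      + (y k 0 * y u 3 - y u 0 * y k 3) ^ 2 = (y k 0) ^ 2 *
        (-(y u 0 * y u 0) + y u 1 * y u 1 + y u 2 * y u 2 + y u 3 * y u 3) := by
    linear_combination (y u 0) ^ 2 * hkk - 2 * y k 0 * y u 0 * hku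
  have : 0 < (y k 0) ^ 2 := by positivity
  by_contra hneg
  push Not at hneg
  nlinarith [sq_nonneg (y k 0 * y u 1 - y u 0 * y k 1),
      sq_nonneg (y k 0 * y u 2 - y u 0 * y k 2), sq_nonneg (y k 0 * y u 3 - y u 0 * y k 3)]

end LorentzAlgebra

/-! ### The Bondi-like neighbourhood at the horizon, and propagation of K = aζ. -/

section BondiHorizon

variable {M : Type*} [TopologicalSpace M] [T2Space M] [ChartedSpace R4 M]
  [IsManifold 𝓘(ℝ, R4) ∞ M]
variable {B : Type*} [TopologicalSpace B] [ChartedSpace R2 B] [IsManifold 𝓘(ℝ, R2) ∞ B]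
variable {g : BField M} {D : Conn M} {Φ : B × ℝ → M} {U V : Set M} {n ζ : VField M} {v r : M → ℝ}
variable {X Y K : VField M} {q : B × ℝ}

theorem IsBondiNeighbourhood.mem (hU : IsBondiNeighbourhood g D Φ U n ζ v r) (q : B × ℝ) :
    Φ q ∈ U := hU.contains ⟨q, rfl⟩

theorem IsBondiNeighbourhood.zeta_ne_zero (hU : IsBondiNeighbourhood g D Φ U n ζ v r) {x : M}
    (hx : x ∈ U) : ζ x ≠ 0 := by
  intro h
  have := hU.zeta_v x hx
  simp [h] at this

theorem IsBondiNeighbourhood.metric_n_zeta (hU : IsBondiNeighbourhood g D Φ U n ζ v r)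
    (q : B × ℝ) : g (Φ q) (n (Φ q)) (ζ (Φ q)) = -1 := by
  rw [hU.n_horizon q _ (hU.zeta_tangent q), hU.zeta_v _ (hU.mem q)]

theorem generator_mem (Φ : B × ℝ → M) (q : B × ℝ) : generator Φ q ∈ horizonTangent Φ q := ⟨_, rfl⟩

theorem generator_ne_zero (hΦ : IsNonExpandingHorizon g D Φ) (q : B × ℝ) :
    generator Φ q ≠ 0 := by
  intro h
  have h1 := mfderiv_injective_of_embedding hΦ.embedding q
    (a₁ := ((0, 1) : R2 × ℝ)) (a₂ := ((0, 0) : R2 × ℝ)) (h.trans (map_zero _).symm)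
  have h2 : ((0, 1) : R2 × ℝ) = (0, 0) := h1
  simp at h2

/-- A null vector tangent to the horizon is a multiple of the null generator. -/
theorem null_tangent_parallel (hg : IsLorentzMetric g) (hΦ : IsNonExpandingHorizon g D Φ)
    {u : Tan M (Φ q)} (hu : u ∈ horizonTangent Φ q) (hn : g (Φ q) u u = 0) :
    ∃ c : ℝ, u = c • generator Φ q :=
  hg.parallel (generator_ne_zero hΦ q) (hΦ.null_generators q _ (generator_mem Φ q)) hn
    (hΦ.null_generators q _ hu)

theorem IsBondiNeighbourhood.zeta_orthogonal (hg : IsLorentzMetric g)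
    (hΦ : IsNonExpandingHorizon g D Φ) (hU : IsBondiNeighbourhood g D Φ U n ζ v r)
    {w : Tan M (Φ q)} (hw : w ∈ horizonTangent Φ q) : g (Φ q) (ζ (Φ q)) w = 0 := by
  obtain ⟨c, hc⟩ := null_tangent_parallel hg hΦ (hU.zeta_tangent q) (hU.zeta_null q)
  rw [hc, map_smul, smul_apply, hΦ.null_generators q w hw, smul_zero]

/-- Both vectors are multiples of the null generator, and ζ(v) = 1 identifies the factor. Applied to
K it produces the coefficient f = dv(K), which is smooth on all of U. -/
theorem IsBondiNeighbourhood.eq_smul_zeta (hg : IsLorentzMetric g)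
    (hΦ : IsNonExpandingHorizon g D Φ) (hU : IsBondiNeighbourhood g D Φ U n ζ v r)
    {u : Tan M (Φ q)} (hu : u ∈ horizonTangent Φ q) (hn : g (Φ q) u u = 0) :
    u = dFun v (Φ q) u • ζ (Φ q) := by
  obtain ⟨c, hc⟩ := null_tangent_parallel hg hΦ (hU.zeta_tangent q) (hU.zeta_null q)
  obtain ⟨d, hd⟩ := null_tangent_parallel hg hΦ hu hn
  have hc0 : c ≠ 0 := by
    rintro rfl
    exact hU.zeta_ne_zero (hU.mem q) (by rw [hc, zero_smul])
  have h1 : u = (d / c) • ζ (Φ q) := by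
    rw [hc, smul_smul, div_mul_cancel₀ d hc0, hd]
  have h2 : dFun v (Φ q) u = d / c := by
    rw [h1, map_smul, hU.zeta_v _ (hU.mem q), smul_eq_mul, mul_one]
  rw [h2]; exact h1

/-- The null direction is its own normal: ζ annihilates the three-dimensional tangent space, and
g(ζ, n) = -1 shows that the annihilating functional is nonzero. -/
theorem IsBondiNeighbourhood.mem_tangent_iff (hg : IsLorentzMetric g)
    (hΦ : IsNonExpandingHorizon g D Φ) (hU : IsBondiNeighbourhood g D Φ U n ζ v r)
    (w : Tan M (Φ q)) : w ∈ horizonTangent Φ q ↔ g (Φ q) (ζ (Φ q)) w = 0 :=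
  mem_horizonTangent_iff hΦ.embedding (g (Φ q) (ζ (Φ q))) (u := n (Φ q))
    (by rw [hg.symm, hU.metric_n_zeta q]; norm_num) (fun _ hw => hU.zeta_orthogonal hg hΦ hw) w

/-- The description by a closed 1-form; it shows at once that tangent fields are closed under the
bracket. -/
theorem IsBondiNeighbourhood.mem_tangent_iff_dr
    (hΦ : IsNonExpandingHorizon g D Φ) (hU : IsBondiNeighbourhood g D Φ U n ζ v r)
    (w : Tan M (Φ q)) : w ∈ horizonTangent Φ q ↔ dFun r (Φ q) w = 0 :=
  mem_horizonTangent_iff hΦ.embedding (dFun r (Φ q)) (u := n (Φ q))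
    (by rw [hU.n_r _ (hU.mem q)]; norm_num)
    (dFun_eq_zero_of_const hΦ.embedding (SmoothFun.mdiffAt hU.smooth_r hU.isOpen (hU.mem q))
      (Filter.Eventually.of_forall hU.r_horizon)) w

/-- Every vector tangent to the horizon extends to a field tangent to the horizon. -/
theorem IsBondiNeighbourhood.exists_tangent_field (hg : IsLorentzMetric g)
    (hΦ : IsNonExpandingHorizon g D Φ) (hU : IsBondiNeighbourhood g D Φ U n ζ v r)
    {w : Tan M (Φ q)} (hw : w ∈ horizonTangent Φ q) :
    ∃ X : VField M, SmoothOn X U ∧ (∀ q', X (Φ q') ∈ horizonTangent Φ q') ∧ X (Φ q) = w := by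
  obtain ⟨Z, hZ, rfl⟩ := exists_smooth_extension w
  replace hZ := hZ.mono (Set.subset_univ U)
  -- Projection along n: since g(ζ, n) = -1, the correction makes the field orthogonal to ζ on the
  -- horizon, and it vanishes at the given point.
  refine ⟨Z + (fun y => g y (ζ y) (Z y)) • n,
    hZ.add (SmoothOn.smul (hg.smoothFun hU.smooth_zeta hZ) hU.smooth_n), fun q' => ?_, ?_⟩
  · rw [hU.mem_tangent_iff hg hΦ]
    simp only [Pi.add_apply, Pi.smul_apply', map_add, map_smul, smul_eq_mul]
    rw [hg.symm _ (ζ (Φ q')) (n (Φ q')), hU.metric_n_zeta q']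
    ring
  · simp [hU.zeta_orthogonal hg hΦ hw]

theorem IsHorizonField.of_smoothOn (hU : IsBondiNeighbourhood g D Φ U n ζ v r)
    (hX : SmoothOn X U) (hXt : ∀ q, X (Φ q) ∈ horizonTangent Φ q) : IsHorizonField Φ X :=
  ⟨⟨U, hU.isOpen, hU.contains, hX⟩, hXt⟩

/-- The transversal n and the tangent space of the horizon together span the tangent space of the
spacetime. -/
theorem IsBondiNeighbourhood.eq_zero_of_orthogonal (hg : IsLorentzMetric g)
    (hΦ : IsNonExpandingHorizon g D Φ) (hU : IsBondiNeighbourhood g D Φ U n ζ v r)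
    {u : Tan M (Φ q)} (hn : g (Φ q) u (n (Φ q)) = 0)
    (ht : ∀ w ∈ horizonTangent Φ q, g (Φ q) u w = 0) : u = 0 := by
  refine hg.eq_zero fun w => ?_
  have h1 : w + g (Φ q) (ζ (Φ q)) w • n (Φ q) ∈ horizonTangent Φ q := by
    rw [hU.mem_tangent_iff hg hΦ]
    simp only [map_add, map_smul, smul_eq_mul]
    rw [hg.symm _ (ζ (Φ q)) (n (Φ q)), hU.metric_n_zeta q]
    ring
  have h2 := ht _ h1
  simpa [hn] using h2

/-- An orthonormal pair which together with `ζ` spans the tangent space of the horizon. -/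
theorem IsBondiNeighbourhood.exists_orthonormal (hg : IsLorentzMetric g)
    (hΦ : IsNonExpandingHorizon g D Φ) (hU : IsBondiNeighbourhood g D Φ U n ζ v r) (q : B × ℝ) :
    ∃ u₁ ∈ horizonTangent Φ q, ∃ u₂ ∈ horizonTangent Φ q,
      g (Φ q) u₁ u₁ = 1 ∧ g (Φ q) u₂ u₂ = 1 ∧ g (Φ q) u₁ u₂ = 0 ∧
      ∀ w ∈ horizonTangent Φ q, ∃ a b c : ℝ, w = a • u₁ + b • u₂ + c • ζ (Φ q) := by
  have hζ0 := hU.zeta_ne_zero (hU.mem q)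
  have hnζ := hU.metric_n_zeta q
  have hnn := hU.n_null _ (hU.mem q)
  have hζζ := hU.zeta_null q
  -- Three linear conditions in dimension four have a nonzero solution u. Orthogonality to ζ gives
  -- g(u,u) ≥ 0, and equality would make u a multiple of ζ, excluded by g(n, u) = 0. Hence u can be
  -- normalised. The choice s = 0 gives the first vector, s = u₁ the second.
  have key : ∀ s : Tan M (Φ q), ∃ u : Tan M (Φ q), g (Φ q) (ζ (Φ q)) u = 0 ∧
      g (Φ q) (n (Φ q)) u = 0 ∧ g (Φ q) s u = 0 ∧ g (Φ q) u u = 1 := by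
    intro s
    have hfd : FiniteDimensional ℝ (Tan M (Φ q)) := inferInstanceAs (FiniteDimensional ℝ R4)
    let L : Tan M (Φ q) →ₗ[ℝ] (Fin 3 → ℝ) := LinearMap.pi
      ![(g (Φ q) (ζ (Φ q))).toLinearMap, (g (Φ q) (n (Φ q))).toLinearMap, (g (Φ q) s).toLinearMap]
    have hker : LinearMap.ker L ≠ ⊥ :=
      LinearMap.ker_ne_bot_of_finrank_lt (by rw [finrank_tan]; simp)
    obtain ⟨u, hu, hu0⟩ := (Submodule.ne_bot_iff _).1 hker
    have hL : ∀ i, L u i = 0 := fun i => congrFun (LinearMap.mem_ker.1 hu) i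
    have h0 : g (Φ q) (ζ (Φ q)) u = 0 := hL 0
    have h1 : g (Φ q) (n (Φ q)) u = 0 := hL 1
    have h2 : g (Φ q) s u = 0 := hL 2
    have hnn' := hg.nonneg_of_orthogonal hζ0 hζζ h0
    have hpos : 0 < g (Φ q) u u := by
      refine lt_of_le_of_ne hnn' fun h => hu0 ?_
      obtain ⟨c, rfl⟩ := hg.parallel hζ0 hζζ h.symm h0
      rw [map_smul, hnζ, smul_eq_mul] at h1
      have : c = 0 := by linarith
      rw [this, zero_smul]
    have hsq : Real.sqrt (g (Φ q) u u) * Real.sqrt (g (Φ q) u u) = g (Φ q) u u :=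
      Real.mul_self_sqrt hnn'
    have hs0 : Real.sqrt (g (Φ q) u u) ≠ 0 := (Real.sqrt_pos.2 hpos).ne'
    refine ⟨(Real.sqrt (g (Φ q) u u))⁻¹ • u, by simp [h0], by simp [h1], by simp [h2], ?_⟩
    simp only [map_smul, smul_apply, smul_eq_mul]
    rw [← mul_assoc, ← mul_inv, hsq, inv_mul_cancel₀ hpos.ne']
  obtain ⟨u₁, hζ1, hn1, -, h11⟩ := key 0
  obtain ⟨u₂, hζ2, hn2, h12, h22⟩ := key u₁
  refine ⟨u₁, (hU.mem_tangent_iff hg hΦ _).2 hζ1, u₂, (hU.mem_tangent_iff hg hΦ _).2 hζ2,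
    h11, h22, h12, fun w hw => ?_⟩
  have hw' := hU.zeta_orthogonal hg hΦ hw
  refine ⟨g (Φ q) w u₁, g (Φ q) w u₂, - g (Φ q) w (n (Φ q)), ?_⟩
  let b : Fin 4 → Tan M (Φ q) := ![u₁, u₂, n (Φ q), ζ (Φ q)]
  have hgram : gram g (Φ q) b = !![1, 0, 0, 0; 0, 1, 0, 0; 0, 0, 0, -1; 0, 0, -1, 0] := by
    ext i j
    fin_cases i <;> fin_cases j <;>
      simp [gram, b, h11, h12, h22, hζ1, hζ2, hn1, hn2, hnζ, hnn, hζζ, hg.symm _ u₂ u₁,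
        hg.symm _ u₁ (n (Φ q)), hg.symm _ u₂ (n (Φ q)), hg.symm _ u₁ (ζ (Φ q)),
        hg.symm _ u₂ (ζ (Φ q)), hg.symm _ (ζ (Φ q)) (n (Φ q))]
  have hdet : (gram g (Φ q) b).det ≠ 0 := by
    rw [hgram]
    simp [Matrix.det_succ_row_zero, Fin.sum_univ_succ]
  have hinv : (gram g (Φ q) b)⁻¹ = !![1, 0, 0, 0; 0, 1, 0, 0; 0, 0, 0, -1; 0, 0, -1, 0] := by
    refine Matrix.inv_eq_left_inv ?_
    rw [hgram]
    ext i j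
    fin_cases i <;> fin_cases j <;> simp [Matrix.mul_apply, Fin.sum_univ_four]
  have hexp := hg.expand hdet w
  rw [hinv] at hexp
  simp [Fin.sum_univ_four, b] at hexp
  rw [hg.symm _ w (ζ (Φ q)), hw'] at hexp
  simpa using hexp

/-- Tangential covariant derivatives of a field that vanishes on the horizon are zero. -/
theorem cov_eq_zero_of_vanishing (hg : IsLorentzMetric g) (hD : IsLeviCivita g D)
    (hΦ : IsNonExpandingHorizon g D Φ) (hV : IsOpen V) (hY : SmoothOn Y V) (hq : Φ q ∈ V)
    (h0 : ∀ᶠ q' in 𝓝 q, Y (Φ q') = 0) {w : Tan M (Φ q)} (hw : w ∈ horizonTangent Φ q) :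
    D Y (Φ q) w = 0 := by
  refine hg.eq_zero fun z => ?_
  obtain ⟨Z, hZ, rfl⟩ := exists_smooth_extension z
  replace hZ := hZ.mono (Set.subset_univ V)
  have h1 := hD.metric Y Z (Φ q) (hY.diffAt hV hq) (hZ.diffAt hV hq) w
  rw [dFun_eq_zero_of_const (c := 0) hΦ.embedding ((hg.smoothFun hY hZ).mdiffAt hV hq)
    (h0.mono fun q' h => by simp [h]) w hw, h0.self_of_nhds] at h1
  simpa using h1.symm

/-- A field tangent to the horizon commutes there with any field that vanishes on the horizon. -/
theorem bracket_eq_zero_of_vanishing (hg : IsLorentzMetric g) (hD : IsLeviCivita g D)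
    (hΦ : IsNonExpandingHorizon g D Φ) (hV : IsOpen V) (hX : SmoothOn X V) (hY : SmoothOn Y V)
    (hq : Φ q ∈ V) (h0 : ∀ᶠ q' in 𝓝 q, Y (Φ q') = 0) (hw : X (Φ q) ∈ horizonTangent Φ q) :
    bracket X Y (Φ q) = 0 := by
  rw [hD.bracket_eq (hX.diffAt hV hq) (hY.diffAt hV hq),
    cov_eq_zero_of_vanishing hg hD hΦ hV hY hq h0 hw, h0.self_of_nhds]
  simp

theorem IsBondiNeighbourhood.bracket_tangent (hΦ : IsNonExpandingHorizon g D Φ)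
    (hU : IsBondiNeighbourhood g D Φ U n ζ v r)
    (hX : SmoothOn X U) (hY : SmoothOn Y U) (hXt : ∀ q, X (Φ q) ∈ horizonTangent Φ q)
    (hYt : ∀ q, Y (Φ q) ∈ horizonTangent Φ q) (q : B × ℝ) :
    bracket X Y (Φ q) ∈ horizonTangent Φ q := by
  have hr : SmoothFun r U := hU.smooth_r
  have tan : ∀ {Z : VField M}, SmoothOn Z U → (∀ q, Z (Φ q) ∈ horizonTangent Φ q) →
      ∀ w ∈ horizonTangent Φ q, dFun (fun y => dFun r y (Z y)) (Φ q) w = 0 := fun hZ hZt =>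
    dFun_eq_zero_of_const (c := 0) hΦ.embedding
      ((hr.dFun_apply hZ hU.isOpen).mdiffAt hU.isOpen (hU.mem q))
      (Filter.Eventually.of_forall fun q' => (hU.mem_tangent_iff_dr hΦ _).1 (hZt q'))
  rw [hU.mem_tangent_iff_dr hΦ, dFun_bracket hU.isOpen hr hX hY (hU.mem q),
    tan hY hYt _ (hXt q), tan hX hXt _ (hYt q), sub_zero]

/-- A Killing field that is a constant multiple of `ζ` on the horizon is this multiple of `ζ`. -/
theorem IsBondiNeighbourhood.eq_smul_zeta_of_horizon (hg : IsLorentzMetric g)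
    (hD : IsLeviCivita g D) (hΦ : IsNonExpandingHorizon g D Φ)
    (hU : IsBondiNeighbourhood g D Φ U n ζ v r) (hK : IsKillingOn g D K U) (a : ℝ)
    (h : ∀ q, K (Φ q) = a • ζ (Φ q)) : ∀ p ∈ U, K p = a • ζ p := by
  have oU := hU.isOpen
  have sn := hU.smooth_n
  have sZ := hK.smooth.bracket sn oU
  have hKt : ∀ q, K (Φ q) ∈ horizonTangent Φ q := fun q => by
    rw [h q]; exact Submodule.smul_mem _ _ (hU.zeta_tangent q)
  have hv : SmoothFun v U := hU.smooth_v
  -- Products with n vanish because n is null. For tangent X, invariance of g and g(n, ·) = -dv on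
  -- tangent vectors give g([K, n], X) = -K(X v) + [K, X] v = -X(K v), and K v = a is constant on
  -- the horizon.
  have hZ0 : ∀ q, bracket K n (Φ q) = 0 := by
    intro q
    have hq := hU.mem q
    refine hU.eq_zero_of_orthogonal hg hΦ ?_ fun w hw => ?_
    · have h1 := hK.dFun_metric hD oU sn sn hq
      rw [dFun_congr (h := fun _ => 0) (Filter.eventually_of_mem (oU.mem_nhds hq) hU.n_null),
        dFun_const, hg.symm _ (n (Φ q))] at h1
      simp only [zero_apply] at h1
      linarith
    · obtain ⟨X, hX, hXt, rfl⟩ := hU.exists_tangent_field hg hΦ hw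
      have h1 := hK.dFun_metric hD oU sn hX hq
      have h2 : dFun (fun y => g y (n y) (X y) + dFun v y (X y)) (Φ q) (K (Φ q)) = 0 :=
        dFun_eq_zero_of_const (c := 0) hΦ.embedding
          (((hg.smoothFun sn hX).mdiffAt oU hq).add ((hv.dFun_apply hX oU).mdiffAt oU hq))
          (Filter.Eventually.of_forall fun q' => by
            change g (Φ q') (n (Φ q')) (X (Φ q')) + dFun v (Φ q') (X (Φ q')) = 0
            rw [hU.n_horizon q' _ (hXt q')]; ring) _ (hKt q)
      rw [dFun_add ((hg.smoothFun sn hX).mdiffAt oU hq)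
        ((hv.dFun_apply hX oU).mdiffAt oU hq), add_apply] at h2
      have h3 := hU.n_horizon q _ (hU.bracket_tangent hΦ hK.smooth hX hKt hXt q)
      have h4 := dFun_bracket oU hv hK.smooth hX hq
      have h5 : dFun (fun y => dFun v y (K y)) (Φ q) (X (Φ q)) = 0 :=
        dFun_eq_zero_of_const (c := a) hΦ.embedding ((hv.dFun_apply hK.smooth oU).mdiffAt oU hq)
          (Filter.Eventually.of_forall fun q' => by
            rw [h q', map_smul, hU.zeta_v _ (hU.mem q'), smul_eq_mul, mul_one]) _ hw
      rw [h3] at h1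
      linarith
  have hZ : ∀ p ∈ U, bracket K n p = 0 := by
    intro p hp
    obtain ⟨γ, s, ⟨q, hq⟩, rfl, hγ, hγU⟩ := hU.swept p hp
    -- Lie differentiating ∇_n n = 0 along K gives ∇_n Z = -∇_Z n for Z = [K, n].
    refine (transport_eq_zero_iff hg hD oU sn sZ (-1) ?_ hγ hγU).1 (by rw [← hq]; exact hZ0 q)
    intro p hp
    have h1 := hK.bracket_cov hg hD oU sn sn hp
    rw [bracket_congr (X' := K) (Y' := 0) (Filter.Eventually.of_forall fun _ => rfl)
      (Filter.eventually_of_mem (oU.mem_nhds hp) hU.n_geodesic)] at h1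
    rw [bracket, VectorField.mlieBracket_zero_right] at h1
    rw [neg_one_smul, eq_neg_iff_add_eq_zero, add_comm]
    exact h1.symm
  have sY : SmoothOn (K - a • ζ) U := hK.smooth.sub (hU.smooth_zeta.const_smul a)
  intro p hp
  obtain ⟨γ, s, ⟨q, hq⟩, rfl, hγ, hγU⟩ := hU.swept p hp
  -- The field Y = K - aζ commutes with n, so absence of torsion gives ∇_n Y = ∇_Y n.
  refine sub_eq_zero.1 ((transport_eq_zero_iff hg hD oU sn sY 1 ?_ hγ hγU).1
    (by rw [← hq]; simp [h q]))
  intro p hp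
  have h1 : bracket n (K + (-a) • ζ) p = 0 := by
    rw [bracket_add_right (hK.smooth.diffAt oU hp) ((hU.smooth_zeta.const_smul _).diffAt oU hp),
      bracket_const_smul_right _ (hU.smooth_zeta.diffAt oU hp), hU.bracket_n_zeta p hp,
      bracket_swap, hZ p hp]
    simp
  have h2 : K + (-a) • ζ = K - a • ζ := by rw [neg_smul, sub_eq_add_neg]
  rw [h2, hD.bracket_eq (sn.diffAt oU hp) (sY.diffAt oU hp), sub_eq_zero] at h1
  rw [one_smul]
  exact h1

end BondiHorizon

/-! ### Algebra of the commutator of Lie and covariant derivatives. -/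

section LieConn

variable {M : Type*} [TopologicalSpace M] [T2Space M] [ChartedSpace R4 M]
  [IsManifold 𝓘(ℝ, R4) ∞ M]
variable {g : BField M} {D : Conn M} {V : Set M} {K L X Y Z : VField M} {x : M}

theorem cov_sub (D : Conn M) (hV : IsOpen V) (hX : SmoothOn X V) (hY : SmoothOn Y V)
    (hx : x ∈ V) : D (X - Y) x = D X x - D Y x := by
  rw [eq_sub_iff_add_eq, ← cov_add D ((hX.sub hY).diffAt hV hx) (hY.diffAt hV hx),
    sub_add_cancel]

theorem lieConn_add_left (hV : IsOpen V) (hK : SmoothOn K V) (hL : SmoothOn L V) (hY : SmoothOn Y V) (hx : x ∈ V) :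
    lieConn D (K + L) X Y x = lieConn D K X Y x + lieConn D L X Y x := by
  have e : D (bracket (K + L) Y) x = D (bracket K Y + bracket L Y) x :=
    cov_congr D (((hK.add hL).bracket hY hV).diffAt hV hx)
      (((hK.bracket hY hV).add (hL.bracket hY hV)).diffAt hV hx)
      (Filter.eventually_of_mem (hV.mem_nhds hx) fun y hy =>
        bracket_add_left (hK.diffAt hV hy) (hL.diffAt hV hy))
  simp only [lieConn]
  rw [e, cov_add D ((hK.bracket hY hV).diffAt hV hx) ((hL.bracket hY hV).diffAt hV hx),
    bracket_add_left (hK.diffAt hV hx) (hL.diffAt hV hx),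
    bracket_add_left (hK.diffAt hV hx) (hL.diffAt hV hx), map_add, add_apply]
  abel

theorem lieConn_add_middle (hD : IsLeviCivita g D) (hV : IsOpen V) (hX : SmoothOn X V) (hY : SmoothOn Y V) (hZ : SmoothOn Z V) (hx : x ∈ V) :
    lieConn D K (X + Y) Z x = lieConn D K X Z x + lieConn D K Y Z x := by
  have e : (fun y => D Z y ((X + Y) y)) = (fun y => D Z y (X y)) + fun y => D Z y (Y y) := by
    ext1 y; simp
  simp only [lieConn]
  rw [e, bracket_add_right ((hX.cov hD.smooth hZ hV).diffAt hV hx)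
    ((hY.cov hD.smooth hZ hV).diffAt hV hx), bracket_add_right (hX.diffAt hV hx)
    (hY.diffAt hV hx), Pi.add_apply, map_add, map_add]
  abel

theorem lieConn_add_self (hD : IsLeviCivita g D) (hV : IsOpen V) (hK : SmoothOn K V)
    (hX : SmoothOn X V) (hY : SmoothOn Y V) (hx : x ∈ V) :
    lieConn D K (X + Y) (X + Y) x
      = lieConn D K X X x + (2 : ℝ) • lieConn D K X Y x + lieConn D K Y Y x := by
  rw [lieConn_add_middle hD hV hX hY (hX.add hY) hx,
    lieConn_symm hD hV hK hX (hX.add hY) hx, lieConn_symm hD hV hK hY (hX.add hY) hx,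
    lieConn_add_middle hD hV hX hY hX hx, lieConn_add_middle hD hV hX hY hY hx,
    lieConn_symm hD hV hK hY hX hx]
  module

theorem IsKillingOn.const_smul (hV : IsOpen V) (hK : IsKillingOn g D K V) (c : ℝ) :
    IsKillingOn g D (c • K) V := by
  refine ⟨hK.smooth.const_smul c, fun x hx u w => ?_⟩
  rw [cov_const_smul D c (hK.smooth.diffAt hV hx)]
  have := hK.killing x hx u w
  simp only [map_smul, smul_apply, smul_eq_mul]
  rw [← mul_add, this, mul_zero]

end LieConn

/-! ### Rigidity: a null Killing field is a multiple of the invariant field. -/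

section NaturalFields

variable {M : Type*} [TopologicalSpace M] [T2Space M] [ChartedSpace R4 M]
  [IsManifold 𝓘(ℝ, R4) ∞ M]
variable {B : Type*} [TopologicalSpace B] [ChartedSpace R2 B] [IsManifold 𝓘(ℝ, R2) ∞ B]
variable {g : BField M} {D : Conn M} {Φ : B × ℝ → M} {U V : Set M} {n ζ : VField M} {v r : M → ℝ}
variable {X Y K : VField M} {q : B × ℝ} {f : M → ℝ}

/-- The trace condition on a natural field controls the components of `[𝓛_ζ, D]` along `ζ`. -/
theorem IsNaturalField.lieConn_zeta (hg : IsLorentzMetric g) (hD : IsLeviCivita g D)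
    (hΦ : IsNonExpandingHorizon g D Φ) (hU : IsBondiNeighbourhood g D Φ U n ζ v r)
    (hζ : IsNaturalField g D Φ ζ) (hX : SmoothOn X U) (hY : SmoothOn Y U)
    (hXt : ∀ q, X (Φ q) ∈ horizonTangent Φ q) (hYt : ∀ q, Y (Φ q) ∈ horizonTangent Φ q)
    (hXX : g (Φ q) (X (Φ q)) (X (Φ q)) = 1) (hYY : g (Φ q) (Y (Φ q)) (Y (Φ q)) = 1)
    (hXY : g (Φ q) (X (Φ q)) (Y (Φ q)) = 0) :
    lieConn D ζ X ζ (Φ q) = 0 ∧ lieConn D ζ ζ ζ (Φ q) = 0 := by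
  have oU := hU.isOpen
  have sζ := hU.smooth_zeta
  have hq := hU.mem q
  have step : ∀ {Z : VField M}, SmoothOn Z U → (∀ q, Z (Φ q) ∈ horizonTangent Φ q) →
      g (Φ q) (Z (Φ q)) (Z (Φ q)) = 1 → g (Φ q) (Z (Φ q)) (Y (Φ q)) = 0 →
      (∀ q, (Z + ζ) (Φ q) ∈ horizonTangent Φ q) ∧
      g (Φ q) ((Z + ζ) (Φ q)) ((Z + ζ) (Φ q)) = 1 ∧ g (Φ q) ((Z + ζ) (Φ q)) (Y (Φ q)) = 0 := by
    intro Z _ hZt h1 h2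
    refine ⟨fun q => Submodule.add_mem _ (hZt q) (hU.zeta_tangent q), ?_, ?_⟩
    · simp only [Pi.add_apply, map_add, add_apply, h1, hU.zeta_null q,
        hU.zeta_orthogonal hg hΦ (hZt q), hg.symm _ (Z (Φ q)) (ζ (Φ q))]
      ring
    · simp only [Pi.add_apply, map_add, add_apply, h2, hU.zeta_orthogonal hg hΦ (hYt q)]
      ring
  have tr : ∀ {Z : VField M}, SmoothOn Z U → (∀ q, Z (Φ q) ∈ horizonTangent Φ q) →
      g (Φ q) (Z (Φ q)) (Z (Φ q)) = 1 → g (Φ q) (Z (Φ q)) (Y (Φ q)) = 0 →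
      lieConn D ζ Z Z (Φ q) = - lieConn D ζ Y Y (Φ q) := fun hZ hZt h1 h2 =>
    eq_neg_of_add_eq_zero_left (hζ.traceless _ Y (.of_smoothOn hU hZ hZt) (.of_smoothOn hU hY hYt)
      q h1 hYY h2)
  -- Since ζ is null and normal, X, X + ζ and X + 2ζ all form an orthonormal pair with Y. The trace
  -- condition therefore gives the same value of [𝓛_ζ, D] on the diagonal for all three, so 2tA +
  -- t²C = 0 for t = 1, 2, where A and C are its values on (X, ζ) and (ζ, ζ). Hence A = C = 0.
  obtain ⟨t1, a1, b1⟩ := step hX hXt hXX hXY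
  obtain ⟨t2, a2, b2⟩ := step (hX.add sζ) t1 a1 b1
  have e0 := tr hX hXt hXX hXY
  have e1 := tr (hX.add sζ) t1 a1 b1
  have e2 := tr ((hX.add sζ).add sζ) t2 a2 b2
  rw [lieConn_add_self hD oU sζ (hX.add sζ) sζ hq,
    lieConn_add_middle hD oU hX sζ sζ hq, e1] at e2
  rw [lieConn_add_self hD oU sζ hX sζ hq, e0] at e1
  generalize lieConn D ζ X ζ (Φ q) = A at *
  generalize lieConn D ζ ζ ζ (Φ q) = C at *
  generalize lieConn D ζ Y Y (Φ q) = E at *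
  have f1 : (2 : ℝ) • A + C = 0 := by
    calc (2 : ℝ) • A + C = (-E + (2 : ℝ) • A + C) + E := by abel
      _ = 0 := by rw [e1]; abel
  have f2 : (2 : ℝ) • A + (3 : ℝ) • C = 0 := by
    calc (2 : ℝ) • A + (3 : ℝ) • C = (-E + (2 : ℝ) • (A + C) + C) + E := by module
      _ = 0 := by rw [e2]; abel
  have hC : C = 0 := by
    calc C = (1 / 2 : ℝ) • (((2 : ℝ) • A + (3 : ℝ) • C) - ((2 : ℝ) • A + C)) := by module
      _ = 0 := by rw [f1, f2]; simp
  refine ⟨?_, hC⟩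
  rw [hC, add_zero] at f1
  exact (smul_eq_zero.1 f1).resolve_left (by norm_num)

/-- Derivative of a field which is a multiple of `ζ` on the horizon. -/
theorem IsBondiNeighbourhood.cov_of_eq_smul (hg : IsLorentzMetric g) (hD : IsLeviCivita g D)
    (hΦ : IsNonExpandingHorizon g D Φ) (hU : IsBondiNeighbourhood g D Φ U n ζ v r)
    (hK : SmoothOn K U) (hf : SmoothFun f U) (h : ∀ᶠ q' in 𝓝 q, K (Φ q') = f (Φ q') • ζ (Φ q'))
    {w : Tan M (Φ q)} (hw : w ∈ horizonTangent Φ q) :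
    D K (Φ q) w = f (Φ q) • D ζ (Φ q) w + dFun f (Φ q) w • ζ (Φ q) := by
  have oU := hU.isOpen
  have hq := hU.mem q
  have s := hU.smooth_zeta.smul hf
  -- The field K - fζ vanishes along the horizon near the point, so its tangential derivatives are
  -- zero.
  have h1 := cov_eq_zero_of_vanishing hg hD hΦ oU (hK.sub s) hq
    (h.mono fun q' h => by simp [h]) hw
  rw [cov_sub D oU hK s hq, sub_apply, sub_eq_zero,
    cov_smul D (hf.mdiffAt oU hq) (hU.smooth_zeta.diffAt oU hq)] at h1
  exact h1

/-- Bracket of a field which is a multiple of `ζ` on the horizon with a tangent field. -/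
theorem IsBondiNeighbourhood.bracket_of_eq_smul (hg : IsLorentzMetric g) (hD : IsLeviCivita g D)
    (hΦ : IsNonExpandingHorizon g D Φ) (hU : IsBondiNeighbourhood g D Φ U n ζ v r)
    (hK : SmoothOn K U) (hf : SmoothFun f U) (h : ∀ᶠ q' in 𝓝 q, K (Φ q') = f (Φ q') • ζ (Φ q'))
    (hX : SmoothOn X U) (hXt : X (Φ q) ∈ horizonTangent Φ q) :
    bracket K X (Φ q) = f (Φ q) • bracket ζ X (Φ q) - dFun f (Φ q) (X (Φ q)) • ζ (Φ q) := by
  have oU := hU.isOpen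
  have hq := hU.mem q
  rw [hD.bracket_eq (hK.diffAt oU hq) (hX.diffAt oU hq),
    hD.bracket_eq (hU.smooth_zeta.diffAt oU hq) (hX.diffAt oU hq),
    hU.cov_of_eq_smul hg hD hΦ hK hf h hXt, h.self_of_nhds, map_smul]
  module

/-- Where a null Killing field `f ζ` does not vanish, the horizon is non-expanding and shear-free:
tangential derivatives of `ζ` are multiples of `ζ`. -/
theorem IsBondiNeighbourhood.cov_zeta_parallel (hg : IsLorentzMetric g) (hD : IsLeviCivita g D)
    (hΦ : IsNonExpandingHorizon g D Φ) (hU : IsBondiNeighbourhood g D Φ U n ζ v r)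
    (hK : IsKillingOn g D K U) (hf : SmoothFun f U)
    (h : ∀ᶠ q' in 𝓝 q, K (Φ q') = f (Φ q') • ζ (Φ q')) (hf0 : f (Φ q) ≠ 0)
    {u : Tan M (Φ q)} (hu : u ∈ horizonTangent Φ q) :
    ∃ c : ℝ, D ζ (Φ q) u = c • ζ (Φ q) := by
  have oU := hU.isOpen
  have hq := hU.mem q
  have sζ := hU.smooth_zeta
  -- On tangent vectors the form g(∇_u ζ, w) is antisymmetric by the Killing equation divided by f,
  -- and symmetric because ζ is normal to a hypersurface whose tangent fields are closed under the
  -- bracket. So it vanishes.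
  have orth : ∀ w ∈ horizonTangent Φ q, g (Φ q) (D ζ (Φ q) u) w = 0 := by
    intro w hw
    obtain ⟨X, hX, hXt, rfl⟩ := hU.exists_tangent_field hg hΦ hu
    obtain ⟨Y, hY, hYt, rfl⟩ := hU.exists_tangent_field hg hΦ hw
    have h1 := hK.killing (Φ q) hq (X (Φ q)) (Y (Φ q))
    rw [hU.cov_of_eq_smul hg hD hΦ hK.smooth hf h hu,
      hU.cov_of_eq_smul hg hD hΦ hK.smooth hf h hw] at h1
    simp only [map_add, add_apply, map_smul, smul_apply, smul_eq_mul,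
      hU.zeta_orthogonal hg hΦ hw, hg.symm _ (X (Φ q)) (ζ (Φ q)),
      hU.zeta_orthogonal hg hΦ hu] at h1
    have h2 : g (Φ q) (D ζ (Φ q) (X (Φ q))) (Y (Φ q)) + g (Φ q) (X (Φ q)) (D ζ (Φ q) (Y (Φ q)))
        = 0 := by
      have : f (Φ q) * (g (Φ q) (D ζ (Φ q) (X (Φ q))) (Y (Φ q))
          + g (Φ q) (X (Φ q)) (D ζ (Φ q) (Y (Φ q)))) = 0 := by linarith
      exact (mul_eq_zero.1 this).resolve_left hf0
    have met : ∀ {A C : VField M}, SmoothOn A U → SmoothOn C U →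
        (∀ q, A (Φ q) ∈ horizonTangent Φ q) → (∀ q, C (Φ q) ∈ horizonTangent Φ q) →
        g (Φ q) (D ζ (Φ q) (C (Φ q))) (A (Φ q)) + g (Φ q) (ζ (Φ q)) (D A (Φ q) (C (Φ q))) = 0 := by
      intro A C hA hC hAt hCt
      rw [← hD.metric ζ A _ (sζ.diffAt oU hq) (hA.diffAt oU hq)]
      exact dFun_eq_zero_of_const (c := 0) hΦ.embedding ((hg.smoothFun sζ hA).mdiffAt oU hq)
        (Filter.Eventually.of_forall fun q' => hU.zeta_orthogonal hg hΦ (hAt q')) _ (hCt q)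
    have h3 := met hY hX hYt hXt
    have h4 := met hX hY hXt hYt
    have h5 := hU.zeta_orthogonal hg hΦ (hU.bracket_tangent hΦ hX hY hXt hYt q)
    rw [hD.bracket_eq (hX.diffAt oU hq) (hY.diffAt oU hq), map_sub] at h5
    rw [hg.symm _ (X (Φ q)) (D ζ (Φ q) (Y (Φ q)))] at h2
    linarith
  -- A vector orthogonal to the horizon is a multiple of ζ; pairing with n and g(n, ζ) = -1 fix the
  -- factor.
  refine ⟨- g (Φ q) (D ζ (Φ q) u) (n (Φ q)), ?_⟩
  have h0 := hU.eq_zero_of_orthogonal hg hΦ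
    (u := D ζ (Φ q) u + g (Φ q) (D ζ (Φ q) u) (n (Φ q)) • ζ (Φ q)) ?_ ?_
  · rw [neg_smul]; exact eq_neg_of_add_eq_zero_left h0
  · rw [map_add, map_smul, add_apply, smul_apply, smul_eq_mul, hg.symm _ (ζ (Φ q)) (n (Φ q)),
      hU.metric_n_zeta q]
    ring
  · intro w hw
    rw [map_add, map_smul, add_apply, smul_apply, orth w hw, hU.zeta_orthogonal hg hΦ hw]
    simp

/-- The surface gravity of a null Killing field has vanishing derivative where the field does not
vanish. -/
theorem IsNaturalField.dFun_surface_gravity (hg : IsLorentzMetric g) (hD : IsLeviCivita g D)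
    (hΦ : IsNonExpandingHorizon g D Φ) (hU : IsBondiNeighbourhood g D Φ U n ζ v r)
    (hζ : IsNaturalField g D Φ ζ) (hK : IsKillingOn g D K U) (hf : SmoothFun f U)
    (h : ∀ q, K (Φ q) = f (Φ q) • ζ (Φ q)) (hf0 : f (Φ q) ≠ 0) {w : Tan M (Φ q)}
    (hw : w ∈ horizonTangent Φ q) :
    dFun f (Φ q) w + dFun (fun y => dFun f y (ζ y)) (Φ q) w = 0 := by
  have oU := hU.isOpen
  have hq := hU.mem q
  have sζ := hU.smooth_zeta
  have h' : ∀ q, ∀ᶠ q' in 𝓝 q, K (Φ q') = f (Φ q') • ζ (Φ q') :=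
    fun q => Filter.Eventually.of_forall h
  have hdf := hf.dFun_apply sζ oU
  have zz : ∀ x, bracket ζ ζ x = 0 := fun x => by
    rw [bracket, VectorField.mlieBracket_self]; rfl
  have key : ∀ {X : VField M}, SmoothOn X U → (∀ q, X (Φ q) ∈ horizonTangent Φ q) →
      lieConn D ζ X ζ (Φ q) = 0 →
      dFun f (Φ q) (X (Φ q)) + dFun (fun y => dFun f y (ζ y)) (Φ q) (X (Φ q)) = 0 := by
    intro X hX hXt hl
    have sW : SmoothOn (fun y => D ζ y (X y)) U := hX.cov hD.smooth sζ oU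
    obtain ⟨c, hc⟩ := hU.cov_zeta_parallel hg hD hΦ hK hf (h' q) hf0 (hXt q)
    have hWt : D ζ (Φ q) (X (Φ q)) ∈ horizonTangent Φ q := by
      rw [hc]; exact Submodule.smul_mem _ _ (hU.zeta_tangent q)
    have b1 := hU.bracket_of_eq_smul hg hD hΦ hK.smooth hf (h' q) sW hWt
    have b2 := hU.bracket_of_eq_smul hg hD hΦ hK.smooth hf (h' q) hX (hXt q)
    have b3 : ∀ᶠ q' in 𝓝 q,
        bracket K ζ (Φ q') = (fun y => - dFun f y (ζ y)) (Φ q') • ζ (Φ q') :=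
      Filter.Eventually.of_forall fun q' => by
        rw [hU.bracket_of_eq_smul hg hD hΦ hK.smooth hf (h' q') sζ (hU.zeta_tangent q'), zz]
        simp
    have hdf' : SmoothFun (fun y => - dFun f y (ζ y)) U := hdf.neg
    have b4 := hU.cov_of_eq_smul hg hD hΦ (hK.smooth.bracket sζ oU) hdf' b3 (hXt q)
    have hk := hK.lieConn_eq_zero hg hD oU hX sζ hq
    have z0 : D (bracket ζ ζ) (Φ q) = 0 := by
      rw [show bracket ζ ζ = 0 from funext zz, cov_zero]
    rw [lieConn, z0, zero_apply, sub_zero, sub_eq_zero] at hl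
    -- With ∇_X ζ = cζ, the identity [𝓛_K, ∇_X] ζ = 0 is expanded for K = fζ. The f-terms form f
    -- [𝓛_ζ, ∇_X] ζ = 0, the two terms c ζ(f) cancel, and ∇_ζ ζ = ζ leaves (X(f) + X(ζ f)) ζ = 0.
    rw [lieConn, b1, b2, b4, dFun_neg, neg_apply, hl, map_sub, map_smul, map_smul, hζ.surface_gravity q, hc,
      map_smul] at hk
    have h0 : (dFun f (Φ q) (X (Φ q)) + dFun (fun y => dFun f y (ζ y)) (Φ q) (X (Φ q))) • ζ (Φ q)
        = 0 := by
      rw [← hk]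
      simp only [smul_eq_mul]
      module
    exact (smul_eq_zero.1 h0).resolve_right (hU.zeta_ne_zero hq)
  obtain ⟨u₁, h₁, u₂, h₂, h11, h22, h12, hspan⟩ := hU.exists_orthonormal hg hΦ q
  obtain ⟨X, hX, hXt, rfl⟩ := hU.exists_tangent_field hg hΦ h₁
  obtain ⟨Y, hY, hYt, rfl⟩ := hU.exists_tangent_field hg hΦ h₂
  obtain ⟨l1, l0⟩ := hζ.lieConn_zeta hg hD hΦ hU hX hY hXt hYt h11 h22 h12
  obtain ⟨l2, -⟩ := hζ.lieConn_zeta hg hD hΦ hU hY hX hYt hXt h22 h11 (by rw [hg.symm]; exact h12)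
  have k1 := key hX hXt l1
  have k2 := key hY hYt l2
  have k0 := key sζ hU.zeta_tangent l0
  obtain ⟨a, b, c, rfl⟩ := hspan w hw
  simp only [map_add, map_smul, smul_eq_mul]
  linear_combination a * k1 + b * k2 + c * k0

/-- The surface gravity of a null Killing field is constant. -/
theorem IsNaturalField.surface_gravity_const [ConnectedSpace B] (hg : IsLorentzMetric g)
    (hD : IsLeviCivita g D) (hΦ : IsNonExpandingHorizon g D Φ)
    (hU : IsBondiNeighbourhood g D Φ U n ζ v r)
    (hζ : IsNaturalField g D Φ ζ) (hK : IsKillingOn g D K U) (hf : SmoothFun f U)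
    (h : ∀ q, K (Φ q) = f (Φ q) • ζ (Φ q)) :
    ∃ κ : ℝ, ∀ q, f (Φ q) + dFun f (Φ q) (ζ (Φ q)) = κ := by
  have oU := hU.isOpen
  have sζ := hU.smooth_zeta
  have hdf := hf.dFun_apply sζ oU
  have hκ : SmoothFun (fun y => f y + dFun f y (ζ y)) U := ContMDiffOn.add hf hdf
  have hfc : Continuous fun q => f (Φ q) := hf.continuousOn.comp_continuous
    hΦ.embedding.contMDiff.continuous hU.mem
  have ad : ∀ q, dFun (fun y => f y + dFun f y (ζ y)) (Φ q)
      = dFun f (Φ q) + dFun (fun y => dFun f y (ζ y)) (Φ q) := fun q =>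
    dFun_add (hf.mdiffAt oU (hU.mem q)) (hdf.mdiffAt oU (hU.mem q))
  have hz : ∀ q, ∀ w ∈ horizonTangent Φ q, dFun (fun y => f y + dFun f y (ζ y)) (Φ q) w = 0 := by
    intro q w hw
    obtain ⟨X, hX, hXt, rfl⟩ := hU.exists_tangent_field hg hΦ hw
    -- Extending w to a tangent field makes the derivative of κ in question a continuous function on
    -- the horizon, so that its zeros form a closed set.
    let θ : B × ℝ → ℝ := fun q => dFun (fun y => f y + dFun f y (ζ y)) (Φ q) (X (Φ q))
    have hθ : Continuous θ := (hκ.dFun_apply hX oU).continuousOn.comp_continuous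
      hΦ.embedding.contMDiff.continuous hU.mem
    have hS : IsClosed {q | θ q = 0} := isClosed_eq hθ continuous_const
    have h1 : {q | f (Φ q) ≠ 0} ⊆ {q | θ q = 0} := fun q' hq' => by
      have := hζ.dFun_surface_gravity hg hD hΦ hU hK hf h hq' (hXt q')
      simpa only [θ, Set.mem_ofPred_eq, ad, add_apply] using this
    -- Vanishing where f ≠ 0 passes to the closure by continuity. Off the closure f is zero in a
    -- neighbourhood along the horizon, and so is f + ζ(f).
    by_cases hq : q ∈ closure {q | f (Φ q) ≠ 0}
    · exact closure_minimal h1 hS hq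
    · have h2 : ∀ᶠ q' in 𝓝 q, f (Φ q') = 0 := by
        filter_upwards [isClosed_closure.isOpen_compl.mem_nhds hq] with q' hq'
        by_contra h0
        exact hq' (subset_closure h0)
      refine dFun_eq_zero_of_const (c := 0) hΦ.embedding (hκ.mdiffAt oU (hU.mem q)) ?_ _ hw
      filter_upwards [eventually_eventually_nhds.2 h2] with q' hq'
      rw [hq'.self_of_nhds, dFun_eq_zero_of_const hΦ.embedding (hf.mdiffAt oU (hU.mem q')) hq' _
        (hU.zeta_tangent q'), add_zero]
  obtain ⟨b⟩ : Nonempty (B × ℝ) := inferInstance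
  exact ⟨_, fun q => const_of_dFun_eq_zero hΦ.embedding (fun q => hκ.mdiffAt oU (hU.mem q)) hz q b⟩

/-- A null Killing field of a horizon is a constant multiple of the invariant vector field. -/
theorem IsInvariantField.eq_smul_of_killing [ConnectedSpace B] (hg : IsLorentzMetric g)
    (hD : IsLeviCivita g D) (hΦ : IsNonExpandingHorizon g D Φ)
    (hU : IsBondiNeighbourhood g D Φ U n ζ v r)
    (hζ : IsInvariantField g D Φ ζ) (hK : IsKillingOn g D K U)
    (hKt : ∀ q, K (Φ q) ∈ horizonTangent Φ q) (hKn : ∀ q, g (Φ q) (K (Φ q)) (K (Φ q)) = 0) :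
    ∃ a : ℝ, ∀ q, K (Φ q) = a • ζ (Φ q) := by
  have oU := hU.isOpen
  have sζ := hU.smooth_zeta
  have hv : SmoothFun v U := hU.smooth_v
  have hf := hv.dFun_apply hK.smooth oU
  have h : ∀ q, K (Φ q) = (fun y => dFun v y (K y)) (Φ q) • ζ (Φ q) :=
    fun q => hU.eq_smul_zeta hg hΦ (hKt q) (hKn q)
  generalize (fun y => dFun v y (K y)) = f at hf h
  obtain ⟨κ, hκ⟩ := hζ.natural.surface_gravity_const hg hD hΦ hU hK hf h
  -- Where f is locally constant, ζ(f) = 0 and therefore f = κ. This supplies the density required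
  -- of a natural field: f cannot equal a constant other than κ on an open set.
  have zf : ∀ {c : ℝ} {q}, (∀ᶠ q' in 𝓝 q, f (Φ q') = c) → c = κ := fun {c q} h0 => by
    rw [← hκ q, h0.self_of_nhds, dFun_eq_zero_of_const hΦ.embedding
      (hf.mdiffAt oU (hU.mem q)) h0 _ (hU.zeta_tangent q), add_zero]
  have dK : ∀ q, D K (Φ q) (ζ (Φ q)) = κ • ζ (Φ q) := fun q => by
    rw [hU.cov_of_eq_smul hg hD hΦ hK.smooth hf (Filter.Eventually.of_forall h)
      (hU.zeta_tangent q), hζ.natural.surface_gravity q, ← add_smul, hκ]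
  have gen : ∀ {L : VField M} (c : ℝ), c ≠ κ → (∀ q, L (Φ q) = 0 → f (Φ q) = c) →
      Dense {q | L (Φ q) ≠ 0} := by
    intro L c hc hL q
    by_contra hq
    refine hc (zf (q := q) ?_)
    filter_upwards [isClosed_closure.isOpen_compl.mem_nhds hq] with q' hq'
    by_contra h0
    exact hq' (subset_closure fun h1 => h0 (hL q' h1))
  have kill : ∀ {L X Y : VField M}, IsKillingOn g D L U → IsHorizonField Φ X →
      IsHorizonField Φ Y → ∀ q, lieConn D L X Y (Φ q) = 0 := by
    rintro L X Y hL ⟨⟨U₁, o₁, c₁, h₁⟩, -⟩ ⟨⟨U₂, o₂, c₂, h₂⟩, -⟩ q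
    have s1 : U ∩ (U₁ ∩ U₂) ⊆ U := Set.inter_subset_left
    exact (hL.mono s1).lieConn_eq_zero hg hD (oU.inter (o₁.inter o₂))
      (h₁.mono fun _ h => h.2.1) (h₂.mono fun _ h => h.2.2) ⟨hU.mem q, c₁ ⟨q, rfl⟩, c₂ ⟨q, rfl⟩⟩
  -- For κ = 0 the field ζ + K = (1 + f)ζ is natural: adding K changes neither the surface gravity
  -- nor [𝓛_ζ, D], and zeros occur only where f = -1 ≠ κ. Uniqueness then gives K = 0 on the
  -- horizon.
  by_cases hκ0 : κ = 0
  · refine ⟨0, fun q => ?_⟩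
    have nat : IsNaturalField g D Φ (ζ + K) := by
      refine { smooth := ⟨U, oU, hU.contains, sζ.add hK.smooth⟩, tangent := fun q => ?_,
               null := fun q => ?_, generic := ?_, surface_gravity := fun q => ?_,
               traceless := fun X Y hX hY q h1 h2 h3 => ?_ }
      · exact Submodule.add_mem _ (hU.zeta_tangent q) (hKt q)
      · simp only [Pi.add_apply, h q, map_add, add_apply, map_smul, smul_apply, hU.zeta_null q]
        simp
      · refine gen (-1) (by rw [hκ0]; norm_num) fun q h0 => ?_
        simp only [Pi.add_apply, h q] at h0
        have h1 : (1 + f (Φ q)) • ζ (Φ q) = 0 := by rw [← h0]; module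
        have := (smul_eq_zero.1 h1).resolve_right (hU.zeta_ne_zero (hU.mem q))
        linarith
      · have hq := hU.mem q
        rw [cov_add D (sζ.diffAt oU hq) (hK.smooth.diffAt oU hq), Pi.add_apply, h q, add_apply,
          map_add, map_add, map_smul, map_smul, dK q, hκ0, hζ.natural.surface_gravity q]
        simp
      · have : ∀ {X : VField M}, IsHorizonField Φ X →
            lieConn D (ζ + K) X X (Φ q) = lieConn D ζ X X (Φ q) := by
          intro X hX
          obtain ⟨U₁, o₁, c₁, h₁⟩ := hX.smooth
          have s1 : U ∩ U₁ ⊆ U := Set.inter_subset_left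
          have s2 : U ∩ U₁ ⊆ U₁ := Set.inter_subset_right
          rw [lieConn_add_left (oU.inter o₁) (sζ.mono s1) (hK.smooth.mono s1)
            (h₁.mono s2) ⟨hU.mem q, c₁ ⟨q, rfl⟩⟩, kill hK hX hX, add_zero]
        rw [this hX, this hY]
        exact hζ.natural.traceless X Y hX hY q h1 h2 h3
    have h1 := hζ.unique _ nat q
    rw [Pi.add_apply] at h1
    rw [zero_smul]
    exact add_eq_left.1 h1
  -- For κ ≠ 0 the field K/κ has surface gravity 1, and its trace condition holds because [𝓛_K, ∇] =
  -- 0. Uniqueness gives K = κζ.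
  · refine ⟨κ, fun q => ?_⟩
    have hL := hK.const_smul oU κ⁻¹
    have nat : IsNaturalField g D Φ (κ⁻¹ • K) := by
      refine { smooth := ⟨U, oU, hU.contains, hL.smooth⟩, tangent := fun q => ?_,
               null := fun q => ?_, generic := ?_, surface_gravity := fun q => ?_,
               traceless := fun X Y hX hY q _ _ _ => ?_ }
      · exact Submodule.smul_mem _ _ (hKt q)
      · simp [hKn q]
      · refine gen 0 (Ne.symm hκ0) fun q h0 => ?_
        simp only [Pi.smul_apply, h q, smul_smul] at h0
        have := (smul_eq_zero.1 h0).resolve_right (hU.zeta_ne_zero (hU.mem q))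
        exact (mul_eq_zero.1 this).resolve_left (inv_ne_zero hκ0)
      · rw [cov_const_smul D _ (hK.smooth.diffAt oU (hU.mem q)), Pi.smul_apply, h q, smul_apply,
          map_smul, map_smul, dK q]
        simp only [smul_smul]
        congr 1
        field_simp
      · rw [kill hL hX hX, kill hL hY hY, add_zero]
    have h1 := hζ.unique _ nat q
    rw [← h1, Pi.smul_apply, smul_smul, mul_inv_cancel₀ hκ0, one_smul]

end NaturalFields

/-! ### Bondi-like charts: ζ is the coordinate field ∂_v. -/

section BondiChart

variable {M : Type*} [TopologicalSpace M] [T2Space M] [ChartedSpace R4 M]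
  [IsManifold 𝓘(ℝ, R4) ∞ M]
variable {B : Type*} [TopologicalSpace B] [ChartedSpace R2 B] [IsManifold 𝓘(ℝ, R2) ∞ B]
variable {g : BField M} {D : Conn M} {Φ : B × ℝ → M} {U V : Set M} {n ζ : VField M} {v r : M → ℝ}
variable {f : M → ℝ} {e : OpenPartialHomeomorph M R4}

theorem eq_along_integralCurve (hV : IsOpen V) (hf : SmoothFun f V)
    (h : ∀ p ∈ V, dFun f p (n p) = 0) {γ : ℝ → M} {s : ℝ}
    (hγ : IsMIntegralCurveOn (I := 𝓘(ℝ, R4)) γ n (Set.uIcc 0 s))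
    (hγV : ∀ t ∈ Set.uIcc 0 s, γ t ∈ V) : f (γ s) = f (γ 0) := by
  have hd : ∀ t ∈ Set.uIcc 0 s, HasDerivWithinAt (fun τ => f (γ τ)) 0 (Set.uIcc 0 s) t :=
    fun t ht => by
      have := hasDerivWithinAt_comp_integralCurve (hf.mdiffAt hV (hγV t ht)) hγ ht
      rwa [h _ (hγV t ht)] at this
  have := (convex_uIcc (0 : ℝ) s).norm_image_sub_le_of_norm_hasDerivWithin_le hd (C := 0)
    (by simp) Set.left_mem_uIcc Set.right_mem_uIcc
  simpa [sub_eq_zero] using this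

/-- Since [n, ζ] = 0 and n(r) = -1 is constant, n(ζ(r)) = 0; and ζ(r) = 0 on the horizon, to which ζ
is tangent. -/
theorem IsBondiNeighbourhood.zeta_r (hΦ : IsNonExpandingHorizon g D Φ)
    (hU : IsBondiNeighbourhood g D Φ U n ζ v r) {p : M} (hp : p ∈ U) : dFun r p (ζ p) = 0 := by
  have oU := hU.isOpen
  have hr : SmoothFun r U := hU.smooth_r
  have h : ∀ p ∈ U, dFun (fun y => dFun r y (ζ y)) p (n p) = 0 := by
    intro p hp
    have h1 := dFun_bracket oU hr hU.smooth_n hU.smooth_zeta hp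
    rw [hU.bracket_n_zeta p hp, map_zero, dFun_congr (f := fun y => dFun r y (n y))
      (h := fun _ => -1) (Filter.eventually_of_mem (oU.mem_nhds hp) hU.n_r), dFun_const] at h1
    simpa using h1.symm
  obtain ⟨γ, s, ⟨q, hq⟩, rfl, hγ, hγU⟩ := hU.swept p hp
  rw [eq_along_integralCurve oU (hr.dFun_apply hU.smooth_zeta oU) h hγ hγU, ← hq]
  exact (hU.mem_tangent_iff_dr hΦ _).1 (hU.zeta_tangent q)

theorem mdifferentiable_of_mem (he : e ∈ IsManifold.maximalAtlas 𝓘(ℝ, R4) ∞ M) :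
    e.MDifferentiable 𝓘(ℝ, R4) 𝓘(ℝ, R4) :=
  ⟨(contMDiffOn_of_mem_maximalAtlas he).mdifferentiableOn (by simp),
    (contMDiffOn_symm_of_mem_maximalAtlas he).mdifferentiableOn (by simp)⟩

theorem smoothFun_coord (he : e ∈ IsManifold.maximalAtlas 𝓘(ℝ, R4) ∞ M) (i : Fin 4) :
    SmoothFun (fun y => e y i) e.source :=
  (EuclideanSpace.proj (𝕜 := ℝ) i).contDiff.contMDiff.comp_contMDiffOn
    (contMDiffOn_of_mem_maximalAtlas he)

theorem chartComp_eq (he : e ∈ IsManifold.maximalAtlas 𝓘(ℝ, R4) ∞ M) {p : M}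
    (hp : p ∈ e.source) (u : Tan M p) (i : Fin 4) :
    chartComp e p u i = dFun (fun y => e y i) p u := by
  have h1 : MDifferentiableAt 𝓘(ℝ, R4) 𝓘(ℝ, R4) e p := (mdifferentiable_of_mem he).mdifferentiableAt hp
  have h2 : HasMFDerivAt 𝓘(ℝ, R4) 𝓘(ℝ, ℝ) (EuclideanSpace.proj (𝕜 := ℝ) i : R4 →L[ℝ] ℝ) (e p)
      (EuclideanSpace.proj (𝕜 := ℝ) i : R4 →L[ℝ] ℝ) :=
    (EuclideanSpace.proj (𝕜 := ℝ) i : R4 →L[ℝ] ℝ).hasMFDerivAt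
  have h3 := (h2.comp p h1.hasMFDerivAt).mfderiv
  have h4 := congrArg (fun A : R4 →L[ℝ] ℝ => A u) h3
  exact h4.symm

theorem IsBondiChart.chartComp_zeta (hΦ : IsNonExpandingHorizon g D Φ)
    (hU : IsBondiNeighbourhood g D Φ U n ζ v r) (he : IsBondiChart U n ζ v r e) {p : M}
    (hp : p ∈ e.source) (i : Fin 4) : chartComp e p (ζ p) i = if i = 2 then 1 else 0 := by
  have hpU := he.source_subset hp
  fin_cases i
  · exact (he.zeta_x p hp).1
  · exact (he.zeta_x p hp).2
  · refine (chartComp_eq he.smooth hp _ _).trans ?_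
    change dFun (fun y => e y 2) p (ζ p) = _
    rw [dFun_congr (h := v) (Filter.eventually_of_mem (e.open_source.mem_nhds hp) he.coord_v),
      hU.zeta_v p hpU]
    simp
  · refine (chartComp_eq he.smooth hp _ _).trans ?_
    change dFun (fun y => e y 3) p (ζ p) = _
    rw [dFun_congr (h := r) (Filter.eventually_of_mem (e.open_source.mem_nhds hp) he.coord_r),
      hU.zeta_r hΦ hpU]
    simp

theorem IsBondiChart.coordVec_eq (hΦ : IsNonExpandingHorizon g D Φ)
    (hU : IsBondiNeighbourhood g D Φ U n ζ v r) (he : IsBondiChart U n ζ v r e) {p : M}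
    (hp : p ∈ e.source) : coordVec e 2 p = ζ p := by
  have h1 : (show R4 from mfderiv 𝓘(ℝ, R4) 𝓘(ℝ, R4) e p (ζ p))
      = (EuclideanSpace.single 2 (1 : ℝ) : R4) := by
    ext i
    refine (he.chartComp_zeta hΦ hU hp i).trans ?_
    simp
  have h2 := (mdifferentiable_of_mem he.smooth).symm_comp_deriv hp
  have h3 := congrArg (fun A : Tan M p →L[ℝ] Tan M p => A (ζ p)) h2
  rw [coordVec, ← h1]
  exact h3

/-- Real functions that are constant along `∂_v` do not depend on `v`. -/
theorem independentOfV_of_dFun (he : e ∈ IsManifold.maximalAtlas 𝓘(ℝ, R4) ∞ M)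
    (hf : SmoothFun f e.source) (h : ∀ p ∈ e.source, dFun f p (coordVec e 2 p) = 0) :
    IndependentOfV e f := by
  intro y _ t hseg
  set w : R4 := EuclideanSpace.single 2 (1 : ℝ) with hw
  have hd : ∀ τ ∈ Set.Icc (0 : ℝ) 1,
      HasDerivWithinAt (fun τ => f (e.symm (y + τ • t • w))) 0 (Set.Icc 0 1) τ := by
    intro τ hτ
    have hz : y + τ • t • w ∈ e.target := hseg (by
      rw [segment_eq_image']
      exact ⟨τ, hτ, by simp⟩)
    set z := y + τ • t • w with hzdef
    have hp := e.map_target hz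
    have h1 : MDifferentiableAt 𝓘(ℝ, R4) 𝓘(ℝ, R4) e.symm z :=
      (mdifferentiable_of_mem he).mdifferentiableAt_symm hz
    have h2 := ((hf.mdiffAt e.open_source hp).hasMFDerivAt.comp z h1.hasMFDerivAt).hasFDerivAt
    have h3 : HasDerivAt (fun τ : ℝ => y + τ • t • w) (t • w) τ := by
      simpa using ((hasDerivAt_id τ).smul_const (t • w)).const_add y
    have h4 := h2.comp_hasDerivAt τ h3
    refine (h4.hasDerivWithinAt).congr_deriv ?_
    have h5 := h _ hp
    rw [coordVec, e.right_inv hz] at h5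
    have h6 : ∀ A : R4 →L[ℝ] ℝ, A w = 0 → A (t • w) = 0 := fun A hA => by
      rw [map_smul, hA, smul_zero]
    exact h6 _ h5
  have := (convex_Icc (0 : ℝ) 1).norm_image_sub_le_of_norm_hasDerivWithin_le hd (C := 0)
    (by simp) (Set.left_mem_Icc.2 zero_le_one) (Set.right_mem_Icc.2 zero_le_one)
  simpa [sub_eq_zero] using this

end BondiChart

/-! ### Fields commuting with the Killing field ζ. -/

section Dragged

variable {M : Type*} [TopologicalSpace M] [T2Space M] [ChartedSpace R4 M]
  [IsManifold 𝓘(ℝ, R4) ∞ M]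
variable {g : BField M} {D : Conn M} {W : Set M} {ζ X Y Z : VField M}

/-- Smooth fields on `W` that commute with `ζ`. -/
structure IsDragged (ζ X : VField M) (W : Set M) : Prop where
  smooth : SmoothOn X W
  bracket_eq : ∀ p ∈ W, bracket ζ X p = 0

theorem IsDragged.zero : IsDragged ζ 0 W :=
  ⟨smoothOn_zero, fun p _ => by rw [bracket, VectorField.mlieBracket_zero_right]; rfl⟩

theorem IsDragged.neg (hW : IsOpen W) (hX : IsDragged ζ X W) : IsDragged ζ (-X) W := by
  rw [← neg_one_smul ℝ X]
  exact ⟨hX.smooth.const_smul _, fun p hp => by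
    rw [bracket_const_smul_right _ (hX.smooth.diffAt hW hp), hX.bracket_eq p hp, smul_zero]⟩

theorem IsDragged.sub (hW : IsOpen W) (hX : IsDragged ζ X W) (hY : IsDragged ζ Y W) :
    IsDragged ζ (X - Y) W := by
  refine ⟨hX.smooth.sub hY.smooth, fun p hp => ?_⟩
  rw [sub_eq_add_neg, bracket_add_right (hX.smooth.diffAt hW hp)
    ((hY.neg hW).smooth.diffAt hW hp), hX.bracket_eq p hp, (hY.neg hW).bracket_eq p hp, add_zero]

theorem bracket_eq_zero_right (hW : IsOpen W) (hY : ∀ p ∈ W, Y p = 0) {p : M} (hp : p ∈ W) :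
    bracket X Y p = 0 := by
  rw [bracket_congr (X' := X) (Y' := 0) (Filter.Eventually.of_forall fun _ => rfl)
    (Filter.eventually_of_mem (hW.mem_nhds hp) hY), bracket, VectorField.mlieBracket_zero_right]
  rfl

theorem cov_eq_zero_of_eq_zero (hW : IsOpen W) (hX : SmoothOn X W) (h : ∀ p ∈ W, X p = 0) {p : M}
    (hp : p ∈ W) : D X p = 0 := by
  rw [cov_congr D (Y := 0) (hX.diffAt hW hp) (smoothOn_zero.diffAt hW hp)
    (Filter.eventually_of_mem (hW.mem_nhds hp) h), cov_zero]

/-- Invariance of the connection under ζ. Together with closure under brackets and differences it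
makes curvatures of dragged fields dragged. -/
theorem IsDragged.cov (hg : IsLorentzMetric g) (hD : IsLeviCivita g D) (hW : IsOpen W)
    (hζ : IsKillingOn g D ζ W) (hX : IsDragged ζ X W) (hY : IsDragged ζ Y W) :
    IsDragged ζ (fun y => D Y y (X y)) W := by
  refine ⟨hX.smooth.cov hD.smooth hY.smooth hW, fun p hp => ?_⟩
  rw [hζ.bracket_cov hg hD hW hX.smooth hY.smooth hp, hX.bracket_eq p hp,
    cov_eq_zero_of_eq_zero hW (hζ.smooth.bracket hY.smooth hW) hY.bracket_eq hp]
  simp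

theorem IsDragged.bracket (hW : IsOpen W) (hζ : SmoothOn ζ W) (hX : IsDragged ζ X W)
    (hY : IsDragged ζ Y W) : IsDragged ζ (bracket X Y) W := by
  refine ⟨hX.smooth.bracket hY.smooth hW, fun p hp => ?_⟩
  rw [jacobi hW hζ hX.smooth hY.smooth hp, bracket_eq_zero_right hW hY.bracket_eq hp,
    bracket_swap, bracket_eq_zero_right hW hX.bracket_eq hp]
  simp

theorem IsDragged.curvature (hg : IsLorentzMetric g) (hD : IsLeviCivita g D) (hW : IsOpen W)
    (hζ : IsKillingOn g D ζ W) (hX : IsDragged ζ X W) (hY : IsDragged ζ Y W)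
    (hZ : IsDragged ζ Z W) : IsDragged ζ (curvature D X Y Z) W :=
  ((hX.cov hg hD hW hζ (hY.cov hg hD hW hζ hZ)).sub hW
    (hY.cov hg hD hW hζ (hX.cov hg hD hW hζ hZ))).sub hW
    ((hX.bracket hW hζ.smooth hY).cov hg hD hW hζ hZ)

theorem IsDragged.dFun_metric (hD : IsLeviCivita g D) (hW : IsOpen W)
    (hζ : IsKillingOn g D ζ W) (hX : IsDragged ζ X W) (hY : IsDragged ζ Y W) {p : M} (hp : p ∈ W) :
    dFun (fun y => g y (X y) (Y y)) p (ζ p) = 0 := by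
  rw [hζ.dFun_metric hD hW hX.smooth hY.smooth hp, hX.bracket_eq p hp, hY.bracket_eq p hp]
  simp

variable {B : Type*} [TopologicalSpace B] [ChartedSpace R2 B] [IsManifold 𝓘(ℝ, R2) ∞ B]
variable {Φ : B × ℝ → M} {U : Set M} {n : VField M} {v r : M → ℝ} {m : CField M} {l : VField M}

theorem IsBondiNeighbourhood.isDragged_n (hU : IsBondiNeighbourhood g D Φ U n ζ v r)
    (hWU : W ⊆ U) : IsDragged ζ n W :=
  ⟨hU.smooth_n.mono hWU, fun p hp => by rw [bracket_swap, hU.bracket_n_zeta p (hWU hp), neg_zero]⟩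

/-- A field that is parallel along `n` and dragged by a Killing field `ζ` at the horizon is dragged
everywhere. -/
theorem IsDragged.of_horizon (hg : IsLorentzMetric g) (hD : IsLeviCivita g D) (hW : IsOpen W)
    (hζ : IsKillingOn g D ζ W) (hn : IsDragged ζ n W) (hs : SweptOut Φ n W) (hX : SmoothOn X W)
    (hXn : ∀ p ∈ W, D X p (n p) = 0) (h : ∀ q, Φ q ∈ W → KillingHorizon.bracket ζ X (Φ q) = 0) :
    IsDragged ζ X W := by
  refine ⟨hX, fun p hp => ?_⟩
  obtain ⟨γ, s, ⟨q, hq⟩, rfl, hγ, hγW⟩ := hs p hp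
  -- Lie differentiating ∇_n X = 0 along ζ, with [ζ, n] = 0, gives ∇_n [ζ, X] = 0: the transport
  -- equation with c = 0.
  refine (transport_eq_zero_iff hg hD hW hn.smooth (hζ.smooth.bracket hX hW) 0 ?_ hγ hγW).1 ?_
  · intro p hp
    have h1 := hζ.bracket_cov hg hD hW hn.smooth hX hp
    rw [bracket_eq_zero_right hW hXn hp, hn.bracket_eq p hp, map_zero, zero_add] at h1
    rw [zero_smul, ← h1]
  · rw [← hq]
    exact h q (by rw [hq]; exact hγW 0 Set.left_mem_uIcc)

theorem IsAdaptedFrame.isDragged_m (hg : IsLorentzMetric g) (hD : IsLeviCivita g D)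
    (hU : IsBondiNeighbourhood g D Φ U n ζ v r) (hζ : IsKillingOn g D ζ U)
    (hW : IsAdaptedFrame g D Φ U n ζ v W m l) (i : Fin 2) : IsDragged ζ (m i) W :=
  .of_horizon hg hD hW.isOpen (hζ.mono hW.subset) (hU.isDragged_n hW.subset) hW.swept
    (hW.smooth_m i) (fun p hp => hW.m_parallel p hp i) fun q hq => hW.m_dragged q hq i

theorem IsAdaptedFrame.isDragged_l (hg : IsLorentzMetric g) (hD : IsLeviCivita g D)
    (hΦ : IsNonExpandingHorizon g D Φ)
    (hU : IsBondiNeighbourhood g D Φ U n ζ v r) (hζ : IsKillingOn g D ζ U)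
    (hW : IsAdaptedFrame g D Φ U n ζ v W m l) : IsDragged ζ l W := by
  have oW := hW.isOpen
  have sζ := hζ.smooth.mono hW.subset
  refine .of_horizon hg hD oW (hζ.mono hW.subset) (hU.isDragged_n hW.subset) hW.swept
    hW.smooth_l hW.l_parallel fun q hq => ?_
  -- The fields l and ζ agree only along the horizon. This is enough for [ζ, l] = [ζ, l - ζ] to
  -- vanish there, since ζ is tangent to the horizon.
  have h0 : ∀ᶠ q' in 𝓝 q, (l - ζ) (Φ q') = 0 := by
    filter_upwards [hΦ.embedding.contMDiff.continuous.continuousAt.preimage_mem_nhds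
      (oW.mem_nhds hq)] with q' hq'
    rw [Pi.sub_apply, hW.l_horizon q' hq', sub_self]
  have h1 := bracket_eq_zero_of_vanishing hg hD hΦ oW sζ (hW.smooth_l.sub sζ) hq h0
    (hU.zeta_tangent q)
  have h2 : KillingHorizon.bracket ζ ζ (Φ q) = 0 := by
    rw [KillingHorizon.bracket, VectorField.mlieBracket_self]; rfl
  rw [← sub_add_cancel l ζ, bracket_add_right ((hW.smooth_l.sub sζ).diffAt oW hq)
    (sζ.diffAt oW hq), h1, h2, add_zero]

end Dragged

/-! ### Ricci and scalar curvature as traces in an arbitrary basis. -/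

section Ricci

variable {M : Type*} [TopologicalSpace M] [T2Space M] [ChartedSpace R4 M]
  [IsManifold 𝓘(ℝ, R4) ∞ M]
variable {g : BField M} {D : Conn M} {x : M} {b : Fin 4 → Tan M x}

theorem riemann_swap (u w z : Tan M x) : riemann D x u w z = - riemann D x w u z :=
  curvature_swap _ _ _ _

theorem metric_riemann_pair (hg : IsLorentzMetric g) (hD : IsLeviCivita g D) (u w z t : Tan M x) :
    g x (riemann D x u w z) t = g x (riemann D x z t u) w := by
  obtain ⟨X, hX, rfl⟩ := exists_smooth_extension u
  obtain ⟨Y, hY, rfl⟩ := exists_smooth_extension w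
  obtain ⟨Z, hZ, rfl⟩ := exists_smooth_extension z
  obtain ⟨T, hT, rfl⟩ := exists_smooth_extension t
  have hx := Set.mem_univ x
  rw [riemann_eq_curvature hg hD isOpen_univ hX hY hZ hx,
    riemann_eq_curvature hg hD isOpen_univ hZ hT hX hx]
  exact curvature_pair_symm hg hD isOpen_univ hX hY hZ hT hx

/-- Linearity of `riemann` in its vector arguments is not visible from the definition by extensions.
Moving an argument into a slot of g makes it evident; `metric_riemann_pair` and
`metric_riemann_third` serve the same purpose for the other arguments. -/
theorem metric_riemann_first (hg : IsLorentzMetric g) (hD : IsLeviCivita g D)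
    (u w z t : Tan M x) : g x (riemann D x u w z) t = - g x (riemann D x z t w) u := by
  rw [riemann_swap, map_neg, neg_apply, metric_riemann_pair hg hD]

theorem metric_riemann_third (hg : IsLorentzMetric g) (hD : IsLeviCivita g D)
    (u w z t : Tan M x) : g x (riemann D x u w z) t = - g x (riemann D x u w t) z := by
  rw [metric_riemann_pair hg hD, metric_riemann_first hg hD, metric_riemann_pair hg hD,
    metric_riemann_pair hg hD]

theorem ricci_eq_std (hg : IsLorentzMetric g) (u w : Tan M x) : ricci D x u w
    = ∑ i, ∑ j, invMetric g x i j * g x (riemann D x (stdVec x i) w u) (stdVec x j) :=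
  Finset.sum_congr rfl fun i _ => stdCoord_eq hg _ i

/-- The Ricci tensor as a trace in any basis. -/
theorem ricci_eq (hg : IsLorentzMetric g) (hD : IsLeviCivita g D) (hb : (gram g x b).det ≠ 0)
    (u w : Tan M x) :
    ricci D x u w = ∑ i, ∑ j, (gram g x b)⁻¹ i j * g x (riemann D x (b i) w u) (b j) := by
  rw [ricci_eq_std hg, invMetric_eq]
  refine trace_eq hg (LinearMap.mk₂ ℝ (fun a c => g x (riemann D x a w u) c) ?_ ?_ ?_ ?_)
    (hg.gram_det_ne_zero (linearIndependent_stdVec x)) hb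
  · intro a a' c
    simp only [fun a => metric_riemann_first hg hD a w u c, map_add]
    ring
  · intro k a c
    simp only [fun a => metric_riemann_first hg hD a w u c, map_smul, smul_eq_mul]
    ring
  · intro a c c'
    rw [map_add]
  · intro k a c
    rw [map_smul]

/-- The scalar curvature as a trace in any basis. -/
theorem scalarCurv_eq (hg : IsLorentzMetric g) (hD : IsLeviCivita g D)
    (hb : (gram g x b).det ≠ 0) :
    scalarCurv g D x = ∑ i, ∑ j, (gram g x b)⁻¹ i j * ricci D x (b i) (b j) := by
  rw [scalarCurv, invMetric_eq]
  -- Two rewritings of the trace, with w and then u in a slot of g, which show that the Ricci tensor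
  -- is bilinear.
  have e₂ : ∀ u w : Tan M x, ricci D x u w
      = ∑ i, ∑ j, invMetric g x i j * g x (riemann D x u (stdVec x j) (stdVec x i)) w :=
    fun u w => (ricci_eq_std hg u w).trans <| Finset.sum_congr rfl fun i _ =>
      Finset.sum_congr rfl fun j _ => by rw [metric_riemann_pair hg hD]
  have e₁ : ∀ u w : Tan M x, ricci D x u w
      = ∑ i, ∑ j, invMetric g x i j * - g x (riemann D x (stdVec x i) w (stdVec x j)) u :=
    fun u w => (ricci_eq_std hg u w).trans <| Finset.sum_congr rfl fun i _ =>
      Finset.sum_congr rfl fun j _ => by rw [metric_riemann_third hg hD]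
  refine trace_eq hg (LinearMap.mk₂ ℝ (ricci D x) ?_ ?_ ?_ ?_)
    (hg.gram_det_ne_zero (linearIndependent_stdVec x)) hb
  · intro u u' w
    simp only [e₁ _ w, map_add, neg_add, mul_add, Finset.sum_add_distrib]
  · intro k u w
    simp only [e₁ _ w, map_smul, smul_eq_mul, Finset.mul_sum]
    exact Finset.sum_congr rfl fun i _ => Finset.sum_congr rfl fun j _ => by ring
  · intro u w w'
    simp only [e₂ u, map_add, mul_add, Finset.sum_add_distrib]
  · intro k u w
    simp only [e₂ u, map_smul, smul_eq_mul, Finset.mul_sum]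
    exact Finset.sum_congr rfl fun i _ => Finset.sum_congr rfl fun j _ => by ring

end Ricci

/-! ### Equality of frame scalars at two points. -/

section Invariance

variable {M : Type*} [TopologicalSpace M] [T2Space M] [ChartedSpace R4 M]
  [IsManifold 𝓘(ℝ, R4) ∞ M]
variable {g F : BField M} {D : Conn M} {W : Set M} {ζ X Y Z T n l : VField M} {p p' : M}
variable {m : CField M} {E : Fin 4 → VField M}

/-- The definition of `ricci` uses the basis `stdVec`, which is not dragged by ζ. Traced in the
dragged basis E instead, the Ricci tensor involves only products of dragged fields and their
curvatures, which are dragged as well, so `h` applies to every ingredient. -/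
theorem ricci_eq_of_dragged (hg : IsLorentzMetric g) (hD : IsLeviCivita g D) (hW : IsOpen W)
    (hζ : IsKillingOn g D ζ W) (hp : p ∈ W) (hp' : p' ∈ W)
    (h : ∀ X Y : VField M, IsDragged ζ X W → IsDragged ζ Y W →
      g p' (X p') (Y p') = g p (X p) (Y p))
    (hE : ∀ i, IsDragged ζ (E i) W) (hEp : (gram g p fun i => E i p).det ≠ 0)
    (hX : IsDragged ζ X W) (hY : IsDragged ζ Y W) :
    ricci D p' (X p') (Y p') = ricci D p (X p) (Y p) := by
  have hG : (gram g p' fun i => E i p') = gram g p fun i => E i p := by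
    ext i j; exact h _ _ (hE i) (hE j)
  rw [ricci_eq hg hD hEp, ricci_eq hg hD (b := fun i => E i p') (by rw [hG]; exact hEp), hG]
  refine Finset.sum_congr rfl fun i _ => Finset.sum_congr rfl fun j _ => ?_
  rw [riemann_eq_curvature hg hD hW (hE i).smooth hY.smooth hX.smooth hp,
    riemann_eq_curvature hg hD hW (hE i).smooth hY.smooth hX.smooth hp',
    h _ _ ((hE i).curvature hg hD hW hζ hY hX) (hE j)]

theorem weyl_eq_of_dragged (hg : IsLorentzMetric g) (hD : IsLeviCivita g D) (hW : IsOpen W)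
    (hζ : IsKillingOn g D ζ W) (hp : p ∈ W) (hp' : p' ∈ W)
    (h : ∀ X Y : VField M, IsDragged ζ X W → IsDragged ζ Y W →
      g p' (X p') (Y p') = g p (X p) (Y p))
    (hE : ∀ i, IsDragged ζ (E i) W) (hEp : (gram g p fun i => E i p).det ≠ 0)
    (hX : IsDragged ζ X W) (hY : IsDragged ζ Y W) (hZ : IsDragged ζ Z W) (hT : IsDragged ζ T W) :
    weyl g D p' (X p') (Y p') (Z p') (T p') = weyl g D p (X p) (Y p) (Z p) (T p) := by
  have hR : ∀ {X Y : VField M}, IsDragged ζ X W → IsDragged ζ Y W →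
      ricci D p' (X p') (Y p') = ricci D p (X p) (Y p) := fun hX hY =>
    ricci_eq_of_dragged hg hD hW hζ hp hp' h hE hEp hX hY
  have hG : (gram g p' fun i => E i p') = gram g p fun i => E i p := by
    ext i j; exact h _ _ (hE i) (hE j)
  have hS : scalarCurv g D p' = scalarCurv g D p := by
    rw [scalarCurv_eq hg hD hEp, scalarCurv_eq hg hD (b := fun i => E i p')
      (by rw [hG]; exact hEp), hG]
    exact Finset.sum_congr rfl fun i _ => Finset.sum_congr rfl fun j _ => by rw [hR (hE i) (hE j)]
  simp only [weyl]
  rw [riemann_eq_curvature hg hD hW hZ.smooth hT.smooth hY.smooth hp,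
    riemann_eq_curvature hg hD hW hZ.smooth hT.smooth hY.smooth hp',
    h _ _ hX (hZ.curvature hg hD hW hζ hT hY), hS, hR hY hT, hR hY hZ, hR hX hT, hR hX hZ,
    h _ _ hX hZ, h _ _ hX hT, h _ _ hY hZ, h _ _ hY hT]

/-- The Newman-Penrose scalars of a frame agree at two points if the multilinear expressions they are
made of do. -/
theorem spinCoefficients_congr (S : Set (CField M))
    (h : ∀ X Y Z, X ∈ S → Y ∈ S → Z ∈ S → cConn g D X Y Z p' = cConn g D X Y Z p)
    (hm : m ∈ S) (hm' : cConj m ∈ S) (hn : cReal n ∈ S) (hl : cReal l ∈ S) :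
    spinCoefficients g D m n l p' = spinCoefficients g D m n l p := by
  simp only [spinCoefficients, h, hm, hm', hn, hl]

theorem maxwellScalars_congr (S : Set (CField M))
    (h : ∀ X Y, X ∈ S → Y ∈ S → cBilin F X Y p' = cBilin F X Y p)
    (hm : m ∈ S) (hm' : cConj m ∈ S) (hn : cReal n ∈ S) (hl : cReal l ∈ S) :
    maxwellScalars F m n l p' = maxwellScalars F m n l p := by
  simp only [maxwellScalars, h, hm, hm', hn, hl]

theorem weylScalars_congr (S : Set (CField M))
    (h : ∀ X Y Z T, X ∈ S → Y ∈ S → Z ∈ S → T ∈ S → cWeyl g D X Y Z T p' = cWeyl g D X Y Z T p)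
    (hm : m ∈ S) (hm' : cConj m ∈ S) (hn : cReal n ∈ S) (hl : cReal l ∈ S) :
    weylScalars g D m n l p' = weylScalars g D m n l p := by
  simp only [weylScalars, h, hm, hm', hn, hl]

variable {B : Type*} [TopologicalSpace B] [ChartedSpace R2 B] [IsManifold 𝓘(ℝ, R2) ∞ B]
variable {Φ : B × ℝ → M} {U : Set M} {v r : M → ℝ} {e : OpenPartialHomeomorph M R4}

theorem cBilin_re (T : BField M) (X Y : CField M) (x : M) :
    (cBilin T X Y x).re = T x (X 0 x) (Y 0 x) - T x (X 1 x) (Y 1 x) := by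
  simp [cBilin, Fin.sum_univ_two, sub_eq_add_neg]

theorem cBilin_im (T : BField M) (X Y : CField M) (x : M) :
    (cBilin T X Y x).im = T x (X 0 x) (Y 1 x) + T x (X 1 x) (Y 0 x) := by
  simp [cBilin, Fin.sum_univ_two]

/-- The real and imaginary parts of an adapted frame form a basis. -/
theorem IsAdaptedFrame.gram_det_ne_zero (hg : IsLorentzMetric g)
    (hW : IsAdaptedFrame g D Φ U n ζ v W m l) (hp : p ∈ W) :
    (gram g p fun i => (![m 0, m 1, n, l] : Fin 4 → VField M) i p).det ≠ 0 := by
  have hre := fun i j => (cBilin_re g _ _ p).symm.trans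
    (congrArg Complex.re (hW.null_frame p hp i j))
  have him := fun i j => (cBilin_im g _ _ p).symm.trans
    (congrArg Complex.im (hW.null_frame p hp i j))
  have s := hg.symm p
  have h1 : g p (m 0 p) (m 0 p) - g p (m 1 p) (m 1 p) = 0 := hre 0 0
  have h2 : g p (m 0 p) (m 1 p) + g p (m 1 p) (m 0 p) = 0 := him 0 0
  have h3 : g p (m 0 p) (m 0 p) - g p (m 1 p) (-m 1 p) = 1 := hre 0 1
  have h4 : g p (m 0 p) (n p) - g p (m 1 p) 0 = 0 := hre 0 2
  have h5 : g p (m 0 p) 0 + g p (m 1 p) (n p) = 0 := him 0 2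
  have h6 : g p (m 0 p) (l p) - g p (m 1 p) 0 = 0 := hre 0 3
  have h7 : g p (m 0 p) 0 + g p (m 1 p) (l p) = 0 := him 0 3
  have h8 : g p (n p) (n p) - g p 0 0 = 0 := hre 2 2
  have h9 : g p (n p) (l p) - g p 0 0 = -1 := hre 2 3
  have h10 : g p (l p) (l p) - g p 0 0 = 0 := hre 3 3
  rw [map_neg, sub_neg_eq_add] at h3
  rw [s (m 1 p) (m 0 p)] at h2
  simp only [map_zero, sub_zero, zero_add] at h4 h5 h6 h7 h8 h9 h10
  have a : g p (m 0 p) (m 0 p) = 1 / 2 := by linarith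
  have b : g p (m 1 p) (m 1 p) = 1 / 2 := by linarith
  have c : g p (m 0 p) (m 1 p) = 0 := by linarith
  have hG : (gram g p fun i => (![m 0, m 1, n, l] : Fin 4 → VField M) i p)
      = !![1 / 2, 0, 0, 0; 0, 1 / 2, 0, 0; 0, 0, 0, -1; 0, 0, -1, 0] := by
    ext i j
    fin_cases i <;> fin_cases j
    exacts [a, c, h4, h6, (s _ _).trans c, b, h5, h7, (s _ _).trans h4, (s _ _).trans h5, h8, h9,
      (s _ _).trans h6, (s _ _).trans h7, (s _ _).trans h9, h10]
  rw [hG]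
  simp [Matrix.det_succ_row_zero, Fin.sum_univ_succ]

end Invariance

/-! ### Independence of v, and the theorem. -/

section Main

variable {M : Type*} [TopologicalSpace M] [T2Space M] [ChartedSpace R4 M]
  [IsManifold 𝓘(ℝ, R4) ∞ M]
variable {g F : BField M} {D : Conn M} {W : Set M} {ζ K X Y n l : VField M}
variable {m : CField M}
variable {B : Type*} [TopologicalSpace B] [ChartedSpace R2 B] [IsManifold 𝓘(ℝ, R2) ∞ B]
variable {Φ : B × ℝ → M} {U : Set M} {v r : M → ℝ} {e : OpenPartialHomeomorph M R4}

theorem IsBondiChart.independentOfV (hΦ : IsNonExpandingHorizon g D Φ)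
    (hU : IsBondiNeighbourhood g D Φ U n ζ v r) (he : IsBondiChart U n ζ v r e) {f : M → ℝ}
    (hf : SmoothFun f e.source) (h : ∀ p ∈ e.source, dFun f p (ζ p) = 0) : IndependentOfV e f :=
  independentOfV_of_dFun he.smooth hf fun p hp => by rw [he.coordVec_eq hΦ hU hp, h p hp]

/-- The components are X(xⁱ), and ζ(X(xⁱ)) = X(ζ(xⁱ)) + [ζ, X](xⁱ) = 0 because ζ(xⁱ) is constant,
being 1 for the coordinate v and 0 for the others. -/
theorem IsBondiChart.independentOfV_chartComp (hΦ : IsNonExpandingHorizon g D Φ)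
    (hU : IsBondiNeighbourhood g D Φ U n ζ v r) (he : IsBondiChart U n ζ v r e)
    (heW : e.source ⊆ W) (hX : IsDragged ζ X W) (i : Fin 4) :
    IndependentOfV e fun p => chartComp e p (X p) i := by
  have sX := hX.smooth.mono heW
  have sζ := hU.smooth_zeta.mono he.source_subset
  have sf := smoothFun_coord he.smooth i
  have e1 : ∀ p ∈ e.source, chartComp e p (X p) i = dFun (fun y => e y i) p (X p) :=
    fun p hp => chartComp_eq he.smooth hp _ i
  refine he.independentOfV hΦ hU ((sf.dFun_apply sX e.open_source).congr e1) fun p hp => ?_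
  rw [dFun_congr (Filter.eventually_of_mem (e.open_source.mem_nhds hp) e1)]
  have h1 := dFun_bracket e.open_source sf sζ sX hp
  rw [hX.bracket_eq p (heW hp), map_zero, dFun_congr (f := fun y => dFun (fun y => e y i) y (ζ y))
    (h := fun _ => if i = 2 then 1 else 0) (Filter.eventually_of_mem (e.open_source.mem_nhds hp)
      fun y hy => by rw [← chartComp_eq he.smooth hy, he.chartComp_zeta hΦ hU hy]), dFun_const] at h1
  simpa using h1.symm

/-- Fields dragged by ζ are also dragged by K = aζ, as a is constant; then a ≠ 0 allows the
invariance of F along K to be divided by a. -/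
theorem LieInvariantOn.dFun_eq_zero (hK : LieInvariantOn K F U)
    (oU : IsOpen U) (hζ : SmoothOn ζ U) {a : ℝ} (ha : a ≠ 0) (hKζ : ∀ p ∈ U, K p = a • ζ p)
    (oW : IsOpen W) (hWU : W ⊆ U) (hX : IsDragged ζ X W) (hY : IsDragged ζ Y W) {p : M}
    (hp : p ∈ W) : dFun (fun y => F y (X y) (Y y)) p (ζ p) = 0 := by
  have hpU := hWU hp
  have h0 : ∀ {Z : VField M}, IsDragged ζ Z W → bracket K Z p = 0 := fun {Z} hZ => by
    rw [bracket_congr (X' := a • ζ) (Y' := Z) (Filter.eventually_of_mem (oU.mem_nhds hpU) hKζ)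
      (Filter.Eventually.of_forall fun _ => rfl), bracket_const_smul_left _ (hζ.diffAt oU hpU),
      hZ.bracket_eq p hp, smul_zero]
  have h1 := hK p hpU X Y (hX.smooth.smoothAt oW hp) (hY.smooth.smoothAt oW hp)
  rw [h0 hX, h0 hY, hKζ p hpU] at h1
  simpa [ha] using h1

/-- Independence of `v` of all the quantities associated with an adapted frame. -/
theorem IsBondiChart.independentOfV_frame (hg : IsLorentzMetric g) (hD : IsLeviCivita g D)
    (hΦ : IsNonExpandingHorizon g D Φ) (hU : IsBondiNeighbourhood g D Φ U n ζ v r)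
    (he : IsBondiChart U n ζ v r e) (hF : SmoothTensorOn F U) (hK : LieInvariantOn K F U)
    (hζ : IsKillingOn g D ζ U) {a : ℝ} (ha : a ≠ 0) (hKζ : ∀ p ∈ U, K p = a • ζ p)
    (hW : IsAdaptedFrame g D Φ U n ζ v W m l) (heW : e.source ⊆ W) :
    IndependentOfV e (frameComponents e m n l) ∧
    IndependentOfV e (spinCoefficients g D m n l) ∧
    IndependentOfV e (maxwellScalars F m n l) ∧
    IndependentOfV e (weylScalars g D m n l) := by
  have oW := hW.isOpen
  have hζW := hζ.mono hW.subset
  have dm := hW.isDragged_m hg hD hU hζ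
  have dl := hW.isDragged_l hg hD hΦ hU hζ
  have dn : IsDragged ζ n W := hU.isDragged_n hW.subset
  have hE : ∀ i, IsDragged ζ ((![m 0, m 1, n, l] : Fin 4 → VField M) i) W := by
    intro i
    fin_cases i
    exacts [dm 0, dm 1, dn, dl]
  -- Complex fields with dragged real and imaginary parts. The scalars are complex multilinear
  -- expressions in members of S, so their invariance follows term by term from the real case.
  let S : Set (CField M) := {X | ∀ i, IsDragged ζ (X i) W}
  have hm : m ∈ S := dm
  have hm' : cConj m ∈ S := by
    intro i
    fin_cases i
    exacts [dm 0, (dm 1).neg oW]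
  have hr : ∀ {X : VField M}, IsDragged ζ X W → cReal X ∈ S := by
    intro X hX i
    fin_cases i
    exacts [hX, .zero]
  have key : ∀ y ∈ e.target, ∀ t : ℝ,
      segment ℝ y (y + t • EuclideanSpace.single 2 (1 : ℝ)) ⊆ e.target →
      frameComponents e m n l (e.symm (y + t • EuclideanSpace.single 2 (1 : ℝ)))
        = frameComponents e m n l (e.symm y) ∧
      spinCoefficients g D m n l (e.symm (y + t • EuclideanSpace.single 2 (1 : ℝ)))
        = spinCoefficients g D m n l (e.symm y) ∧
      maxwellScalars F m n l (e.symm (y + t • EuclideanSpace.single 2 (1 : ℝ)))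
        = maxwellScalars F m n l (e.symm y) ∧
      weylScalars g D m n l (e.symm (y + t • EuclideanSpace.single 2 (1 : ℝ)))
        = weylScalars g D m n l (e.symm y) := by
    intro y hy t hseg
    have hp := heW (e.map_target hy)
    have hp' := heW (e.map_target (hseg (right_mem_segment ℝ y _)))
    have hgp : ∀ X Y : VField M, IsDragged ζ X W → IsDragged ζ Y W → _ := fun X Y hX hY =>
      he.independentOfV hΦ hU (hg.smoothFun (hX.smooth.mono heW) (hY.smooth.mono heW))
        (fun p hp => hX.dFun_metric hD oW hζW hY (heW hp)) y hy t hseg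
    have hFp : ∀ X Y : VField M, IsDragged ζ X W → IsDragged ζ Y W → _ := fun X Y hX hY =>
      he.independentOfV hΦ hU (SmoothTensorOn.apply (ContMDiffOn.mono hF he.source_subset) (hX.smooth.mono heW)
        (hY.smooth.mono heW)) (fun p hp => hK.dFun_eq_zero hU.isOpen hζ.smooth ha hKζ oW
          hW.subset hX hY (heW hp)) y hy t hseg
    have hcp : ∀ (X : VField M) (i : Fin 4), IsDragged ζ X W → _ := fun X i hX =>
      he.independentOfV_chartComp hΦ hU heW hX i y hy t hseg
    beta_reduce at hgp hFp hcp
    refine ⟨?_, ?_, ?_, ?_⟩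
    · have hfr : ∀ μ, npFrame m n l μ ∈ S := by
        intro μ
        fin_cases μ
        exacts [hm, hm', hr dn, hr dl]
      funext μ i
      simp only [frameComponents]
      rw [hcp _ i (hfr μ 0), hcp _ i (hfr μ 1)]
    · refine spinCoefficients_congr S (fun X Y Z hX hY hZ => ?_) hm hm' (hr dn) (hr dl)
      refine Finset.sum_congr rfl fun i _ => Finset.sum_congr rfl fun j _ =>
        Finset.sum_congr rfl fun k _ => ?_
      have h1 := hgp _ _ (hX i) ((hZ k).cov hg hD oW hζW (hY j))
      beta_reduce at h1
      rw [h1]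
    · refine maxwellScalars_congr S (fun X Y hX hY => ?_) hm hm' (hr dn) (hr dl)
      refine Finset.sum_congr rfl fun i _ => Finset.sum_congr rfl fun j _ => ?_
      rw [hFp _ _ (hX i) (hY j)]
    · refine weylScalars_congr S (fun X Y Z T hX hY hZ hT => ?_) hm hm' (hr dn) (hr dl)
      refine Finset.sum_congr rfl fun i _ => Finset.sum_congr rfl fun j _ =>
        Finset.sum_congr rfl fun k _ => Finset.sum_congr rfl fun l _ => ?_
      rw [weyl_eq_of_dragged hg hD oW hζW hp hp' hgp hE (hW.gram_det_ne_zero hg hp)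
        (hX i) (hY j) (hZ k) (hT l)]
  exact ⟨fun y hy t h => (key y hy t h).1, fun y hy t h => (key y hy t h).2.1,
    fun y hy t h => (key y hy t h).2.2.1, fun y hy t h => (key y hy t h).2.2.2⟩

end Main

end KillingHorizon

end

theorem mainTheorem10
    {M : Type*} [TopologicalSpace M] [T2Space M] [SecondCountableTopology M]
    [ChartedSpace R4 M] [IsManifold 𝓘(ℝ, R4) ∞ M]
    {B : Type*} [TopologicalSpace B] [T2Space B] [CompactSpace B] [ConnectedSpace B]
    [ChartedSpace R2 B] [IsManifold 𝓘(ℝ, R2) ∞ B]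
    (g : BField M) (hg : IsLorentzMetric g)
    (D : Conn M) (hD : IsLeviCivita g D)
    (Φ : B × ℝ → M) (hΦ : IsNonExpandingHorizon g D Φ)
    (U : Set M) (n ζ : VField M) (v r : M → ℝ)
    (hU : IsBondiNeighbourhood g D Φ U n ζ v r)
    (F : BField M) (c Λ : ℝ) (hc : 0 < c) (hF : IsElectrovac g D F c Λ U)
    (K : VField M) (hK : IsKillingOn g D K U) (hKF : LieInvariantOn K F U)
    (hK_tangent : ∀ q, K (Φ q) ∈ horizonTangent Φ q)
    (hK_null : ∀ q, g (Φ q) (K (Φ q)) (K (Φ q)) = 0)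
    (hζ : (IsInvariantField g D Φ ζ ∧ ∃ p ∈ U, K p ≠ 0) ∨ ∀ q, K (Φ q) = ζ (Φ q)) :
    ∃ a : ℝ, a ≠ 0 ∧ ((∀ q, K (Φ q) = ζ (Φ q)) → a = 1) ∧
      (∀ p ∈ U, K p = a • ζ p) ∧
      ∀ e : OpenPartialHomeomorph M R4, IsBondiChart U n ζ v r e →
        (∀ p ∈ e.source, K p = a • coordVec e 2 p) ∧
        ∀ (W : Set M) (m : CField M) (l : VField M), IsAdaptedFrame g D Φ U n ζ v W m l →
          e.source ⊆ W →
          IndependentOfV e (frameComponents e m n l) ∧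
          IndependentOfV e (spinCoefficients g D m n l) ∧
          IndependentOfV e (maxwellScalars F m n l) ∧
          IndependentOfV e (weylScalars g D m n l) := by
  obtain ⟨a, ha⟩ : ∃ a : ℝ, ∀ q, K (Φ q) = a • ζ (Φ q) := by
    rcases hζ with ⟨hζ, -⟩ | h
    · exact hζ.eq_smul_of_killing hg hD hΦ hU hK hK_tangent hK_null
    · exact ⟨1, fun q => by rw [h q, one_smul]⟩
  have haU := hU.eq_smul_zeta_of_horizon hg hD hΦ hK a ha
  obtain ⟨q₀⟩ : Nonempty (B × ℝ) := inferInstance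
  have ha1 : (∀ q, K (Φ q) = ζ (Φ q)) → a = 1 := fun h => by
    have h1 : (a - 1) • ζ (Φ q₀) = 0 := by rw [sub_smul, one_smul, ← ha, h, sub_self]
    exact sub_eq_zero.1 ((smul_eq_zero.1 h1).resolve_right (hU.zeta_ne_zero (hU.mem q₀)))
  have ha0 : a ≠ 0 := by
    rintro rfl
    rcases hζ with ⟨-, p, hp, hKp⟩ | h
    · exact hKp (by rw [haU p hp, zero_smul])
    · exact zero_ne_one (ha1 h)
  -- Since K = aζ on the open set U, also ∇K = a∇ζ there, and the Killing equation for K can be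
  -- divided by a.
  have hζK : IsKillingOn g D ζ U := by
    refine ⟨hU.smooth_zeta, fun x hx u w => ?_⟩
    have e : D K x = a • D ζ x := by
      rw [← cov_const_smul D a (hU.smooth_zeta.diffAt hU.isOpen hx)]
      exact cov_congr D (hK.smooth.diffAt hU.isOpen hx)
        ((hU.smooth_zeta.const_smul a).diffAt hU.isOpen hx)
        (Filter.eventually_of_mem (hU.isOpen.mem_nhds hx) haU)
    have h1 := hK.killing x hx u w
    simp only [e, smul_apply, map_smul, smul_eq_mul, ← mul_add] at h1
    exact (mul_eq_zero.1 h1).resolve_left ha0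
  refine ⟨a, ha0, ha1, haU, fun e he => ⟨fun p hp => ?_, fun W m l hW heW => ?_⟩⟩
  · rw [he.coordVec_eq hΦ hU hp, haU p (he.source_subset hp)]
  · exact he.independentOfV_frame hg hD hΦ hU hF.smooth hKF hζK ha0 haU hW heW
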